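/- Let $d\in\{1,2\}$ and let $Q$ be the ground state, i.e. the positive radial $H^1(\mathbb R^d)$ solution of $\Delta Q-Q+|Q|^{4/d}Q=0$. Write $\Lambda=\frac d2+y\cdot\nabla$, $(f,g)=\int fg$, and $$E(v)=\tfrac12\int|\nabla v|^2-\tfrac1{2+4/d}\int|v|^{2+4/d},\qquad P(v)=\Im\int\bar v\,\nabla v .$$ Profiles. Fix $\eta\in(0,1)$ and a family $(\tilde Q_b)_{b\ge0}$ with $\tilde Q_0=Q$ such that, for small $b\ge 0$, $b\mapsto\tilde Q_b$ is continuous into $H^1$, and for small $b>0$, with $R_b=\frac2b\sqrt{1-\eta}$, $\tilde Q_b=\chi_bQ_b$. Here $Q_b$ is smooth and radial, $\Delta Q_b-Q_b+ib\Lambda Q_b+|Q_b|^{4/d}Q_b=0$ and $e^{ib|y|^2/4}Q_b>0$ in $\{|y|<R_b\}$, $Q_b=0$ on $\{|y|=R_b\}$, and $\chi_b$ is a smooth radial cutoff with values in $[0,1]$, equal to $1$ for $|y|\le\sqrt{1-\eta}\,R_b$ and to $0$ for $|y|\ge R_b$. Let $\Gamma_b$ satisfy $c\,e^{-\pi/b}\le\Gamma_b\le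 C\,e^{-\pi/b}$ for small $b>0$, with constants $c,C>0$. Equation. Let $\phi_1,\dots,\phi_N$ be real Schwartz functions on $\mathbb R^d$, let $B_1,\dots,B_N$ be continuous real paths on $[0,\infty)$ (for instance sample paths of Brownian motions), $W(t,x)=\sum_k\phi_k(x)B_k(t)$, $\beta_j=2\partial_jW$, $c=-|\nabla W|^2+i\Delta W$, and consider $$iu_t+\Delta u+\sum_j i\beta_j\partial_ju+cu+|u|^{4/d}u=0 .\tag{1}$$ Put $\|f\|_M=\sup_{|\alpha|,|\beta|\le10}\|x^\alpha\partial^\beta f\|_{L^\infty}$. Solutions on $[0,T_1]$ are mild solutions in $C([0,T_1];H^1)$. Statement. There is $\alpha>0$, depending only on $d,\eta$, the family $(\tilde Q_b)$ and $\Gamma$, such that for all $K,A>0$ there is $\lambda^*>0$ with the following property. Let $\sup_{t\in[0,1]}\big(\sum_j\|\beta_j(t)\|_M+\|c(t)\|_M\big)\le K$, let $T_1>0$, and let $u$ solve (1) on $[0,T_1]$ with $u(0)=u_0$, where: (i) $u_0(x)=\lambda_0^{-d/2}(\tilde Q_{b_0}+\epsilon_0)(x/\lambda_0)$ with $\epsilon_0\in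 H^1$, $0<\lambda_0\le\lambda^*$, $b_0>0$, $\|\epsilon_0\|_{L^2}+b_0<\alpha$, $\lambda_0\le e^{-(1/\Gamma_{b_0})^{4/5}}$, $\int|\nabla\epsilon_0|^2+|\epsilon_0|^2e^{-|y|}\le\Gamma_{b_0}^{4/5}$, $|E(u_0)|\le1000$, $|P(u_0)|\le1000$, and $$\Re(|y|^2\tilde Q_{b_0},\overline{\epsilon_0})=0,\quad \Re(y\tilde Q_{b_0},\overline{\epsilon_0})=0,\quad \Re(i\Lambda\tilde Q_{b_0},\overline{\epsilon_0})=0,\quad \Re(i\Lambda^2\tilde Q_{b_0},\overline{\epsilon_0})=0;$$ (ii) for $t\in[0,T_1]$, $u(t,x)=\lambda(t)^{-d/2}(\tilde Q_{b(t)}+\epsilon(t))\big(\tfrac{x-x(t)}{\lambda(t)}\big)e^{i\gamma(t)}$ with $\epsilon(t)\in H^1$ satisfying the same four orthogonality conditions with respect to $\tilde Q_{b(t)}$; (iii) the bootstrap assumptions hold on $[0,T_1]$: $\lambda(t)>0$, $b(t)>0$, $\|\epsilon(t)\|_{L^2}+b(t)<\alpha$; $\lambda(t')\le\frac32\lambda(t)$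 for $t\le t'$ in $[0,T_1]$; $\lambda(t)\le e^{-(1/\Gamma_{b(t)})^{2/3}}$; $\int|\nabla\epsilon(t)|^2+|\epsilon(t)|^2e^{-|y|}\le\Gamma_{b(t)}^{2/3}$; and there are integers $0\le m\le n$ and times $0=t_m\le t_{m+1}\le\dots\le t_n=T_1$ such that, for $m\le k<n$, $A^{-1}2^{-k}\le\lambda(t)\le A2^{-k}$ on $[t_k,t_{k+1}]$ and $t_{k+1}-t_k\le A\,k\,\lambda(t_k)^2$. Then for all $t\in[0,T_1]$, $$\lambda(t)^2|E(u(t))|\le\Gamma_{b(t)}^{10}\qquad\text{and}\qquad\lambda(t)\,|P(u(t))|\le\Gamma_{b(t)}^{10}.$$ -/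

import Mathlib

open MeasureTheory Filter Topology Set
open scoped FourierTransform LineDeriv Laplacian SchwartzMap ENNReal ContDiff

noncomputable section

namespace LogLogNLS

/-- The space `ℝᵈ` with its Euclidean structure. -/
abbrev Sp (d : ℕ) : Type := EuclideanSpace ℝ (Fin d)

/-- Complex-valued `L²(ℝᵈ)`. -/
abbrev L2 (d : ℕ) : Type := Lp ℂ 2 (volume : Measure (Sp d))

/-- The `j`-th standard basis vector of `ℝᵈ`. -/
abbrev stdVec {d : ℕ} (j : Fin d) : Sp d := EuclideanSpace.single j (1 : ℝ)

/-! ### The Sobolev space `H¹` -/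

/-- `H¹(ℝᵈ)`, realised as the space of pairs `(f, ∇f)` with `f ∈ L²` and distributional partial
derivatives `∂ⱼ f ∈ L²`.  The induced norm is `(‖f‖² + ∑ⱼ ‖∂ⱼ f‖²)^{1/2}`. -/
def h1Submodule (d : ℕ) : Submodule ℂ (WithLp 2 (L2 d × PiLp 2 (fun _ : Fin d => L2 d))) where
  carrier := {p | ∀ j : Fin d,
    ∂_{stdVec j} (Lp.toTemperedDistributionCLM ℂ (volume : Measure (Sp d)) 2 p.fst)
      = Lp.toTemperedDistributionCLM ℂ (volume : Measure (Sp d)) 2 (p.snd j)}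
  add_mem' := by
    intro p q hp hq j
    have h1 := hp j
    have h2 := hq j
    simp only [WithLp.add_fst, WithLp.add_snd, PiLp.add_apply, map_add,
      LineDeriv.lineDerivOp_add, h1, h2]
  zero_mem' := by
    intro j
    simp only [WithLp.zero_fst, WithLp.zero_snd, PiLp.zero_apply, map_zero]
    exact (LineDeriv.lineDerivOpCLM ℂ 𝓢'(Sp d, ℂ) (stdVec j)).map_zero
  smul_mem' := by
    intro c p hp j
    have h1 := hp j
    simp only [WithLp.smul_fst, WithLp.smul_snd, PiLp.smul_apply, map_smul,
      LineDeriv.lineDerivOp_smul, h1]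

/-- The space `H¹(ℝᵈ)` with its norm. -/
abbrev H1 (d : ℕ) : Type := h1Submodule d

/-- The underlying `L²` function of an `H¹` function. -/
def H1.fn {d : ℕ} (v : H1 d) : L2 d := v.1.fst

/-- The weak partial derivative `∂ⱼ v ∈ L²` of an `H¹` function. -/
def H1.pd {d : ℕ} (v : H1 d) (j : Fin d) : L2 d := v.1.snd j

/-- `E(v) = ½ ∫ |∇v|² - (2 + 4/d)⁻¹ ∫ |v|^{2 + 4/d}`. -/
def energy {d : ℕ} (v : H1 d) : ℝ :=
  (1 / 2) * (∫ x, ∑ j, ‖v.pd j x‖ ^ 2)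
    - 1 / (2 + 4 / (d : ℝ)) * ∫ x, ‖v.fn x‖ ^ (2 + 4 / (d : ℝ))

/-- `P(v) = Im ∫ v̄ ∇v ∈ ℝᵈ`. -/
def momentum {d : ℕ} (v : H1 d) : Sp d :=
  WithLp.toLp 2 fun j => (∫ x, (starRingEnd ℂ) (v.fn x) * v.pd j x).im

/-! ### The free Schrödinger group and the equation with path-dependent coefficients -/

/-- The symbol `exp(-4π² i t |ξ|²)` of `exp(itΔ)` (for the Fourier kernel `exp(-2πi x·ξ)`). -/
def schrodingerSymbol (d : ℕ) (t : ℝ) (ξ : Sp d) : ℂ :=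
  Complex.exp (((-(4 * Real.pi ^ 2 * t * ‖ξ‖ ^ 2) : ℝ) : ℂ) * Complex.I)

theorem memLp_schrodingerSymbol (d : ℕ) (t : ℝ) :
    MemLp (schrodingerSymbol d t) ∞ (volume : Measure (Sp d)) := by
  refine memLp_top_of_bound ?_ 1 (Eventually.of_forall fun ξ => ?_)
  · refine Continuous.aestronglyMeasurable ?_
    unfold schrodingerSymbol
    fun_prop
  · rw [schrodingerSymbol, Complex.norm_exp_ofReal_mul_I]

/-- The free Schrödinger group `exp(itΔ)` on `L²`, as a Fourier multiplier. -/
def freeGroup {d : ℕ} (t : ℝ) (f : L2 d) : L2 d :=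
  𝓕⁻ ((memLp_schrodingerSymbol d t).toLp (schrodingerSymbol d t) • 𝓕 f : L2 d)

/-- `βⱼ(t, x) = 2 ∂ⱼ W(t, x) = 2 ∑ₖ ∂ⱼφₖ(x) Bₖ(t)`, where `W(t, x) = ∑ₖ φₖ(x) Bₖ(t)`. -/
def coeffBeta {d N : ℕ} (φ : Fin N → 𝓢(Sp d, ℝ)) (B : Fin N → ℝ → ℝ) (j : Fin d)
    (t : ℝ) (x : Sp d) : ℝ :=
  2 * ∑ k, (∂_{stdVec j} (φ k)) x * B k t

/-- `c(t, x) = -∑ⱼ (∑ₖ ∂ⱼφₖ(x) Bₖ(t))² + i ∑ₖ Δφₖ(x) Bₖ(t)`. -/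
def coeffC {d N : ℕ} (φ : Fin N → 𝓢(Sp d, ℝ)) (B : Fin N → ℝ → ℝ)
    (t : ℝ) (x : Sp d) : ℂ :=
  ((-∑ j : Fin d, (∑ k, (∂_{stdVec j} (φ k)) x * B k t) ^ 2 : ℝ) : ℂ)
    + Complex.I * ((∑ k, (Δ (φ k)) x * B k t : ℝ) : ℂ)

/-- `‖f‖_M = sup_{|α|, |β| ≤ 10} ‖x^α ∂^β f‖_{L^∞}` for smooth `f`, with values in `[0, ∞]`.
A derivative `∂^β` with `|β| = n` is listed through the word `w` of its directions. -/
def normM {d : ℕ} {F : Type*} [NormedAddCommGroup F] [NormedSpace ℝ F] (f : Sp d → F) : ℝ≥0∞ :=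
  ⨆ (α : Fin d → ℕ) (_ : ∑ i, α i ≤ 10) (n : ℕ) (_ : n ≤ 10) (w : Fin n → Fin d) (x : Sp d),
    ‖(∏ i, x i ^ α i) • iteratedFDeriv ℝ n f x (fun l => stdVec (w l))‖ₑ

/-- The path satisfies `∑ⱼ ‖βⱼ(t)‖_M + ‖c(t)‖_M ≤ K` for all `t ∈ [0, 1]`. -/
def CoeffBound {d N : ℕ} (φ : Fin N → 𝓢(Sp d, ℝ)) (B : Fin N → ℝ → ℝ) (K : ℝ) : Prop :=
  ∀ t ∈ Icc (0 : ℝ) 1,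
    (∑ j, normM (coeffBeta φ B j t)) + normM (coeffC φ B t) ≤ ENNReal.ofReal K

/-- `u ∈ C([0, T]; H¹)` is a mild solution on `[0, T]` of
`i uₜ + Δu + ∑ⱼ i βⱼ ∂ⱼu + c u + |u|^{4/d} u = 0`, that is
`u(t) = e^{itΔ} u(0) + i ∫₀ᵗ e^{i(t-s)Δ} G(s) ds` in `L²`, where `G` is the sum of the last three
terms. -/
def IsMildSolution {d N : ℕ} (φ : Fin N → 𝓢(Sp d, ℝ)) (B : Fin N → ℝ → ℝ) (T : ℝ)
    (u : ℝ → H1 d) : Prop :=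
  ContinuousOn u (Icc 0 T) ∧
  ∃ G : ℝ → L2 d,
    IntervalIntegrable G volume 0 T ∧
    (∀ t ∈ Icc 0 T, ∀ᵐ x : Sp d,
      G t x = (∑ j, Complex.I * (coeffBeta φ B j t x : ℂ) * (u t).pd j x)
        + coeffC φ B t x * (u t).fn x
        + ((‖(u t).fn x‖ ^ (4 / (d : ℝ)) : ℝ) : ℂ) * (u t).fn x) ∧
    ∀ t ∈ Icc 0 T,
      (u t).fn = freeGroup t (u 0).fn + Complex.I • ∫ s in (0 : ℝ)..t, freeGroup (t - s) (G s)

/-! ### Ground state and localized profiles -/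

/-- `Q` is the ground state: a positive radial `H¹` solution of `ΔQ - Q + |Q|^{4/d} Q = 0`. -/
structure IsGroundState {d : ℕ} (Q : Sp d → ℝ) : Prop where
  contDiff : ContDiff ℝ 2 Q
  pos : ∀ x, 0 < Q x
  radial : ∀ x y, ‖x‖ = ‖y‖ → Q x = Q y
  memH1 : ∃ v : H1 d, ∀ᵐ x, v.fn x = (Q x : ℂ)
  equation : ∀ x, (Δ Q) x - Q x + |Q x| ^ (4 / (d : ℝ)) * Q x = 0

/-- The generator `Λ = d/2 + y·∇` of the `L²` scaling. -/
def scalingGen {d : ℕ} (f : Sp d → ℂ) (y : Sp d) : ℂ :=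
  ((d : ℝ) / 2 : ℝ) * f y + fderiv ℝ f y y

/-- `f` is a localized self-similar profile with parameters `b > 0` and `η ∈ (0, 1)`: `f = χ q`,
where, with `R = (2/b) √(1-η)`, the radial function `q` solves
`Δq - q + i b Λq + |q|^{4/d} q = 0` in the ball `|y| < R`, `e^{i b |y|²/4} q` is positive there and
`q` vanishes on `|y| = R`, and where `χ` is a smooth radial cutoff with values in `[0, 1]`, equal
to `1` for `|y| ≤ √(1-η) R` and to `0` for `|y| ≥ R`. -/
def IsLocalizedProfile {d : ℕ} (η b : ℝ) (f : Sp d → ℂ) : Prop :=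
  ∃ (q : Sp d → ℂ) (χ : Sp d → ℝ) (R : ℝ),
    R = 2 / b * √(1 - η) ∧
    ContDiff ℝ ∞ q ∧ (∀ x y, ‖x‖ = ‖y‖ → q x = q y) ∧
    (∀ y, ‖y‖ < R →
      (Δ q) y - q y + Complex.I * (b : ℂ) * scalingGen q y
        + ((‖q y‖ ^ (4 / (d : ℝ)) : ℝ) : ℂ) * q y = 0) ∧
    (∀ y, ‖y‖ < R → ∃ p : ℝ, 0 < p ∧
      Complex.exp (Complex.I * ((b * ‖y‖ ^ 2 / 4 : ℝ) : ℂ)) * q y = (p : ℂ)) ∧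
    (∀ y, ‖y‖ = R → q y = 0) ∧
    ContDiff ℝ ∞ χ ∧ (∀ x y, ‖x‖ = ‖y‖ → χ x = χ y) ∧ (∀ y, χ y ∈ Icc (0 : ℝ) 1) ∧
    (∀ y, ‖y‖ ≤ √(1 - η) * R → χ y = 1) ∧ (∀ y, R ≤ ‖y‖ → χ y = 0) ∧
    ∀ y, f y = (χ y : ℂ) * q y

/-- `b ↦ Q̃_b` is a continuous family of approximations of the ground state `Q`: for small `b > 0`
each `Q̃_b` is a localized self-similar profile, `Q̃_0 = Q`, and `b ↦ Q̃_b` is continuous with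
values in `H¹` for small `b ≥ 0`. -/
structure IsProfileFamily {d : ℕ} (η : ℝ) (Q : Sp d → ℝ) (Qt : ℝ → Sp d → ℂ) : Prop where
  zero : ∀ y, Qt 0 y = (Q y : ℂ)
  profile : ∃ bs > 0, (∀ b ∈ Ioo 0 bs, IsLocalizedProfile η b (Qt b)) ∧
    ∃ v : ℝ → H1 d, ContinuousOn v (Ico 0 bs) ∧ ∀ b ∈ Ico 0 bs, ∀ᵐ y, (v b).fn y = Qt b y

/-- `Γ_b ∼ e^{-π/b}` for small `b > 0`. -/
def IsGammaLike (Γ : ℝ → ℝ) : Prop :=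
  ∃ c > 0, ∃ C > 0, ∃ bs > 0, ∀ b ∈ Ioo 0 bs,
    c * Real.exp (-Real.pi / b) ≤ Γ b ∧ Γ b ≤ C * Real.exp (-Real.pi / b)

/-! ### Modulated decomposition, initial data and the bootstrap regime -/

/-- `v(x) = l^{-d/2} (Q̃_b + ε)((x - x₀)/l) e^{iγ}` for almost every `x`. -/
def IsModulated {d : ℕ} (Qb : Sp d → ℂ) (ε : H1 d) (l : ℝ) (x₀ : Sp d) (γ : ℝ) (v : H1 d) :
    Prop :=
  ∀ᵐ x : Sp d, v.fn x = ((l ^ (-((d : ℝ) / 2)) : ℝ) : ℂ)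
    * (Qb (l⁻¹ • (x - x₀)) + ε.fn (l⁻¹ • (x - x₀))) * Complex.exp (Complex.I * (γ : ℂ))

/-- The orthogonality conditions
`Re(|y|² Q̃_b, ε̄) = 0`, `Re(y Q̃_b, ε̄) = 0`, `Re(i Λ Q̃_b, ε̄) = 0`, `Re(i Λ² Q̃_b, ε̄) = 0`,
where `(f, g) = ∫ f g`. -/
structure IsOrthogonal {d : ℕ} (Qb : Sp d → ℂ) (ε : H1 d) : Prop where
  sq : (∫ y, ((‖y‖ ^ 2 : ℝ) : ℂ) * Qb y * (starRingEnd ℂ) (ε.fn y)).re = 0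
  lin : ∀ j : Fin d, (∫ y : Sp d, (y j : ℂ) * Qb y * (starRingEnd ℂ) (ε.fn y)).re = 0
  gen : (∫ y, Complex.I * scalingGen Qb y * (starRingEnd ℂ) (ε.fn y)).re = 0
  gen_sq : (∫ y, Complex.I * scalingGen (scalingGen Qb) y * (starRingEnd ℂ) (ε.fn y)).re = 0

/-- `∫ |∇ε|² + |ε|² e^{-|y|} dy`. -/
def localNormSq {d : ℕ} (ε : H1 d) : ℝ :=
  ∫ y : Sp d, ((∑ j, ‖ε.pd j y‖ ^ 2) + ‖ε.fn y‖ ^ 2 * Real.exp (-‖y‖))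

/-- The initial datum `u₀ = λ₀^{-d/2} (Q̃_{b₀} + ε₀)(x/λ₀)` with its orthogonality conditions and
smallness conditions, and with energy and momentum at most `1000`. -/
structure IsInitialDatum {d : ℕ} (α : ℝ) (Γ : ℝ → ℝ) (Qt : ℝ → Sp d → ℂ)
    (b₀ l₀ : ℝ) (ε₀ u₀ : H1 d) : Prop where
  l_pos : 0 < l₀
  form : IsModulated (Qt b₀) ε₀ l₀ 0 0 u₀
  orth : IsOrthogonal (Qt b₀) ε₀
  b_pos : 0 < b₀
  small : ‖ε₀.fn‖ + b₀ < α
  l_le : l₀ ≤ Real.exp (-((1 / Γ b₀) ^ (4 / 5 : ℝ)))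
  local_le : localNormSq ε₀ ≤ Γ b₀ ^ (4 / 5 : ℝ)
  energy_le : |energy u₀| ≤ 1000
  momentum_le : ‖momentum u₀‖ ≤ 1000

/-- The bootstrap assumptions on `[0, T]`, where `A` bounds all the implicit constants.  The times
`τ_m = 0 ≤ τ_{m+1} ≤ ⋯ ≤ τ_n = T` form the partition with `λ(t) ∼ 2^{-k}` on
`[τ_k, τ_{k+1}]`. -/
structure IsBootstrap {d : ℕ} (α A : ℝ) (Γ : ℝ → ℝ) (T : ℝ) (b l : ℝ → ℝ) (ε : ℝ → H1 d) :
    Prop where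
  l_pos : ∀ t ∈ Icc 0 T, 0 < l t
  b_pos : ∀ t ∈ Icc 0 T, 0 < b t
  small : ∀ t ∈ Icc 0 T, ‖(ε t).fn‖ + b t < α
  almost_mono : ∀ t ∈ Icc 0 T, ∀ t' ∈ Icc 0 T, t ≤ t' → l t' ≤ 3 / 2 * l t
  l_le : ∀ t ∈ Icc 0 T, l t ≤ Real.exp (-((1 / Γ (b t)) ^ (2 / 3 : ℝ)))
  local_le : ∀ t ∈ Icc 0 T, localNormSq (ε t) ≤ Γ (b t) ^ (2 / 3 : ℝ)
  partition : ∃ (m n : ℕ) (τ : ℕ → ℝ), m ≤ n ∧ τ m = 0 ∧ τ n = T ∧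
    ∀ k, m ≤ k → k < n → τ k ≤ τ (k + 1) ∧
      (∀ t ∈ Icc (τ k) (τ (k + 1)),
        A⁻¹ * (2 : ℝ)⁻¹ ^ k ≤ l t ∧ l t ≤ A * (2 : ℝ)⁻¹ ^ k) ∧
      τ (k + 1) - τ k ≤ A * k * l (τ k) ^ 2

end LogLogNLS

end

/-! Energy and momentum are not conserved by (1), but their drift is bounded by norms that the
bootstrap regime controls through the scale. Writing `N(u) = |u|^{4/d} u` and absorbing the size of
the coefficients into `K'`, the energy changes at rate at most `K' (‖u‖² + ‖N(u)‖ ‖u‖)` and each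
momentum component at rate at most `2 K' ‖u‖²`, where `‖u‖` is the `H¹` norm. No derivative beyond
the first appears: the first order terms have real coefficients `β`, so `β·∇` is antisymmetric up to
a zeroth order term, and the purely nonlinear contributions cancel.

In the bootstrap regime `Q̃_b + ε` is bounded in `H¹` and its gradient stays away from zero, because
`Q̃_b` is close to `Q` and `ε` is small (`exists_threshold`). By the mass-critical scaling `‖u‖ ≲
1/λ` and `‖N(u)‖ ≲ 1/λ²`, so the energy rate is at most of order `λ⁻³` and the momentum rate of
order `λ⁻²`. Multiplying by `λ(t)²`, respectively `λ(t)`, and using `λ(t) ≤ (3/2) λ(s)` for the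
energy, both integrands become `≲ λ(t) λ(s)⁻²`. The solution spends time `≲ k λ²` at scale `2⁻ᵏ`, so
the integral up to a time at scale `2⁻ᴺ` is `≲ λ(t) ∑_{k ≤ N} k ≲ λ(t) (N+1)² ≲ √λ(t)`
(`exists_integral_le_sqrt`). Initial values of size `1000` are absorbed in the same way. Finally `C
√λ ≤ λ^{1/4}` when `λ*` is small, and `λ ≤ exp(-Γ^{-2/3})` makes `λ^{1/4} ≤ Γ^{10}`
(`exists_exp_le_pow`).

The analytic difficulty is to justify the energy identity for a mild solution which is only `H¹`.
Let `T = (1 - sΔ)⁻¹` with `s = 4⁻ʲ`. The energy is replaced by `(1/2s) ⟨(1-T)u, u⟩` minus the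
potential energy of `Tu`; this is differentiable along the flow and tends to the energy as `j → ∞`.
Its derivative has the expected terms plus errors containing `δ = N(u) - N(Tu)` (`energyRate_eq`).
Since `‖Tu‖_∞` grows at most like `√(1+j)`, a logarithmic loss that occurs only in dimension two,
the worst error is `(1+j) s⁻¹ ‖u - Tu‖²` (`exists_abs_energyRate_le`). The quantities `s⁻¹ ‖u -
Tu‖²` are merely bounded one by one, but they are summable over the scales by a telescoping argument
(`sum_inv_mul_norm_sub_res_sq_le`). The harmonic series diverges, so along infinitely many `j` even
the time integral multiplied by `1+j` is as small as desired (`frequently_lt_of_sum_le`), and those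
scales yield `IsPerturbedFlow.abs_energy_sub_le`. The momentum needs no such choice, since its error
is `O((1+j)√s)`. -/

noncomputable section

namespace LogLogNLS

variable {d : ℕ}

/-! ### Multiplication operators and Fourier multipliers on `L²` -/

/-- Multiplication by an essentially bounded function on `L²` (zero if `m` is not in `L^∞`). -/
def mulOp (m : Sp d → ℂ) : L2 d →L[ℂ] L2 d :=
  open Classical in
  if h : MemLp m ∞ (volume : Measure (Sp d)) then
    LinearMap.mkContinuousOfExistsBound
      { toFun := fun f => (h.toLp m • f : L2 d)
        map_add' := fun f g => by
          refine Lp.ext ?_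
          filter_upwards [Lp.coeFn_lpSMul (r := 2) (h.toLp m) (f + g),
            Lp.coeFn_lpSMul (r := 2) (h.toLp m) f, Lp.coeFn_lpSMul (r := 2) (h.toLp m) g,
            Lp.coeFn_add f g,
            Lp.coeFn_add (h.toLp m • f : L2 d) (h.toLp m • g : L2 d)] with x h1 h2 h3 h4 h5
          rw [h1, h5, Pi.smul_apply', h4, Pi.add_apply, Pi.add_apply, h2, h3, smul_add]
          rfl
        map_smul' := fun c f => by
          refine Lp.ext ?_
          filter_upwards [Lp.coeFn_lpSMul (r := 2) (h.toLp m) (c • f),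
            Lp.coeFn_lpSMul (r := 2) (h.toLp m) f, Lp.coeFn_smul c f,
            Lp.coeFn_smul c (h.toLp m • f : L2 d)] with x h1 h2 h3 h4
          rw [RingHom.id_apply, h1, h4, Pi.smul_apply', h3, Pi.smul_apply, Pi.smul_apply, h2,
            smul_comm]
          rfl }
      ⟨‖h.toLp m‖, fun f => Lp.norm_smul_le _ _⟩
  else 0

theorem mulOp_eq {m : Sp d → ℂ} (h : MemLp m ∞ (volume : Measure (Sp d))) (f : L2 d) :
    mulOp m f = (h.toLp m • f : L2 d) := by
  simp only [mulOp, dif_pos h]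
  rfl

theorem mulOp_coeFn {m : Sp d → ℂ} (h : MemLp m ∞ (volume : Measure (Sp d))) (f : L2 d) :
    mulOp m f =ᵐ[volume] fun x => m x * f x := by
  rw [mulOp_eq h]
  filter_upwards [Lp.coeFn_lpSMul (r := 2) (h.toLp m) f, h.coeFn_toLp] with x h1 h2
  simp [h1, h2]

theorem norm_mulOp_le {m : Sp d → ℂ} {C : ℝ} (hC : 0 ≤ C) (hm : ∀ x, ‖m x‖ ≤ C) (f : L2 d) :
    ‖mulOp m f‖ ≤ C * ‖f‖ := by
  by_cases h : MemLp m ∞ (volume : Measure (Sp d))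
  · refine Lp.norm_le_mul_norm_of_ae_le_mul ?_
    filter_upwards [mulOp_coeFn h f] with x hx
    rw [hx, norm_mul]
    exact mul_le_mul_of_nonneg_right (hm x) (norm_nonneg _)
  · simp only [mulOp, dif_neg h, zero_apply, norm_zero]
    positivity

theorem memLp_top_mul {m₁ m₂ : Sp d → ℂ} (h₁ : MemLp m₁ ∞ (volume : Measure (Sp d)))
    (h₂ : MemLp m₂ ∞ (volume : Measure (Sp d))) :
    MemLp (fun x => m₁ x * m₂ x) ∞ (volume : Measure (Sp d)) :=
  h₂.mul h₁

theorem mulOp_mulOp {m₁ m₂ : Sp d → ℂ} (h₁ : MemLp m₁ ∞ (volume : Measure (Sp d)))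
    (h₂ : MemLp m₂ ∞ (volume : Measure (Sp d))) (f : L2 d) :
    mulOp m₁ (mulOp m₂ f) = mulOp (fun x => m₁ x * m₂ x) f := by
  refine Lp.ext ?_
  filter_upwards [mulOp_coeFn h₁ (mulOp m₂ f), mulOp_coeFn h₂ f,
    mulOp_coeFn (memLp_top_mul h₁ h₂) f] with x hx1 hx2 hx3
  rw [hx1, hx2, hx3, mul_assoc]

theorem inner_eq_integral (f g : L2 d) :
    inner ℂ f g = ∫ x, (starRingEnd ℂ) (f x) * g x := by
  rw [L2.inner_def]
  refine integral_congr_ae (Eventually.of_forall fun x => ?_)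
  simp [mul_comm]

theorem norm_sq_eq_integral (f : L2 d) : ‖f‖ ^ 2 = ∫ x, ‖f x‖ ^ 2 := by
  have h := norm_sq_eq_re_inner (𝕜 := ℂ) f
  rw [inner_eq_integral] at h
  have : ∀ x, (starRingEnd ℂ) (f x) * f x = ((‖f x‖ ^ 2 : ℝ) : ℂ) := fun x => by
    rw [mul_comm, Complex.mul_conj, Complex.normSq_eq_norm_sq]
  simp_rw [this] at h
  rw [integral_complex_ofReal] at h
  exact h

theorem integrable_norm_sq (f : L2 d) : Integrable (fun x => ‖f x‖ ^ 2) volume :=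
  (memLp_two_iff_integrable_sq_norm (Lp.aestronglyMeasurable f)).1 (Lp.memLp f)

theorem inner_mulOp {m : Sp d → ℂ} (h : MemLp m ∞ (volume : Measure (Sp d))) (f g : L2 d) :
    inner ℂ (mulOp (fun x => (starRingEnd ℂ) (m x)) f) g = inner ℂ f (mulOp m g) := by
  have h' : MemLp (fun x => (starRingEnd ℂ) (m x)) ∞ (volume : Measure (Sp d)) :=
    h.star
  rw [inner_eq_integral, inner_eq_integral]
  refine integral_congr_ae ?_
  filter_upwards [mulOp_coeFn h g, mulOp_coeFn h' f] with x h1 h2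
  rw [h1, h2, map_mul, Complex.conj_conj]
  ring

/-- Dominated convergence for `|mᵢ - m₀|² |f|²`. Only strong convergence can be expected: the
symbols used later (resolvents as `s → 0`, the free group in time) converge pointwise but not
uniformly. -/
theorem tendsto_mulOp {ι : Type*} {l : Filter ι} [l.IsCountablyGenerated]
    {m : ι → Sp d → ℂ} {m₀ : Sp d → ℂ} {C : ℝ}
    (hm : ∀ i, MemLp (m i) ∞ (volume : Measure (Sp d)))
    (hm₀ : MemLp m₀ ∞ (volume : Measure (Sp d)))
    (hC : ∀ᶠ i in l, ∀ x, ‖m i x - m₀ x‖ ≤ C)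
    (hlim : ∀ᵐ x, Tendsto (fun i => m i x) l (𝓝 (m₀ x))) (f : L2 d) :
    Tendsto (fun i => mulOp (m i) f) l (𝓝 (mulOp m₀ f)) := by
  have key : ∀ i, ‖mulOp (m i) f - mulOp m₀ f‖ ^ 2 = ∫ x, ‖m i x - m₀ x‖ ^ 2 * ‖f x‖ ^ 2 := by
    intro i
    rw [norm_sq_eq_integral]
    refine integral_congr_ae ?_
    filter_upwards [mulOp_coeFn (hm i) f, mulOp_coeFn hm₀ f,
      Lp.coeFn_sub (mulOp (m i) f) (mulOp m₀ f)] with x h1 h2 h3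
    rw [h3, Pi.sub_apply, h1, h2, ← sub_mul, norm_mul, mul_pow]
  have hsq : Tendsto (fun i => ‖mulOp (m i) f - mulOp m₀ f‖ ^ 2) l (𝓝 0) := by
    simp_rw [key]
    have h0 : (0 : ℝ) = ∫ x : Sp d, (0 : ℝ) := by simp
    rw [h0]
    refine tendsto_integral_filter_of_dominated_convergence (fun x => C ^ 2 * ‖f x‖ ^ 2) ?_ ?_
      ((integrable_norm_sq f).const_mul _) ?_
    · refine Eventually.of_forall fun i => ?_
      exact ((((hm i).1.sub hm₀.1).norm.pow 2).mul ((Lp.aestronglyMeasurable f).norm.pow 2))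
    · filter_upwards [hC] with i hi
      refine Eventually.of_forall fun x => ?_
      rw [Real.norm_of_nonneg (by positivity)]
      have := hi x
      gcongr
    · filter_upwards [hlim] with x hx
      have : Tendsto (fun i => ‖m i x - m₀ x‖ ^ 2 * ‖f x‖ ^ 2) l
          (𝓝 (‖m₀ x - m₀ x‖ ^ 2 * ‖f x‖ ^ 2)) := ((hx.sub_const _).norm.pow 2).mul_const _
      simpa using this
  rw [tendsto_iff_norm_sub_tendsto_zero]
  have := hsq.sqrt
  simpa [Real.sqrt_sq] using this

/-- The Fourier multiplier with symbol `m` on `L²`. -/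
def fmul (m : Sp d → ℂ) : L2 d →L[ℂ] L2 d :=
  ((Lp.fourierTransformₗᵢ (Sp d) ℂ).symm : L2 d →L[ℂ] L2 d) ∘L mulOp m ∘L
    ((Lp.fourierTransformₗᵢ (Sp d) ℂ) : L2 d →L[ℂ] L2 d)

theorem fmul_apply (m : Sp d → ℂ) (f : L2 d) : fmul m f = 𝓕⁻ (mulOp m (𝓕 f)) := rfl

theorem fourier_fmul (m : Sp d → ℂ) (f : L2 d) : 𝓕 (fmul m f) = mulOp m (𝓕 f) := by
  rw [fmul_apply, FourierTransform.fourier_fourierInv_eq]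

theorem norm_fourier (f : L2 d) : ‖𝓕 f‖ = ‖f‖ := Lp.norm_fourier_eq f

theorem fourier_injective : Function.Injective (𝓕 : L2 d → L2 d) :=
  (Lp.fourierTransformₗᵢ (Sp d) ℂ).injective

theorem norm_fmul_le {m : Sp d → ℂ} {C : ℝ} (hC : 0 ≤ C) (hm : ∀ x, ‖m x‖ ≤ C) (f : L2 d) :
    ‖fmul m f‖ ≤ C * ‖f‖ := by
  rw [← norm_fourier, fourier_fmul, ← norm_fourier f]
  exact norm_mulOp_le hC hm _

theorem fmul_fmul {m₁ m₂ : Sp d → ℂ} (h₁ : MemLp m₁ ∞ (volume : Measure (Sp d)))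
    (h₂ : MemLp m₂ ∞ (volume : Measure (Sp d))) (f : L2 d) :
    fmul m₁ (fmul m₂ f) = fmul (fun x => m₁ x * m₂ x) f := by
  apply fourier_injective
  rw [fourier_fmul, fourier_fmul, fourier_fmul, mulOp_mulOp h₁ h₂]

theorem fmul_comm {m₁ m₂ : Sp d → ℂ} (h₁ : MemLp m₁ ∞ (volume : Measure (Sp d)))
    (h₂ : MemLp m₂ ∞ (volume : Measure (Sp d))) (f : L2 d) :
    fmul m₁ (fmul m₂ f) = fmul m₂ (fmul m₁ f) := by
  rw [fmul_fmul h₁ h₂, fmul_fmul h₂ h₁]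
  simp_rw [mul_comm]

theorem inner_fmul {m : Sp d → ℂ} (h : MemLp m ∞ (volume : Measure (Sp d))) (f g : L2 d) :
    inner ℂ (fmul (fun x => (starRingEnd ℂ) (m x)) f) g = inner ℂ f (fmul m g) := by
  rw [← Lp.inner_fourier_eq, ← Lp.inner_fourier_eq f, fourier_fmul, fourier_fmul, inner_mulOp h]

theorem inner_fmul_of_real {m : Sp d → ℝ}
    (h : MemLp (fun x => (m x : ℂ)) ∞ (volume : Measure (Sp d))) (f g : L2 d) :
    inner ℂ (fmul (fun x => (m x : ℂ)) f) g = inner ℂ f (fmul (fun x => (m x : ℂ)) g) := by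
  rw [← inner_fmul h]
  simp

theorem tendsto_fmul {ι : Type*} {l : Filter ι} [l.IsCountablyGenerated]
    {m : ι → Sp d → ℂ} {m₀ : Sp d → ℂ} {C : ℝ}
    (hm : ∀ i, MemLp (m i) ∞ (volume : Measure (Sp d)))
    (hm₀ : MemLp m₀ ∞ (volume : Measure (Sp d)))
    (hC : ∀ᶠ i in l, ∀ x, ‖m i x - m₀ x‖ ≤ C)
    (hlim : ∀ᵐ x, Tendsto (fun i => m i x) l (𝓝 (m₀ x))) (f : L2 d) :
    Tendsto (fun i => fmul (m i) f) l (𝓝 (fmul m₀ f)) := by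
  have := tendsto_mulOp hm hm₀ hC hlim (𝓕 f)
  exact ((Lp.fourierTransformₗᵢ (Sp d) ℂ).symm.continuous.tendsto _).comp this

theorem memLp_top_of_continuous {m : Sp d → ℂ} {C : ℝ} (hm : Continuous m)
    (hC : ∀ x, ‖m x‖ ≤ C) : MemLp m ∞ (volume : Measure (Sp d)) :=
  memLp_top_of_bound hm.aestronglyMeasurable C (Eventually.of_forall hC)

theorem fmul_const_one (f : L2 d) : fmul (fun _ => (1 : ℂ)) f = f := by
  apply fourier_injective
  rw [fourier_fmul]
  refine Lp.ext ?_
  filter_upwards [mulOp_coeFn (memLp_top_of_continuous (m := fun _ => (1 : ℂ)) (C := 1)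
    continuous_const (by simp))
    (𝓕 f)] with x hx
  rw [hx, one_mul]

theorem fmul_add {m₁ m₂ : Sp d → ℂ} (h₁ : MemLp m₁ ∞ (volume : Measure (Sp d)))
    (h₂ : MemLp m₂ ∞ (volume : Measure (Sp d))) (f : L2 d) :
    fmul (fun x => m₁ x + m₂ x) f = fmul m₁ f + fmul m₂ f := by
  apply fourier_injective
  rw [FourierTransform.fourier_add, fourier_fmul, fourier_fmul, fourier_fmul]
  refine Lp.ext ?_
  filter_upwards [mulOp_coeFn h₁ (𝓕 f), mulOp_coeFn h₂ (𝓕 f), mulOp_coeFn (h₁.add h₂) (𝓕 f),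
    Lp.coeFn_add (mulOp m₁ (𝓕 f)) (mulOp m₂ (𝓕 f))] with x hx1 hx2 hx3 hx4
  have h : mulOp (fun x => m₁ x + m₂ x) (𝓕 f) x = (m₁ x + m₂ x) * 𝓕 f x := hx3
  rw [h, hx4, Pi.add_apply, hx1, hx2, add_mul]

theorem fmul_sub {m₁ m₂ : Sp d → ℂ} (h₁ : MemLp m₁ ∞ (volume : Measure (Sp d)))
    (h₂ : MemLp m₂ ∞ (volume : Measure (Sp d))) (f : L2 d) :
    fmul (fun x => m₁ x - m₂ x) f = fmul m₁ f - fmul m₂ f := by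
  have h : MemLp (fun x => m₁ x - m₂ x) ∞ (volume : Measure (Sp d)) := h₁.sub h₂
  have := fmul_add h h₂ f
  rw [eq_sub_iff_add_eq]
  simpa using this.symm

theorem fmul_const_mul {m : Sp d → ℂ} (h : MemLp m ∞ (volume : Measure (Sp d))) (c : ℂ)
    (f : L2 d) : fmul (fun x => c * m x) f = c • fmul m f := by
  apply fourier_injective
  rw [FourierTransform.fourier_smul, fourier_fmul, fourier_fmul]
  refine Lp.ext ?_
  have h' : MemLp (fun x => c * m x) ∞ (volume : Measure (Sp d)) := h.const_mul c
  filter_upwards [mulOp_coeFn h (𝓕 f), mulOp_coeFn h' (𝓕 f),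
    Lp.coeFn_smul c (mulOp m (𝓕 f))] with x h1 h2 h3
  rw [h2, h3, Pi.smul_apply, h1, smul_eq_mul, mul_assoc]

/-- On Schwartz functions the two notions of Fourier multiplier agree. -/
theorem fmul_toLp {m : Sp d → ℂ} (h : MemLp m ∞ (volume : Measure (Sp d)))
    (hm : m.HasTemperateGrowth) (f : 𝓢(Sp d, ℂ)) :
    fmul m (f.toLp 2) = (SchwartzMap.fourierMultiplierCLM ℂ m f).toLp 2 := by
  rw [fmul_apply, SchwartzMap.toLp_fourier_eq, SchwartzMap.fourierMultiplierCLM_apply,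
    ← SchwartzMap.toLp_fourierInv_eq]
  congr 1
  refine Lp.ext ?_
  filter_upwards [mulOp_coeFn h ((𝓕 f).toLp 2), (𝓕 f).coeFn_toLp 2,
    (SchwartzMap.smulLeftCLM ℂ m (𝓕 f)).coeFn_toLp 2] with x h1 h2 h3
  rw [h1, h2, h3, SchwartzMap.smulLeftCLM_apply_apply hm, smul_eq_mul]

/-! ### Fourier characterisation of `H¹` -/

/-- The symbol `2πi ξⱼ` of `∂ⱼ`. -/
def dsym (j : Fin d) (ξ : Sp d) : ℂ := 2 * Real.pi * Complex.I * (ξ j : ℝ)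

/-- The symbol `4π²|ξ|²` of `-Δ`. -/
def asym (ξ : Sp d) : ℝ := 4 * Real.pi ^ 2 * ‖ξ‖ ^ 2

/-- The symbol `(1 + s 4π²|ξ|²)⁻¹` of the resolvent `(1 - sΔ)⁻¹`. -/
def rsym (s : ℝ) (ξ : Sp d) : ℝ := (1 + s * asym ξ)⁻¹

theorem asym_nonneg (ξ : Sp d) : 0 ≤ asym ξ := by unfold asym; positivity

theorem sum_norm_dsym_sq (ξ : Sp d) : ∑ j, ‖dsym j ξ‖ ^ 2 = asym ξ := by
  simp only [dsym, asym, norm_mul, EuclideanSpace.norm_sq_eq, Finset.mul_sum]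
  refine Finset.sum_congr rfl fun j _ => ?_
  simp only [Complex.norm_ofNat, Complex.norm_real, Complex.norm_I, Real.norm_eq_abs, mul_pow,
    sq_abs]
  ring

theorem norm_dsym_sq_le (j : Fin d) (ξ : Sp d) : ‖dsym j ξ‖ ^ 2 ≤ asym ξ := by
  rw [← sum_norm_dsym_sq]
  exact Finset.single_le_sum (f := fun j => ‖dsym j ξ‖ ^ 2) (fun _ _ => by positivity)
    (Finset.mem_univ j)

theorem continuous_asym : Continuous (asym : Sp d → ℝ) := by unfold asym; fun_prop

theorem continuous_dsym (j : Fin d) : Continuous (dsym j : Sp d → ℂ) := by unfold dsym; fun_prop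

theorem rsym_pos {s : ℝ} (hs : 0 ≤ s) (ξ : Sp d) : 0 < rsym s ξ := by
  have := asym_nonneg ξ
  unfold rsym; positivity

theorem rsym_le_one {s : ℝ} (hs : 0 ≤ s) (ξ : Sp d) : rsym s ξ ≤ 1 := by
  have := asym_nonneg ξ
  unfold rsym
  exact inv_le_one_of_one_le₀ (by nlinarith [mul_nonneg hs this])

theorem one_sub_rsym {s : ℝ} (hs : 0 ≤ s) (ξ : Sp d) : 1 - rsym s ξ = s * asym ξ * rsym s ξ := by
  have := mul_nonneg hs (asym_nonneg ξ)
  unfold rsym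
  field_simp
  ring

theorem continuous_rsym {s : ℝ} (hs : 0 ≤ s) : Continuous (rsym s : Sp d → ℝ) := by
  unfold rsym
  refine Continuous.inv₀ (by have := continuous_asym (d := d); fun_prop) fun ξ => ?_
  have := mul_nonneg hs (asym_nonneg ξ)
  positivity

theorem hasTemperateGrowth_rsym {s : ℝ} (hs : 0 ≤ s) :
    (rsym s : Sp d → ℝ).HasTemperateGrowth := by
  have h1 := Function.hasTemperateGrowth_one_add_norm_sq_rpow (Sp d) (-1)
  have h2 : (fun ξ : Sp d => (2 * Real.pi * √s) • ξ).HasTemperateGrowth :=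
    ((2 * Real.pi * √s) • ContinuousLinearMap.id ℝ (Sp d)).hasTemperateGrowth
  have := h1.comp h2
  have hfun : (rsym s : Sp d → ℝ) = (fun x : Sp d => (1 + ‖x‖ ^ 2) ^ (-1 : ℝ)) ∘
      fun ξ : Sp d => (2 * Real.pi * √s) • ξ := by
    funext ξ
    simp only [rsym, asym, Function.comp, norm_smul, Real.rpow_neg_one]
    rw [Real.norm_of_nonneg (by positivity), mul_pow, mul_pow, Real.sq_sqrt hs]
    ring
  rw [hfun]
  exact this

theorem hasTemperateGrowth_rsym_ofReal {s : ℝ} (hs : 0 ≤ s) :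
    (fun ξ : Sp d => (rsym s ξ : ℂ)).HasTemperateGrowth :=
  Function.Complex.hasTemperateGrowth_ofReal.comp (hasTemperateGrowth_rsym hs)

theorem memLp_rsym {s : ℝ} (hs : 0 ≤ s) :
    MemLp (fun ξ : Sp d => (rsym s ξ : ℂ)) ∞ (volume : Measure (Sp d)) :=
  memLp_top_of_continuous (C := 1) (Complex.continuous_ofReal.comp (continuous_rsym hs)) fun ξ => by
    rw [Complex.norm_real, Real.norm_of_nonneg (rsym_pos hs ξ).le]
    exact rsym_le_one hs ξ

theorem norm_dsym_le (j : Fin d) (ξ : Sp d) : ‖dsym j ξ‖ ≤ √(asym ξ) :=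
  Real.le_sqrt_of_sq_le (norm_dsym_sq_le j ξ)

theorem norm_dsym_mul_rsym_le {s : ℝ} (hs : 0 < s) (j : Fin d) (ξ : Sp d) :
    ‖dsym j ξ * (rsym s ξ : ℂ)‖ ≤ (√s)⁻¹ := by
  have ha := asym_nonneg ξ
  have h1 := rsym_pos hs.le ξ
  rw [norm_mul, Complex.norm_real, Real.norm_of_nonneg h1.le]
  have h2 : √(asym ξ) * √s * rsym s ξ ≤ 1 := by
    rw [← Real.sqrt_mul ha, rsym, ← div_eq_mul_inv, div_le_one (by positivity)]
    nlinarith [Real.sq_sqrt (show 0 ≤ asym ξ * s by positivity), sq_nonneg (√(asym ξ * s) - 1)]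
  have h3 : 0 < √s := Real.sqrt_pos.2 hs
  rw [← one_div, le_div_iff₀ h3]
  calc _ ≤ √(asym ξ) * rsym s ξ * √s := by gcongr; exact norm_dsym_le j ξ
    _ = √(asym ξ) * √s * rsym s ξ := by ring
    _ ≤ 1 := h2

theorem memLp_dsym_mul_rsym {s : ℝ} (hs : 0 < s) (j : Fin d) :
    MemLp (fun ξ : Sp d => dsym j ξ * (rsym s ξ : ℂ)) ∞ (volume : Measure (Sp d)) :=
  memLp_top_of_continuous ((continuous_dsym j).mul
    (Complex.continuous_ofReal.comp (continuous_rsym hs.le))) (norm_dsym_mul_rsym_le hs j)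

theorem hasTemperateGrowth_coord (j : Fin d) :
    (fun ξ : Sp d => ((ξ j : ℝ) : ℂ)).HasTemperateGrowth :=
  Function.Complex.hasTemperateGrowth_ofReal.comp
    (EuclideanSpace.proj j : Sp d →L[ℝ] ℝ).hasTemperateGrowth

theorem hasTemperateGrowth_dsym (j : Fin d) : (dsym j : Sp d → ℂ).HasTemperateGrowth :=
  (Function.HasTemperateGrowth.const (2 * Real.pi * Complex.I)).mul (hasTemperateGrowth_coord j)

theorem inner_stdVec (j : Fin d) (ξ : Sp d) : inner ℝ ξ (stdVec j) = ξ j := by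
  simp [stdVec, EuclideanSpace.inner_single_right]

theorem toTemperedDistribution_injective :
    Function.Injective (Lp.toTemperedDistributionCLM ℂ (volume : Measure (Sp d)) 2) :=
  LinearMap.ker_eq_bot.1 Lp.ker_toTemperedDistributionCLM_eq_bot

/-- The reciprocal `1 + s 4π²|ξ|²` has temperate growth, so multiplication by it is a left inverse.
This permits testing an identity of distributions after damping by the resolvent symbol. -/
theorem smulLeftCLM_rsym_injective {s : ℝ} (hs : 0 ≤ s) :
    Function.Injective
      (TemperedDistribution.smulLeftCLM ℂ (fun ξ : Sp d => (rsym s ξ : ℂ))) := by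
  have hinv : (fun ξ : Sp d => ((1 + s * asym ξ : ℝ) : ℂ)).HasTemperateGrowth := by
    refine Function.Complex.hasTemperateGrowth_ofReal.comp (f := fun ξ : Sp d => 1 + s * asym ξ) ?_
    unfold asym
    fun_prop
  refine Function.LeftInverse.injective
    (g := TemperedDistribution.smulLeftCLM ℂ (fun ξ : Sp d => ((1 + s * asym ξ : ℝ) : ℂ)))
    fun f => ?_
  rw [TemperedDistribution.smulLeftCLM_smulLeftCLM_apply (hasTemperateGrowth_rsym_ofReal hs) hinv]
  have : ((fun ξ : Sp d => (rsym s ξ : ℂ)) * fun ξ => ((1 + s * asym ξ : ℝ) : ℂ))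
      = fun _ => (1 : ℂ) := by
    ext ξ
    have := mul_nonneg hs (asym_nonneg ξ)
    simp only [Pi.mul_apply, rsym]
    rw [← Complex.ofReal_mul, inv_mul_cancel₀ (by positivity), Complex.ofReal_one]
  rw [this]
  simp

theorem toTemperedDistribution_mulOp {m : Sp d → ℂ} (h : MemLp m ∞ (volume : Measure (Sp d)))
    (hm : m.HasTemperateGrowth) (f : L2 d) :
    Lp.toTemperedDistributionCLM ℂ (volume : Measure (Sp d)) 2 (mulOp m f)
      = TemperedDistribution.smulLeftCLM ℂ m
          (Lp.toTemperedDistributionCLM ℂ (volume : Measure (Sp d)) 2 f) := by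
  rw [mulOp_eq h]
  exact Lp.toTemperedDistribution_smul_eq (p := ∞) (q := 2) (r := 2) hm h f

/-- The product `dsym j · 𝓕 f` need not lie in `L²` a priori, so the two sides cannot be compared
there directly. Multiplying both by `rsym 1`, which loses no information, turns both multipliers
into bounded ones; the identity then lives in `L²`, and the positive factor is divided out
pointwise. -/
theorem lineDeriv_eq_iff (f g : L2 d) (j : Fin d) :
    ∂_{stdVec j} (Lp.toTemperedDistributionCLM ℂ (volume : Measure (Sp d)) 2 f)
      = Lp.toTemperedDistributionCLM ℂ (volume : Measure (Sp d)) 2 g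
    ↔ (𝓕 g : L2 d) =ᵐ[volume] fun ξ => dsym j ξ * (𝓕 f : L2 d) ξ := by
  set ι := Lp.toTemperedDistributionCLM ℂ (volume : Measure (Sp d)) 2
  have hF : Function.Injective (𝓕 : 𝓢'(Sp d, ℂ) → 𝓢'(Sp d, ℂ)) := fun a b hab => by
    have := congrArg (𝓕⁻ : 𝓢'(Sp d, ℂ) → 𝓢'(Sp d, ℂ)) hab
    simpa using this
  have hFι : ∀ h : L2 d, 𝓕 (ι h) = ι (𝓕 h) := fun h => Lp.fourier_toTemperedDistribution_eq h
  have hfun : (fun ξ : Sp d => ((inner ℝ ξ (stdVec j) : ℝ) : ℂ)) = fun ξ => ((ξ j : ℝ) : ℂ) := by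
    ext ξ; rw [inner_stdVec]
  have hd1 : (fun ξ : Sp d => dsym j ξ * (rsym 1 ξ : ℂ))
      = (2 * Real.pi * Complex.I) •
        ((fun ξ : Sp d => ((ξ j : ℝ) : ℂ)) * fun ξ => (rsym 1 ξ : ℂ)) := by
    ext ξ; simp [dsym, mul_assoc]
  rw [← hF.eq_iff, TemperedDistribution.fourier_lineDerivOp_eq, hFι, hFι, hfun,
    ← (smulLeftCLM_rsym_injective zero_le_one).eq_iff, map_smul,
    TemperedDistribution.smulLeftCLM_smulLeftCLM_apply (hasTemperateGrowth_coord j)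
      (hasTemperateGrowth_rsym_ofReal zero_le_one), ← smul_apply,
    ← TemperedDistribution.smulLeftCLM_smul ((hasTemperateGrowth_coord j).mul
      (hasTemperateGrowth_rsym_ofReal zero_le_one)), ← hd1,
    ← toTemperedDistribution_mulOp (memLp_rsym zero_le_one)
      (hasTemperateGrowth_rsym_ofReal zero_le_one),
    ← toTemperedDistribution_mulOp (memLp_dsym_mul_rsym zero_lt_one j)
      ((hasTemperateGrowth_dsym j).mul (hasTemperateGrowth_rsym_ofReal zero_le_one)),
    toTemperedDistribution_injective.eq_iff, Lp.ext_iff]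
  have h1 := mulOp_coeFn (memLp_dsym_mul_rsym zero_lt_one j) (𝓕 f)
  have h2 := mulOp_coeFn (memLp_rsym zero_le_one) (𝓕 g)
  constructor
  · intro h
    filter_upwards [h, h1, h2] with ξ h h1 h2
    rw [h1, h2] at h
    have := rsym_pos zero_le_one ξ
    have h3 : (rsym 1 ξ : ℂ) ≠ 0 := by exact_mod_cast this.ne'
    apply mul_left_cancel₀ h3
    rw [← h]; ring
  · intro h
    filter_upwards [h, h1, h2] with ξ h h1 h2
    rw [h1, h2, h]; ring

namespace H1

/-- The underlying function, as a continuous linear map. -/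
def fnL (d : ℕ) : H1 d →L[ℂ] L2 d :=
  (WithLp.fstL 2 ℂ (L2 d) (PiLp 2 (fun _ : Fin d => L2 d))) ∘L (h1Submodule d).subtypeL

/-- The `j`-th partial derivative, as a continuous linear map. -/
def pdL (j : Fin d) : H1 d →L[ℂ] L2 d :=
  (PiLp.proj 2 (fun _ : Fin d => L2 d) j : _ →L[ℂ] L2 d) ∘L
    (WithLp.sndL 2 ℂ (L2 d) (PiLp 2 (fun _ : Fin d => L2 d))) ∘L (h1Submodule d).subtypeL

@[simp] theorem fnL_apply (v : H1 d) : fnL d v = v.fn := rfl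
@[simp] theorem pdL_apply (j : Fin d) (v : H1 d) : pdL j v = v.pd j := rfl

theorem norm_sq (v : H1 d) : ‖v‖ ^ 2 = ‖v.fn‖ ^ 2 + ∑ j, ‖v.pd j‖ ^ 2 := by
  change ‖v.1‖ ^ 2 = _
  rw [WithLp.prod_norm_sq_eq_of_L2, PiLp.norm_sq_eq_of_L2]
  rfl

theorem inner_eq (v w : H1 d) :
    inner ℂ v w = inner ℂ v.fn w.fn + ∑ j, inner ℂ (v.pd j) (w.pd j) := by
  rw [Submodule.coe_inner, WithLp.prod_inner_apply, PiLp.inner_apply]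
  rfl

theorem fourier_pd (v : H1 d) (j : Fin d) :
    (𝓕 (v.pd j) : L2 d) =ᵐ[volume] fun ξ => dsym j ξ * (𝓕 v.fn : L2 d) ξ :=
  (lineDeriv_eq_iff v.fn (v.pd j) j).1 (v.2 j)

/-- Constructor from the function and its partial derivatives. -/
def mk' (f : L2 d) (g : Fin d → L2 d)
    (h : ∀ j, (𝓕 (g j) : L2 d) =ᵐ[volume] fun ξ => dsym j ξ * (𝓕 f : L2 d) ξ) : H1 d :=
  ⟨WithLp.toLp 2 (f, WithLp.toLp 2 g), fun j => (lineDeriv_eq_iff f (g j) j).2 (h j)⟩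

@[simp] theorem mk'_fn (f : L2 d) (g : Fin d → L2 d) (h) : (mk' f g h).fn = f := rfl
@[simp] theorem mk'_pd (f : L2 d) (g : Fin d → L2 d) (h) (j) : (mk' f g h).pd j = g j := rfl

theorem ext_fn {v w : H1 d} (h : v.fn = w.fn) : v = w := by
  have hpd : ∀ j, v.pd j = w.pd j := fun j => by
    apply fourier_injective
    refine Lp.ext ?_
    filter_upwards [fourier_pd v j, fourier_pd w j] with ξ h1 h2
    rw [h1, h2, h]
  have : ‖v - w‖ ^ 2 = 0 := by
    rw [norm_sq, ← fnL_apply, map_sub]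
    simp_rw [← pdL_apply, map_sub]
    simp [h, hpd]
  exact sub_eq_zero.1 (norm_eq_zero.1 (by simpa using this))

theorem fourier_toLp_lineDeriv (f : 𝓢(Sp d, ℂ)) (j : Fin d) :
    (𝓕 ((∂_{stdVec j} f).toLp 2 : L2 d) : L2 d) =ᵐ[volume]
      fun ξ => dsym j ξ * (𝓕 (f.toLp 2 : L2 d) : L2 d) ξ := by
    rw [SchwartzMap.toLp_fourier_eq, SchwartzMap.toLp_fourier_eq,
      SchwartzMap.fourier_lineDerivOp_eq]
    filter_upwards [SchwartzMap.coeFn_toLp (𝓕 f) 2,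
      SchwartzMap.coeFn_toLp ((2 * Real.pi * Complex.I) •
        SchwartzMap.smulLeftCLM ℂ (fun x => inner ℝ x (stdVec j)) (𝓕 f)) 2] with ξ h1 h2
    rw [h1, h2, smul_apply,
      SchwartzMap.smulLeftCLM_apply_apply (by fun_prop), inner_stdVec, dsym, smul_eq_mul]
    simp [mul_assoc]

/-- A Schwartz function as an element of `H¹`. -/
def ofSchwartz (f : 𝓢(Sp d, ℂ)) : H1 d :=
  mk' (f.toLp 2 volume) (fun j => (∂_{stdVec j} f).toLp 2 volume) (fourier_toLp_lineDeriv f)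

@[simp] theorem ofSchwartz_fn (f : 𝓢(Sp d, ℂ)) : (ofSchwartz f).fn = f.toLp 2 := rfl
@[simp] theorem ofSchwartz_pd (f : 𝓢(Sp d, ℂ)) (j : Fin d) :
    (ofSchwartz f).pd j = (∂_{stdVec j} f).toLp 2 := rfl

end H1

/-! ### Completeness of `H¹` and density of Schwartz functions -/

theorem isClosed_h1Submodule : IsClosed (h1Submodule d : Set
    (WithLp 2 (L2 d × PiLp 2 (fun _ : Fin d => L2 d)))) := by
  have : (h1Submodule d : Set (WithLp 2 (L2 d × PiLp 2 (fun _ : Fin d => L2 d))))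
      = ⋂ j : Fin d, {p | ∂_{stdVec j} (Lp.toTemperedDistributionCLM ℂ volume 2 p.fst)
      = Lp.toTemperedDistributionCLM ℂ (volume : Measure (Sp d)) 2 (p.snd j)} := by
    ext p
    simp only [mem_iInter]
    rfl
  rw [this]
  refine isClosed_iInter fun j => isClosed_eq ?_ ?_
  · exact (LineDeriv.lineDerivOpCLM ℂ 𝓢'(Sp d, ℂ) (stdVec j)).continuous.comp
      ((Lp.toTemperedDistributionCLM ℂ volume 2).continuous.comp
      (WithLp.fstL 2 ℂ (L2 d) (PiLp 2 (fun _ : Fin d => L2 d))).continuous)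
  · exact (Lp.toTemperedDistributionCLM ℂ volume 2).continuous.comp
      ((PiLp.proj 2 (fun _ : Fin d => L2 d) j : _ →L[ℂ] L2 d).continuous.comp
      (WithLp.sndL 2 ℂ (L2 d) (PiLp 2 (fun _ : Fin d => L2 d))).continuous)

instance : CompleteSpace (H1 d) :=
  (isClosed_h1Submodule (d := d)).completeSpace_coe

theorem dense_of_inner_eq_zero {E : Type*} [NormedAddCommGroup E] [InnerProductSpace ℂ E]
    [CompleteSpace E] (K : Submodule ℂ E)
    (hK : ∀ v : E, (∀ w ∈ K, inner ℂ w v = 0) → v = 0) : Dense (K : Set E) := by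
  rw [Submodule.dense_iff_topologicalClosure_eq_top, Submodule.topologicalClosure_eq_top_iff,
    Submodule.eq_bot_iff]
  exact fun v hv => hK v fun w hw => (Submodule.mem_orthogonal _ v).1 hv w hw

namespace H1

/-- `ofSchwartz` as a linear map. -/
def ofSchwartzLM (d : ℕ) : 𝓢(Sp d, ℂ) →ₗ[ℂ] H1 d where
  toFun := ofSchwartz
  map_add' f g := ext_fn (by
    rw [← fnL_apply (ofSchwartz f + _), map_add]
    exact map_add (SchwartzMap.toLpCLM ℂ ℂ 2 (volume : Measure (Sp d))) f g)
  map_smul' c f := ext_fn (by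
    rw [← fnL_apply (_ • ofSchwartz f), map_smul]
    exact map_smul (SchwartzMap.toLpCLM ℂ ℂ 2 (volume : Measure (Sp d))) c f)

/-- The test function with `𝓕 f = (1 + 4π²|ξ|²)⁻¹ g` cancels the `H¹` weight, so that the `H¹`
pairing becomes the `L²` pairing of `𝓕 v.fn` with an arbitrary Schwartz function `g`, and these are
dense in `L²`. -/
theorem eq_zero_of_inner_ofSchwartz (v : H1 d)
    (hv : ∀ f : 𝓢(Sp d, ℂ), inner ℂ (ofSchwartz f) v = 0) : v = 0 := by
  have h0 : 𝓕 v.fn = 0 := by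
    refine (SchwartzMap.denseRange_toLpCLM (E := Sp d) (F := ℂ) (p := 2) (μ := volume)
      ENNReal.ofNat_ne_top).eq_zero_of_inner_right ℂ fun g => ?_
    set f : 𝓢(Sp d, ℂ) := 𝓕⁻ (SchwartzMap.smulLeftCLM ℂ (fun ξ : Sp d => (rsym 1 ξ : ℂ)) g) with hf
    have hFf : 𝓕 f = SchwartzMap.smulLeftCLM ℂ (fun ξ : Sp d => (rsym 1 ξ : ℂ)) g := by
      rw [hf, FourierTransform.fourier_fourierInv_eq]
    have hFf' : (𝓕 (ofSchwartz f).fn : L2 d) =ᵐ[volume] fun ξ => (rsym 1 ξ : ℂ) * g ξ := by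
      rw [ofSchwartz_fn, SchwartzMap.toLp_fourier_eq, hFf]
      filter_upwards [SchwartzMap.coeFn_toLp
        (SchwartzMap.smulLeftCLM ℂ (fun ξ : Sp d => (rsym 1 ξ : ℂ)) g) 2] with ξ h
      rw [h, SchwartzMap.smulLeftCLM_apply_apply (hasTemperateGrowth_rsym_ofReal zero_le_one),
        smul_eq_mul]
    have h := hv f
    rw [inner_eq, ← Lp.inner_fourier_eq] at h
    simp_rw [← Lp.inner_fourier_eq ((ofSchwartz f).pd _)] at h
    rw [L2.inner_def] at h
    simp_rw [L2.inner_def] at h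
    rw [← integral_finsetSum _ (fun j _ => L2.integrable_inner _ _),
      ← integral_add (L2.integrable_inner _ _)
        (integrable_finsetSum _ fun j _ => L2.integrable_inner _ _)] at h
    rw [L2.inner_def, ← h]
    refine integral_congr_ae ?_
    have hpd1 : ∀ᵐ ξ, ∀ j, (𝓕 ((ofSchwartz f).pd j) : L2 d) ξ
        = dsym j ξ * (𝓕 (ofSchwartz f).fn : L2 d) ξ :=
      ae_all_iff.2 fun j => fourier_pd (ofSchwartz f) j
    have hpd2 : ∀ᵐ ξ, ∀ j, (𝓕 (v.pd j) : L2 d) ξ = dsym j ξ * (𝓕 v.fn : L2 d) ξ :=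
      ae_all_iff.2 fun j => fourier_pd v j
    filter_upwards [hFf', hpd1, hpd2, SchwartzMap.coeFn_toLp g 2] with ξ h1 h2 h3 h4
    simp only [SchwartzMap.toLpCLM_apply, h4, h2, h3, h1, RCLike.inner_apply, map_mul]
    have e1 : ∀ j : Fin d, dsym j ξ * (𝓕 v.fn : L2 d) ξ * ((starRingEnd ℂ) (dsym j ξ) *
        ((starRingEnd ℂ) (rsym 1 ξ : ℂ) * (starRingEnd ℂ) (g ξ)))
        = ((‖dsym j ξ‖ ^ 2 : ℝ) : ℂ) * ((𝓕 v.fn : L2 d) ξ * ((rsym 1 ξ : ℂ) * (starRingEnd ℂ) (g ξ))) := by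
      intro j
      rw [← Complex.normSq_eq_norm_sq, ← Complex.mul_conj, Complex.conj_ofReal]
      ring
    rw [Finset.sum_congr rfl fun j _ => e1 j, ← Finset.sum_mul, ← Complex.ofReal_sum,
      sum_norm_dsym_sq, Complex.conj_ofReal]
    have : ((rsym 1 ξ : ℝ) : ℂ) * (1 + (asym ξ : ℂ)) = 1 := by
      have := asym_nonneg ξ
      have h5 : rsym 1 ξ * (1 + asym ξ) = 1 := by
        rw [rsym, one_mul, inv_mul_cancel₀ (by positivity)]
      exact_mod_cast h5
    linear_combination (- (𝓕 v.fn : L2 d) ξ * (starRingEnd ℂ) (g ξ)) * this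
  refine ext_fn ?_
  have : v.fn = 0 := fourier_injective (by rw [h0]; exact (map_zero (Lp.fourierTransformₗᵢ (Sp d) ℂ)).symm)
  rw [this, ← fnL_apply, map_zero]

theorem denseRange_ofSchwartz : DenseRange (ofSchwartz : 𝓢(Sp d, ℂ) → H1 d) := by
  refine (dense_of_inner_eq_zero (LinearMap.range (ofSchwartzLM d)) fun v hv => ?_).mono ?_
  · exact eq_zero_of_inner_ofSchwartz v fun f => hv (ofSchwartz f) ⟨f, rfl⟩
  · rintro _ ⟨f, rfl⟩
    exact ⟨f, rfl⟩

/-- A closed property of `H¹` functions holds if it holds for Schwartz functions. -/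
theorem induction_schwartz {P : H1 d → Prop} (hc : IsClosed {v | P v})
    (h : ∀ f : 𝓢(Sp d, ℂ), P (ofSchwartz f)) (v : H1 d) : P v :=
  denseRange_ofSchwartz.induction_on v hc h

end H1

/-! ### The resolvent `(1 - sΔ)⁻¹` -/

/-- The resolvent `(1 - sΔ)⁻¹` on `L²`. -/
def res (s : ℝ) : L2 d →L[ℂ] L2 d := fmul fun ξ => (rsym s ξ : ℂ)

theorem norm_rsym_ofReal_le {s : ℝ} (hs : 0 ≤ s) (ξ : Sp d) : ‖(rsym s ξ : ℂ)‖ ≤ 1 := by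
  rw [Complex.norm_real, Real.norm_of_nonneg (rsym_pos hs ξ).le]
  exact rsym_le_one hs ξ

theorem norm_res_le {s : ℝ} (hs : 0 ≤ s) (f : L2 d) : ‖res s f‖ ≤ ‖f‖ := by
  have := norm_fmul_le zero_le_one (norm_rsym_ofReal_le hs) f
  rwa [one_mul] at this

theorem inner_res {s : ℝ} (hs : 0 ≤ s) (f g : L2 d) :
    inner ℂ (res s f) g = inner ℂ f (res s g) :=
  inner_fmul_of_real (memLp_rsym hs) f g

theorem fourier_res {s : ℝ} (hs : 0 ≤ s) (f : L2 d) :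
    (𝓕 (res s f) : L2 d) =ᵐ[volume] fun ξ => (rsym s ξ : ℂ) * (𝓕 f : L2 d) ξ := by
  rw [res, fourier_fmul]
  exact mulOp_coeFn (memLp_rsym hs) _

theorem fourier_sub_res {s : ℝ} (hs : 0 ≤ s) (f : L2 d) :
    (𝓕 (f - res s f) : L2 d) =ᵐ[volume]
      fun ξ => ((s * asym ξ * rsym s ξ : ℝ) : ℂ) * (𝓕 f : L2 d) ξ := by
  have h : (𝓕 (f - res s f) : L2 d) = 𝓕 f - 𝓕 (res s f) :=
    map_sub (Lp.fourierTransformₗᵢ (Sp d) ℂ) _ _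
  rw [h]
  filter_upwards [Lp.coeFn_sub (𝓕 f : L2 d) (𝓕 (res s f)), fourier_res hs f] with ξ h1 h2
  rw [h1, Pi.sub_apply, h2, ← one_sub_rsym hs]
  push_cast
  ring

theorem inner_eq_integral_fourier (f g : L2 d) :
    inner ℂ f g = ∫ ξ, (starRingEnd ℂ) ((𝓕 f : L2 d) ξ) * (𝓕 g : L2 d) ξ := by
  rw [← Lp.inner_fourier_eq, inner_eq_integral]

theorem norm_sq_eq_integral_fourier (f : L2 d) : ‖f‖ ^ 2 = ∫ ξ, ‖(𝓕 f : L2 d) ξ‖ ^ 2 := by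
  rw [← norm_fourier, norm_sq_eq_integral]

theorem integrable_conj_mul (f g : L2 d) :
    Integrable (fun x => (starRingEnd ℂ) (f x) * g x) volume := by
  refine (L2.integrable_inner (𝕜 := ℂ) f g).congr (Eventually.of_forall fun x => ?_)
  simp [mul_comm]

namespace H1

theorem norm_fn_le (v : H1 d) : ‖v.fn‖ ≤ ‖v‖ := by
  refine le_of_sq_le_sq ?_ (norm_nonneg _)
  rw [norm_sq v]
  have : 0 ≤ ∑ j, ‖v.pd j‖ ^ 2 := Finset.sum_nonneg fun _ _ => by positivity
  linarith

theorem sum_norm_pd_sq_le (v : H1 d) : ∑ j, ‖v.pd j‖ ^ 2 ≤ ‖v‖ ^ 2 := by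
  rw [norm_sq v]
  have : 0 ≤ ‖v.fn‖ ^ 2 := by positivity
  linarith

theorem norm_pd_le (v : H1 d) (j : Fin d) : ‖v.pd j‖ ≤ ‖v‖ := by
  refine le_of_sq_le_sq ?_ (norm_nonneg _)
  refine le_trans ?_ (sum_norm_pd_sq_le v)
  exact Finset.single_le_sum (f := fun j => ‖v.pd j‖ ^ 2) (fun _ _ => by positivity)
    (Finset.mem_univ j)

theorem fn_sub (v w : H1 d) : (v - w).fn = v.fn - w.fn := map_sub (fnL d) v w
theorem pd_sub (v w : H1 d) (j : Fin d) : (v - w).pd j = v.pd j - w.pd j := map_sub (pdL j) v w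
theorem fn_add (v w : H1 d) : (v + w).fn = v.fn + w.fn := map_add (fnL d) v w

/-- The resolvent on `H¹`. -/
def res {s : ℝ} (hs : 0 ≤ s) (v : H1 d) : H1 d :=
  mk' (LogLogNLS.res s v.fn) (fun j => LogLogNLS.res s (v.pd j)) fun j => by
    filter_upwards [fourier_res hs v.fn, fourier_res hs (v.pd j), fourier_pd v j] with ξ h1 h2 h3
    rw [h1, h2, h3]; ring

@[simp] theorem res_fn {s : ℝ} (hs : 0 ≤ s) (v : H1 d) :
    (res hs v).fn = LogLogNLS.res s v.fn := rfl
@[simp] theorem res_pd {s : ℝ} (hs : 0 ≤ s) (v : H1 d) (j : Fin d) :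
    (res hs v).pd j = LogLogNLS.res s (v.pd j) := rfl

theorem norm_res_le {s : ℝ} (hs : 0 ≤ s) (v : H1 d) : ‖res hs v‖ ≤ ‖v‖ := by
  refine le_of_sq_le_sq ?_ (norm_nonneg _)
  rw [norm_sq, norm_sq]
  gcongr
  · exact LogLogNLS.norm_res_le hs _
  · exact LogLogNLS.norm_res_le hs _

theorem norm_sub_res_le {s : ℝ} (hs : 0 ≤ s) (v : H1 d) : ‖v - res hs v‖ ≤ 2 * ‖v‖ := by
  calc _ ≤ ‖v‖ + ‖res hs v‖ := norm_sub_le _ _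
    _ ≤ ‖v‖ + ‖v‖ := by gcongr; exact norm_res_le hs v
    _ = _ := by ring

theorem integrable_asym_mul (v : H1 d) :
    Integrable (fun ξ => asym ξ * ‖(𝓕 v.fn : L2 d) ξ‖ ^ 2) volume := by
  have h : ∀ᵐ ξ, ∀ j, (𝓕 (v.pd j) : L2 d) ξ = dsym j ξ * (𝓕 v.fn : L2 d) ξ :=
    ae_all_iff.2 fun j => fourier_pd v j
  refine (integrable_finsetSum Finset.univ fun j _ =>
    integrable_norm_sq (𝓕 (v.pd j) : L2 d)).congr ?_
  filter_upwards [h] with ξ h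
  simp_rw [h, norm_mul, mul_pow]
  rw [← Finset.sum_mul, sum_norm_dsym_sq]

/-- On the Fourier side, `1 - T = -sΔT` and the symbol of `-Δ` is `∑ⱼ |dsym j|²`. The factor `s`
gained here pays for the `s⁻¹` in the regularised energy. -/
theorem inner_sub_res {s : ℝ} (hs : 0 ≤ s) (v w : H1 d) :
    inner ℂ (v.fn - LogLogNLS.res s v.fn) w.fn
      = s * ∑ j, inner ℂ (LogLogNLS.res s (v.pd j)) (w.pd j) := by
  simp_rw [inner_eq_integral_fourier]
  rw [← integral_finsetSum _ fun j _ => integrable_conj_mul _ _, ← integral_const_mul]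
  refine integral_congr_ae ?_
  have h1 : ∀ᵐ ξ, ∀ j, (𝓕 (v.pd j) : L2 d) ξ = dsym j ξ * (𝓕 v.fn : L2 d) ξ :=
    ae_all_iff.2 fun j => fourier_pd v j
  have h2 : ∀ᵐ ξ, ∀ j, (𝓕 (w.pd j) : L2 d) ξ = dsym j ξ * (𝓕 w.fn : L2 d) ξ :=
    ae_all_iff.2 fun j => fourier_pd w j
  have h3 : ∀ᵐ ξ, ∀ j, (𝓕 (LogLogNLS.res s (v.pd j)) : L2 d) ξ
      = (rsym s ξ : ℂ) * (𝓕 (v.pd j) : L2 d) ξ :=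
    ae_all_iff.2 fun j => fourier_res hs _
  filter_upwards [h1, h2, h3, fourier_sub_res hs v.fn] with ξ h1 h2 h3 h4
  rw [h4]
  simp_rw [h3, h1, h2, map_mul, Complex.conj_ofReal]
  have e1 : ∀ j : Fin d, ((rsym s ξ : ℂ) * ((starRingEnd ℂ) (dsym j ξ) *
      (starRingEnd ℂ) ((𝓕 v.fn : L2 d) ξ))) * (dsym j ξ * (𝓕 w.fn : L2 d) ξ)
      = ((‖dsym j ξ‖ ^ 2 : ℝ) : ℂ) *
        ((rsym s ξ : ℂ) * (starRingEnd ℂ) ((𝓕 v.fn : L2 d) ξ) * (𝓕 w.fn : L2 d) ξ) := by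
    intro j
    rw [← Complex.normSq_eq_norm_sq, ← Complex.mul_conj]
    ring
  rw [Finset.sum_congr rfl fun j _ => e1 j, ← Finset.sum_mul, ← Complex.ofReal_sum,
    sum_norm_dsym_sq]
  push_cast
  ring

/-- The mean oscillation of `∇v` at scale `s`: `⟨(1 - sΔ)⁻¹ ∇v, ∇v⟩`. -/
def resEnergy (s : ℝ) (v : H1 d) : ℝ := ∑ j, (inner ℂ (LogLogNLS.res s (v.pd j)) (v.pd j)).re

theorem resEnergy_eq_integral {s : ℝ} (hs : 0 ≤ s) (v : H1 d) :
    resEnergy s v = ∫ ξ, rsym s ξ * asym ξ * ‖(𝓕 v.fn : L2 d) ξ‖ ^ 2 := by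
  unfold resEnergy
  rw [← Complex.re_sum]
  simp_rw [inner_eq_integral_fourier]
  rw [← integral_finsetSum _ fun j _ => integrable_conj_mul _ _]
  have h1 : ∀ᵐ ξ, ∀ j, (𝓕 (v.pd j) : L2 d) ξ = dsym j ξ * (𝓕 v.fn : L2 d) ξ :=
    ae_all_iff.2 fun j => fourier_pd v j
  have h3 : ∀ᵐ ξ, ∀ j, (𝓕 (LogLogNLS.res s (v.pd j)) : L2 d) ξ
      = (rsym s ξ : ℂ) * (𝓕 (v.pd j) : L2 d) ξ :=
    ae_all_iff.2 fun j => fourier_res hs _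
  have : (∫ ξ, ∑ j, (starRingEnd ℂ) ((𝓕 (LogLogNLS.res s (v.pd j)) : L2 d) ξ)
      * (𝓕 (v.pd j) : L2 d) ξ)
      = ∫ ξ, ((rsym s ξ * asym ξ * ‖(𝓕 v.fn : L2 d) ξ‖ ^ 2 : ℝ) : ℂ) := by
    refine integral_congr_ae ?_
    filter_upwards [h1, h3] with ξ h1 h3
    simp_rw [h3, h1, map_mul, Complex.conj_ofReal]
    have e1 : ∀ j : Fin d, ((rsym s ξ : ℂ) * ((starRingEnd ℂ) (dsym j ξ) *
        (starRingEnd ℂ) ((𝓕 v.fn : L2 d) ξ))) * (dsym j ξ * (𝓕 v.fn : L2 d) ξ)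
        = ((‖dsym j ξ‖ ^ 2 : ℝ) : ℂ) *
          ((rsym s ξ : ℂ) * ((‖(𝓕 v.fn : L2 d) ξ‖ ^ 2 : ℝ) : ℂ)) := by
      intro j
      rw [← Complex.normSq_eq_norm_sq, ← Complex.mul_conj, ← Complex.normSq_eq_norm_sq,
        ← Complex.mul_conj]
      ring
    rw [Finset.sum_congr rfl fun j _ => e1 j, ← Finset.sum_mul, ← Complex.ofReal_sum,
      sum_norm_dsym_sq]
    push_cast
    ring
  rw [this, integral_complex_ofReal, Complex.ofReal_re]

theorem resEnergy_nonneg {s : ℝ} (hs : 0 ≤ s) (v : H1 d) : 0 ≤ resEnergy s v := by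
  rw [resEnergy_eq_integral hs]
  refine integral_nonneg fun ξ => ?_
  have := rsym_pos hs ξ
  have := asym_nonneg ξ
  positivity

theorem resEnergy_le {s : ℝ} (hs : 0 ≤ s) (v : H1 d) : resEnergy s v ≤ ∑ j, ‖v.pd j‖ ^ 2 := by
  unfold resEnergy
  refine Finset.sum_le_sum fun j _ => ?_
  calc _ ≤ ‖inner ℂ (LogLogNLS.res s (v.pd j)) (v.pd j)‖ := Complex.re_le_norm _
    _ ≤ ‖LogLogNLS.res s (v.pd j)‖ * ‖v.pd j‖ := norm_inner_le_norm _ _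
    _ ≤ ‖v.pd j‖ * ‖v.pd j‖ := by gcongr; exact LogLogNLS.norm_res_le hs _
    _ = _ := by ring

theorem norm_sub_res_sq_eq {s : ℝ} (hs : 0 ≤ s) (v : H1 d) :
    ‖v.fn - LogLogNLS.res s v.fn‖ ^ 2
      = ∫ ξ, (s * asym ξ * rsym s ξ) ^ 2 * ‖(𝓕 v.fn : L2 d) ξ‖ ^ 2 := by
  rw [norm_sq_eq_integral_fourier]
  refine integral_congr_ae ?_
  filter_upwards [fourier_sub_res hs v.fn] with ξ h
  rw [h, norm_mul, Complex.norm_real, mul_pow, Real.norm_eq_abs, sq_abs]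

theorem integrable_mul_asym_mul (v : H1 d) {g : Sp d → ℝ} {C : ℝ} (hg : Continuous g)
    (hC : ∀ ξ, |g ξ| ≤ C) :
    Integrable (fun ξ => g ξ * asym ξ * ‖(𝓕 v.fn : L2 d) ξ‖ ^ 2) volume := by
  refine ((integrable_asym_mul v).const_mul C).mono' ?_ (Eventually.of_forall fun ξ => ?_)
  · exact ((hg.mul continuous_asym).aestronglyMeasurable).mul
      ((Lp.aestronglyMeasurable _).norm.pow 2)
  · have := asym_nonneg ξ
    rw [norm_mul, norm_mul, Real.norm_of_nonneg this, norm_pow, norm_norm, mul_assoc]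
    exact mul_le_mul_of_nonneg_right (hC ξ) (by positivity)

/-- Telescoping bound for the error of the regularisation at scale `s`. -/
theorem norm_sub_res_sq_le {s : ℝ} (hs : 0 < s) (v : H1 d) :
    ‖v.fn - LogLogNLS.res s v.fn‖ ^ 2 ≤ s * (4 / 3) * (resEnergy (s / 4) v - resEnergy s v) := by
  have hs4 : 0 ≤ s / 4 := by positivity
  have hb : ∀ r : ℝ, 0 ≤ r → ∀ ξ : Sp d, |rsym r ξ| ≤ 1 := fun r hr ξ => by
    rw [abs_of_pos (rsym_pos hr ξ)]; exact rsym_le_one hr ξ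
  rw [norm_sub_res_sq_eq hs.le, resEnergy_eq_integral hs4, resEnergy_eq_integral hs.le,
    ← integral_sub (integrable_mul_asym_mul v (continuous_rsym hs4) (hb _ hs4))
      (integrable_mul_asym_mul v (continuous_rsym hs.le) (hb _ hs.le)), ← integral_const_mul]
  refine integral_mono_of_nonneg (Eventually.of_forall fun ξ => by positivity)
    (((integrable_mul_asym_mul v (continuous_rsym hs4) (hb _ hs4)).sub
      (integrable_mul_asym_mul v (continuous_rsym hs.le) (hb _ hs.le))).const_mul _)
    (Eventually.of_forall fun ξ => ?_)
  have ha := asym_nonneg ξ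
  set a := asym ξ
  have h0 : 0 ≤ ‖(𝓕 v.fn : L2 d) ξ‖ ^ 2 := by positivity
  set F := ‖(𝓕 v.fn : L2 d) ξ‖ ^ 2
  -- The resolvent symbols at scales `s/4` and `s` differ by `(3/4) s a` times their product. The
  -- constant `4/3` therefore makes the right side exactly `(s a)²` times that product, and the
  -- symbol at `s` is the smaller factor.
  have key : (s * a * rsym s ξ) ^ 2 ≤ s * (4 / 3) * (rsym (s / 4) ξ - rsym s ξ) * a := by
    have e1 : rsym s ξ = (1 + s * a)⁻¹ := rfl
    have e2 : rsym (s / 4) ξ = (1 + s / 4 * a)⁻¹ := rfl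
    rw [e1, e2]
    have p1 : 0 < 1 + s * a := by positivity
    have p2 : 0 < 1 + s / 4 * a := by positivity
    have e3 : s * (4 / 3) * ((1 + s / 4 * a)⁻¹ - (1 + s * a)⁻¹) * a
        = (s * a) ^ 2 * ((1 + s / 4 * a)⁻¹ * (1 + s * a)⁻¹) := by
      field_simp
      ring
    rw [e3, mul_pow]
    have : (1 + s * a)⁻¹ ≤ (1 + s / 4 * a)⁻¹ := inv_anti₀ p2 (by nlinarith [mul_nonneg hs.le ha])
    have : (1 + s * a)⁻¹ ^ 2 ≤ (1 + s / 4 * a)⁻¹ * (1 + s * a)⁻¹ := by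
      rw [sq]; gcongr
    gcongr
  calc _ ≤ (s * (4 / 3) * (rsym (s / 4) ξ - rsym s ξ) * a) * F :=
        mul_le_mul_of_nonneg_right key h0
    _ = _ := by ring

/-- The symbol `s a r` of `1 - T` lies in `[0, 1]`, so its square is at most itself; this leaves one
factor `s` times the Dirichlet form. -/
theorem norm_sub_res_sq_le' {s : ℝ} (hs : 0 ≤ s) (v : H1 d) :
    ‖v.fn - LogLogNLS.res s v.fn‖ ^ 2 ≤ s * ∑ j, ‖v.pd j‖ ^ 2 := by
  have h1 : ‖v.fn - LogLogNLS.res s v.fn‖ ^ 2 ≤ s * resEnergy s v := by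
    have hb : ∀ ξ : Sp d, |rsym s ξ| ≤ 1 := fun ξ => by
      rw [abs_of_pos (rsym_pos hs ξ)]; exact rsym_le_one hs ξ
    rw [norm_sub_res_sq_eq hs, resEnergy_eq_integral hs, ← integral_const_mul]
    refine integral_mono_of_nonneg (Eventually.of_forall fun ξ => by positivity)
      ((integrable_mul_asym_mul v (continuous_rsym hs) hb).const_mul _)
      (Eventually.of_forall fun ξ => ?_)
    have ha := asym_nonneg ξ
    have hr := rsym_pos hs ξ
    have h2 : s * asym ξ * rsym s ξ ≤ 1 := by
      rw [← one_sub_rsym hs]; linarith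
    have h3 : 0 ≤ s * asym ξ * rsym s ξ := by positivity
    calc _ = (s * asym ξ * rsym s ξ) * (s * asym ξ * rsym s ξ * ‖(𝓕 v.fn : L2 d) ξ‖ ^ 2) := by ring
      _ ≤ 1 * (s * asym ξ * rsym s ξ * ‖(𝓕 v.fn : L2 d) ξ‖ ^ 2) :=
          mul_le_mul_of_nonneg_right h2 (by positivity)
      _ = _ := by ring
  exact h1.trans (mul_le_mul_of_nonneg_left (resEnergy_le hs v) hs)

theorem norm_sub_res_le_sqrt {s : ℝ} (hs : 0 ≤ s) (v : H1 d) :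
    ‖v.fn - LogLogNLS.res s v.fn‖ ≤ √s * ‖v‖ := by
  refine le_of_sq_le_sq ?_ (by positivity)
  rw [mul_pow, Real.sq_sqrt hs]
  exact (norm_sub_res_sq_le' hs v).trans (mul_le_mul_of_nonneg_left (sum_norm_pd_sq_le v) hs)

end H1

theorem tendsto_res {σ : ℕ → ℝ} (hσ : ∀ n, 0 ≤ σ n) (hlim : Tendsto σ atTop (𝓝 0)) (f : L2 d) :
    Tendsto (fun n => res (σ n) f) atTop (𝓝 f) := by
  have := tendsto_fmul (l := atTop) (m := fun n (ξ : Sp d) => (rsym (σ n) ξ : ℂ))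
    (m₀ := fun _ => (1 : ℂ)) (C := 2) (fun n => memLp_rsym (hσ n))
    (memLp_top_of_continuous (C := 1) continuous_const (by simp))
    (Eventually.of_forall fun n ξ => ?_) (Eventually.of_forall fun ξ => ?_) f
  · rwa [fmul_const_one] at this
  · calc _ ≤ ‖(rsym (σ n) ξ : ℂ)‖ + ‖(1 : ℂ)‖ := norm_sub_le _ _
      _ ≤ 1 + 1 := add_le_add (norm_rsym_ofReal_le (hσ n) ξ) (by simp)
      _ = 2 := by norm_num
  · have h1 : Tendsto (fun n => rsym (σ n) ξ) atTop (𝓝 1) := by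
      have : Tendsto (fun n => 1 + σ n * asym ξ) atTop (𝓝 (1 + 0 * asym ξ)) :=
        (hlim.mul_const _).const_add _
      have := this.inv₀ (by norm_num)
      simpa [rsym] using this
    exact_mod_cast (Complex.continuous_ofReal.tendsto _).comp h1

/-! ### Uniform bounds -/

theorem norm_sq_eq_integral_one_add_asym (v : H1 d) :
    ‖v‖ ^ 2 = ∫ ξ, (1 + asym ξ) * ‖(𝓕 v.fn : L2 d) ξ‖ ^ 2 := by
  have h1 : ∀ᵐ ξ, ∀ j, (𝓕 (v.pd j) : L2 d) ξ = dsym j ξ * (𝓕 v.fn : L2 d) ξ :=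
    ae_all_iff.2 fun j => H1.fourier_pd v j
  rw [H1.norm_sq]
  simp_rw [norm_sq_eq_integral_fourier]
  rw [← integral_finsetSum _ fun j _ => integrable_norm_sq _,
    ← integral_add (integrable_norm_sq _) (integrable_finsetSum _ fun j _ => integrable_norm_sq _)]
  refine integral_congr_ae ?_
  filter_upwards [h1] with ξ h1
  simp_rw [h1, norm_mul, mul_pow]
  rw [← Finset.sum_mul, sum_norm_dsym_sq]
  ring

/-- Convergence in `L²` gives almost everywhere convergence along a subsequence, which transfers
pointwise bounds from Schwartz functions to all of `H¹`. -/
theorem ae_norm_le_of_tendsto {g : ℕ → L2 d} {g₀ : L2 d} {B : ℕ → ℝ} {B₀ : ℝ}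
    (hg : Tendsto g atTop (𝓝 g₀)) (hB : Tendsto B atTop (𝓝 B₀))
    (h : ∀ n, ∀ᵐ x, ‖g n x‖ ≤ B n) : ∀ᵐ x, ‖g₀ x‖ ≤ B₀ := by
  obtain ⟨ns, hns, hlim⟩ := (tendstoInMeasure_of_tendsto_Lp hg).exists_seq_tendsto_ae
  filter_upwards [hlim, ae_all_iff.2 h] with x hx hx'
  exact le_of_tendsto_of_tendsto hx.norm (hB.comp hns.tendsto_atTop)
    (Eventually.of_forall fun n => hx' (ns n))

theorem H1.exists_seq_schwartz (v : H1 d) :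
    ∃ f : ℕ → 𝓢(Sp d, ℂ), Tendsto (fun n => H1.ofSchwartz (f n)) atTop (𝓝 v) := by
  obtain ⟨x, hx, hlim⟩ := mem_closure_iff_seq_limit.1 (H1.denseRange_ofSchwartz v)
  choose f hf using hx
  exact ⟨f, by simpa [hf] using hlim⟩

/-- Fourier inversion bounds the value by `∫ m |𝓕 f|`, and Cauchy–Schwarz with the weights `√(rsym
1)` and `√(1 + asym)`, whose product is one, brings out the `H¹` norm. -/
theorem norm_fourierMultiplierCLM_apply_le {m : Sp d → ℝ} (hm0 : ∀ ξ, 0 ≤ m ξ)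
    (hmc : Continuous m)
    (hmt : (fun ξ => (m ξ : ℂ)).HasTemperateGrowth)
    (hI : Integrable (fun ξ => m ξ ^ 2 * rsym 1 ξ) volume) (f : 𝓢(Sp d, ℂ)) (x : Sp d) :
    ‖SchwartzMap.fourierMultiplierCLM ℂ (fun ξ => (m ξ : ℂ)) f x‖
      ≤ √(∫ ξ, m ξ ^ 2 * rsym 1 ξ) * ‖H1.ofSchwartz f‖ := by
  have e1 : ‖SchwartzMap.fourierMultiplierCLM ℂ (fun ξ => (m ξ : ℂ)) f x‖
      ≤ ∫ ξ, m ξ * ‖𝓕 f ξ‖ := by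
    rw [SchwartzMap.fourierMultiplierCLM_apply, SchwartzMap.fourierInv_coe, Real.fourierInv_eq]
    refine (norm_integral_le_integral_norm _).trans (le_of_eq ?_)
    refine integral_congr_ae (Eventually.of_forall fun ξ => ?_)
    simp only [Circle.norm_smul, SchwartzMap.smulLeftCLM_apply_apply hmt, smul_eq_mul, norm_mul,
      Complex.norm_real, Real.norm_of_nonneg (hm0 ξ)]
  have hpos : ∀ ξ : Sp d, 0 < 1 + asym ξ := fun ξ => by have := asym_nonneg ξ; positivity
  have hrs : ∀ ξ : Sp d, rsym 1 ξ = (1 + asym ξ)⁻¹ := fun ξ => by simp [rsym]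
  have hn : ∫ ξ, (1 + asym ξ) * ‖𝓕 f ξ‖ ^ 2 = ‖H1.ofSchwartz f‖ ^ 2 := by
    rw [norm_sq_eq_integral_one_add_asym, H1.ofSchwartz_fn, SchwartzMap.toLp_fourier_eq]
    refine integral_congr_ae ?_
    filter_upwards [(𝓕 f).coeFn_toLp 2] with ξ h
    rw [h]
  have hint : Integrable (fun ξ => (1 + asym ξ) * ‖𝓕 f ξ‖ ^ 2) volume := by
    have h1 := integrable_norm_sq (𝓕 (H1.ofSchwartz f).fn : L2 d)
    refine (h1.add (H1.integrable_asym_mul (H1.ofSchwartz f))).congr ?_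
    rw [H1.ofSchwartz_fn, SchwartzMap.toLp_fourier_eq]
    filter_upwards [(𝓕 f).coeFn_toLp 2] with ξ h
    simp only [Pi.add_apply, h]; ring
  refine e1.trans ?_
  have hF : Continuous fun ξ => ‖𝓕 f ξ‖ := (𝓕 f).continuous.norm
  have hs1 : Continuous fun ξ : Sp d => √(rsym 1 ξ) := (continuous_rsym zero_le_one).sqrt
  have hs2 : Continuous fun ξ : Sp d => √(1 + asym ξ) := (continuous_const.add continuous_asym).sqrt
  have hm1 : MemLp (fun ξ => m ξ * √(rsym 1 ξ)) (ENNReal.ofReal 2) (volume : Measure (Sp d)) := by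
    rw [ENNReal.ofReal_ofNat]
    refine (memLp_two_iff_integrable_sq (μ := volume) (hmc.mul hs1).aestronglyMeasurable).2 ?_
    refine hI.congr (Eventually.of_forall fun ξ => ?_)
    simp only [Pi.mul_apply, mul_pow, Real.sq_sqrt (rsym_pos zero_le_one ξ).le]
  have hm2 : MemLp (fun ξ => √(1 + asym ξ) * ‖𝓕 f ξ‖) (ENNReal.ofReal 2)
      (volume : Measure (Sp d)) := by
    rw [ENNReal.ofReal_ofNat]
    refine (memLp_two_iff_integrable_sq (μ := volume) (hs2.mul hF).aestronglyMeasurable).2 ?_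
    refine hint.congr (Eventually.of_forall fun ξ => ?_)
    simp only [Pi.mul_apply, mul_pow, Real.sq_sqrt (hpos ξ).le]
  have hcs := integral_mul_le_Lp_mul_Lq_of_nonneg Real.HolderConjugate.two_two
    (Eventually.of_forall fun ξ => mul_nonneg (hm0 ξ) (Real.sqrt_nonneg (rsym 1 ξ)))
    (Eventually.of_forall fun ξ => mul_nonneg (Real.sqrt_nonneg (1 + asym ξ))
      (norm_nonneg (𝓕 f ξ))) hm1 hm2
  have hl : ∀ ξ, m ξ * √(rsym 1 ξ) * (√(1 + asym ξ) * ‖𝓕 f ξ‖) = m ξ * ‖𝓕 f ξ‖ := fun ξ => by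
    have : √(rsym 1 ξ) * √(1 + asym ξ) = 1 := by
      rw [← Real.sqrt_mul (rsym_pos zero_le_one ξ).le, hrs, inv_mul_cancel₀ (hpos ξ).ne',
        Real.sqrt_one]
    linear_combination (m ξ * ‖𝓕 f ξ‖) * this
  have hr1 : ∀ ξ, (m ξ * √(rsym 1 ξ)) ^ (2 : ℝ) = m ξ ^ 2 * rsym 1 ξ := fun ξ => by
    rw [Real.rpow_two, mul_pow, Real.sq_sqrt (rsym_pos zero_le_one ξ).le]
  have hr2 : ∀ ξ, (√(1 + asym ξ) * ‖𝓕 f ξ‖) ^ (2 : ℝ) = (1 + asym ξ) * ‖𝓕 f ξ‖ ^ 2 := fun ξ => by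
    rw [Real.rpow_two, mul_pow, Real.sq_sqrt (hpos ξ).le]
  simp_rw [hl, hr1, hr2] at hcs
  rw [hn, ← Real.sqrt_eq_rpow, ← Real.sqrt_eq_rpow, Real.sqrt_sq (norm_nonneg _)] at hcs
  exact hcs

theorem ae_norm_fmul_le {m : Sp d → ℝ} (hm0 : ∀ ξ, 0 ≤ m ξ) {C : ℝ}
    (hmc : Continuous m) (hC : ∀ ξ, m ξ ≤ C)
    (hmt : (fun ξ => (m ξ : ℂ)).HasTemperateGrowth)
    (hI : Integrable (fun ξ => m ξ ^ 2 * rsym 1 ξ) volume) (v : H1 d) :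
    ∀ᵐ x, ‖fmul (fun ξ => (m ξ : ℂ)) v.fn x‖ ≤ √(∫ ξ, m ξ ^ 2 * rsym 1 ξ) * ‖v‖ := by
  obtain ⟨f, hf⟩ := H1.exists_seq_schwartz v
  have hmb : MemLp (fun ξ => (m ξ : ℂ)) ∞ (volume : Measure (Sp d)) :=
    memLp_top_of_continuous (C := C) (Complex.continuous_ofReal.comp hmc) fun ξ => by
      rw [Complex.norm_real, Real.norm_of_nonneg (hm0 ξ)]; exact hC ξ
  refine ae_norm_le_of_tendsto (((fmul fun ξ => (m ξ : ℂ)).continuous.tendsto _).comp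
    (((H1.fnL d).continuous.tendsto v).comp hf)) (hf.norm.const_mul _) fun n => ?_
  simp only [Function.comp, H1.fnL_apply, H1.ofSchwartz_fn]
  rw [fmul_toLp hmb hmt]
  filter_upwards [(SchwartzMap.fourierMultiplierCLM ℂ (fun ξ => (m ξ : ℂ)) (f n)).coeFn_toLp 2]
    with x hx
  rw [hx]
  exact norm_fourierMultiplierCLM_apply_le hm0 hmc hmt hI (f n) x

theorem rsym_one_le (ξ : Sp d) : rsym 1 ξ ≤ (1 + ‖ξ‖ ^ 2)⁻¹ := by
  unfold rsym asym
  refine inv_anti₀ (by positivity) ?_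
  have : 1 ≤ Real.pi := by linarith [Real.pi_gt_three]
  nlinarith [sq_nonneg ‖ξ‖, mul_nonneg (sq_nonneg ‖ξ‖) (show 0 ≤ 4 * Real.pi ^ 2 - 1 by nlinarith)]

theorem integrable_rsym_one_mul (hd : d = 1) :
    Integrable (fun ξ : Sp d => (1 : ℝ) ^ 2 * rsym 1 ξ) volume := by
  have h := integrable_rpow_neg_one_add_norm_sq (E := Sp d) (μ := volume) (r := 2)
    (by simp [hd])
  refine h.mono' (by have := continuous_rsym (d := d) zero_le_one; fun_prop)
    (Eventually.of_forall fun ξ => ?_)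
  rw [one_pow, one_mul, Real.norm_of_nonneg (rsym_pos zero_le_one ξ).le]
  refine (rsym_one_le ξ).trans (le_of_eq ?_)
  rw [show (-2 / 2 : ℝ) = -1 by norm_num, Real.rpow_neg_one]

/-- Sobolev embedding `H¹ ⊂ L^∞` in dimension one. -/
theorem exists_ae_norm_le_of_dim_one (hd : d = 1) :
    ∃ C : ℝ, 0 ≤ C ∧ ∀ v : H1 d, ∀ᵐ x, ‖v.fn x‖ ≤ C * ‖v‖ := by
  refine ⟨√(∫ ξ : Sp d, (1 : ℝ) ^ 2 * rsym 1 ξ), Real.sqrt_nonneg _, fun v => ?_⟩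
  have := ae_norm_fmul_le (m := fun _ : Sp d => (1 : ℝ)) (fun _ => zero_le_one) (C := 1)
    continuous_const (fun _ => le_rfl) (by simp)
    (integrable_rsym_one_mul hd) v
  simpa [fmul_const_one] using this

theorem rsym_le_mul_rsym_one {s : ℝ} (hs : 0 < s) (hs1 : s ≤ 1) (ξ : Sp d) :
    rsym s ξ ≤ s⁻¹ * rsym 1 ξ := by
  have ha := asym_nonneg ξ
  unfold rsym
  rw [← mul_inv]
  refine inv_anti₀ (by positivity) ?_
  nlinarith

theorem integrable_rsym_mul_rsym (hd : d ≤ 2) {s r : ℝ} (hs : 0 < s) (hs1 : s ≤ 1) (hr : 0 < r)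
    (hr1 : r ≤ 1) :
    Integrable (fun ξ : Sp d => rsym s ξ * rsym r ξ) volume := by
  have h := integrable_rpow_neg_one_add_norm_sq (E := Sp d) (μ := volume) (r := 4)
    (by
      rw [finrank_euclideanSpace_fin]
      have : (d : ℝ) ≤ 2 := by exact_mod_cast hd
      linarith)
  refine (h.const_mul (s⁻¹ * r⁻¹)).mono' ((continuous_rsym hs.le).mul
    (continuous_rsym hr.le)).aestronglyMeasurable (Eventually.of_forall fun ξ => ?_)
  have p1 := rsym_pos hs.le ξ
  have p2 := rsym_pos hr.le ξ
  have p3 := rsym_pos zero_le_one ξ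
  rw [Real.norm_of_nonneg (by positivity), show (-4 / 2 : ℝ) = -2 by norm_num,
    Real.rpow_neg (by positivity), Real.rpow_two, ← inv_pow]
  calc rsym s ξ * rsym r ξ ≤ (s⁻¹ * rsym 1 ξ) * (r⁻¹ * rsym 1 ξ) :=
        mul_le_mul (rsym_le_mul_rsym_one hs hs1 ξ) (rsym_le_mul_rsym_one hr hr1 ξ) p2.le
          (by positivity)
    _ = s⁻¹ * r⁻¹ * rsym 1 ξ ^ 2 := by ring
    _ ≤ _ := by
      have := rsym_one_le ξ
      gcongr

theorem rsym_smul {s r : ℝ} (hs : 0 ≤ s) (ξ : Sp d) : rsym r (√s • ξ) = rsym (s * r) ξ := by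
  simp only [rsym, asym, norm_smul, mul_pow, Real.norm_of_nonneg (Real.sqrt_nonneg s),
    Real.sq_sqrt hs]
  ring_nf

/-- Dyadic scales `4⁻ʲ`. -/
def sc (j : ℕ) : ℝ := (1 / 4) ^ j

theorem sc_pos (j : ℕ) : 0 < sc j := by unfold sc; positivity
theorem sc_le_one (j : ℕ) : sc j ≤ 1 := by
  unfold sc; exact pow_le_one₀ (by norm_num) (by norm_num)
theorem sc_succ (j : ℕ) : sc (j + 1) = sc j / 4 := by unfold sc; ring
theorem tendsto_sc : Tendsto sc atTop (𝓝 0) :=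
  tendsto_pow_atTop_nhds_zero_of_lt_one (by norm_num) (by norm_num)

/-- In dimension two the integral diverges like `log (1/s)` as `s → 0`. Induction over the scales
shows this: passing from `s` to `s/4` costs at most the fixed amount `D`. -/
theorem exists_integral_rsym_le (hd : d = 2) :
    ∃ C : ℝ, 0 ≤ C ∧ ∀ j : ℕ, ∫ ξ : Sp d, rsym (sc j) ξ * rsym 1 ξ ≤ C * (1 + j) := by
  set I0 := ∫ ξ : Sp d, rsym 1 ξ * rsym 1 ξ
  set D := ∫ ξ : Sp d, rsym 1 ξ * rsym (1 / 4) ξ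
  have hI0 : 0 ≤ I0 := integral_nonneg fun ξ => by
    have := rsym_pos zero_le_one ξ
    positivity
  have hD : 0 ≤ D := integral_nonneg fun ξ => by
    have := rsym_pos zero_le_one ξ
    have := rsym_pos (show (0 : ℝ) ≤ 1 / 4 by norm_num) ξ
    positivity
  have key : ∀ j : ℕ, ∫ ξ : Sp d, rsym (sc j) ξ * rsym 1 ξ ≤ I0 + D * j := by
    intro j
    induction j with
    | zero => simp [sc, I0]
    | succ j ih =>
      have hs := sc_pos j
      have hs4 : 0 < sc j / 4 := by positivity
      have hs1 := sc_le_one j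
      -- The substitution `ξ ↦ √s ξ` has Jacobian `s^{d/2}`, which equals the prefactor `s` exactly
      -- in dimension two; hence the cost of one step does not depend on `j`.
      have hscale : ∫ ξ : Sp d, sc j * (rsym (sc j) ξ * rsym (sc j / 4) ξ) = D := by
        have h := Measure.integral_comp_smul (volume : Measure (Sp d))
          (fun ξ : Sp d => rsym 1 ξ * rsym (1 / 4) ξ) (√(sc j))
        simp_rw [rsym_smul hs.le] at h
        rw [finrank_euclideanSpace_fin, hd, Real.sq_sqrt hs.le, abs_of_pos (by positivity),
          smul_eq_mul] at h
        rw [integral_const_mul]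
        have e : ∀ ξ : Sp d, rsym (sc j) ξ * rsym (sc j / 4) ξ
            = rsym (sc j * 1) ξ * rsym (sc j * (1 / 4)) ξ := fun ξ => by
          rw [mul_one, mul_one_div]
        simp_rw [e]
        subst hd
        rw [h, ← mul_assoc, mul_inv_cancel₀ hs.ne', one_mul]
      have hle : ∫ ξ : Sp d, rsym (sc j / 4) ξ * rsym 1 ξ
          ≤ ∫ ξ : Sp d, (rsym (sc j) ξ * rsym 1 ξ + sc j * (rsym (sc j) ξ * rsym (sc j / 4) ξ)) := by
        refine integral_mono (integrable_rsym_mul_rsym hd.le hs4 (by linarith) one_pos le_rfl)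
          ((integrable_rsym_mul_rsym hd.le hs hs1 one_pos le_rfl).add
            ((integrable_rsym_mul_rsym hd.le hs hs1 hs4 (by linarith)).const_mul _)) fun ξ => ?_
        have ha := asym_nonneg ξ
        have p1 := rsym_pos hs.le ξ
        have p2 := rsym_pos hs4.le ξ
        have p3 := rsym_pos zero_le_one ξ
        have e1 : rsym (sc j / 4) ξ - rsym (sc j) ξ
            = 3 / 4 * sc j * asym ξ * (rsym (sc j) ξ * rsym (sc j / 4) ξ) := by
          have q1 : 0 < 1 + sc j * asym ξ := by positivity
          have q2 : 0 < 1 + sc j / 4 * asym ξ := by positivity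
          unfold rsym
          field_simp
          ring
        have e2 : asym ξ * rsym 1 ξ ≤ 1 := by
          have := one_sub_rsym zero_le_one ξ
          rw [one_mul] at this
          linarith
        have e3 : (rsym (sc j / 4) ξ - rsym (sc j) ξ) * rsym 1 ξ
            ≤ sc j * (rsym (sc j) ξ * rsym (sc j / 4) ξ) := by
          rw [e1]
          calc _ = (3 / 4 * (asym ξ * rsym 1 ξ)) *
                (sc j * (rsym (sc j) ξ * rsym (sc j / 4) ξ)) := by ring
            _ ≤ 1 * (sc j * (rsym (sc j) ξ * rsym (sc j / 4) ξ)) :=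
              mul_le_mul_of_nonneg_right (by linarith) (by positivity)
            _ = _ := one_mul _
        simp only
        linarith
      rw [integral_add (integrable_rsym_mul_rsym hd.le hs hs1 one_pos le_rfl)
            ((integrable_rsym_mul_rsym hd.le hs hs1 hs4 (by linarith)).const_mul _), hscale] at hle
      rw [sc_succ]
      push_cast
      linarith
  refine ⟨I0 + D, by positivity, fun j => (key j).trans ?_⟩
  have : (0 : ℝ) ≤ j := Nat.cast_nonneg j
  nlinarith

/-- The regularisation at scale `4⁻ʲ` is bounded, with logarithmic growth in two dimensions. -/
theorem exists_ae_norm_res_le (hd : d = 1 ∨ d = 2) :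
    ∃ C : ℝ, 0 ≤ C ∧ ∀ (j : ℕ) (v : H1 d),
      ∀ᵐ x, ‖res (sc j) v.fn x‖ ≤ C * √(1 + j) * ‖v‖ := by
  rcases hd with hd | hd
  · obtain ⟨C, hC, h⟩ := exists_ae_norm_le_of_dim_one hd
    refine ⟨C, hC, fun j v => ?_⟩
    filter_upwards [h (H1.res (sc_pos j).le v)] with x hx
    refine hx.trans ?_
    have h1 : (1 : ℝ) ≤ √(1 + j) := by
      rw [Real.one_le_sqrt]
      have : (0 : ℝ) ≤ j := Nat.cast_nonneg j
      linarith
    have h2 := H1.norm_res_le (sc_pos j).le v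
    calc C * ‖H1.res (sc_pos j).le v‖ ≤ C * 1 * ‖v‖ := by rw [mul_one]; gcongr
      _ ≤ _ := by gcongr
  · obtain ⟨C, hC, h⟩ := exists_integral_rsym_le hd
    refine ⟨√C, Real.sqrt_nonneg _, fun j v => ?_⟩
    have hs := sc_pos j
    have hle : ∀ ξ : Sp d, rsym (sc j) ξ ^ 2 * rsym 1 ξ ≤ rsym (sc j) ξ * rsym 1 ξ := fun ξ => by
      have p1 := rsym_pos hs.le ξ
      have p2 := rsym_pos zero_le_one ξ
      have p3 := rsym_le_one hs.le ξ
      rw [sq, mul_assoc]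
      exact mul_le_of_le_one_left (by positivity) p3
    have hint := integrable_rsym_mul_rsym hd.le hs (sc_le_one j) one_pos le_rfl
    have hint2 : Integrable (fun ξ : Sp d => rsym (sc j) ξ ^ 2 * rsym 1 ξ) volume := by
      refine hint.mono' (((continuous_rsym hs.le).pow 2).mul
        (continuous_rsym zero_le_one)).aestronglyMeasurable (Eventually.of_forall fun ξ => ?_)
      have p2 := rsym_pos zero_le_one ξ
      rw [Real.norm_of_nonneg (by positivity)]
      exact hle ξ
    filter_upwards [ae_norm_fmul_le (fun ξ => (rsym_pos hs.le ξ).le) (continuous_rsym hs.le)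
      (rsym_le_one hs.le) (hasTemperateGrowth_rsym_ofReal hs.le) hint2 v] with x hx
    refine hx.trans ?_
    rw [← Real.sqrt_mul hC]
    gcongr
    exact (integral_mono hint2 hint hle).trans (h j)

/-! ### Gagliardo–Nirenberg in dimension two -/

/-- The inequality `‖g‖_{L²} ≤ C ‖∇g‖_{L¹}` on `ℝ²`. -/
theorem eLpNorm_two_le_eLpNorm_fderiv (hd : d = 2) :
    ∃ C : ℝ≥0∞, C ≠ ⊤ ∧ ∀ g : Sp d → ℂ, ContDiff ℝ 1 g → eLpNorm g 1 volume ≠ ⊤ →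
      eLpNorm g 2 volume ≤ C * eLpNorm (fderiv ℝ g) 1 volume := by
  have hconj : NNReal.HolderConjugate (Module.finrank ℝ (Sp d) : NNReal) 2 := by
    rw [finrank_euclideanSpace_fin, hd]
    exact NNReal.HolderConjugate.two_two
  refine ⟨(eLpNormLESNormFDerivOneConst (volume : Measure (Sp d)) ((2 : NNReal) : ℝ) : ℝ≥0∞),
    ENNReal.coe_ne_top, fun g hg hg1 => ?_⟩
  set C : ℝ≥0∞ := (eLpNormLESNormFDerivOneConst (volume : Measure (Sp d)) ((2 : NNReal) : ℝ) : ℝ≥0∞)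
  -- The Sobolev inequality at hand requires compact support. Slowly varying cutoffs `ψ(x/(n+1))`
  -- provide it; the gradient falling on the cutoff costs `O(1/n) ‖g‖_{L¹}`, and Fatou's lemma
  -- removes the cutoff in the limit.
  let ψ : ContDiffBump (0 : Sp d) := ⟨1, 2, one_pos, one_lt_two⟩
  obtain ⟨M, hM⟩ : ∃ M, ∀ x, ‖fderiv ℝ ψ x‖ ≤ M :=
    (ψ.hasCompactSupport.fderiv (𝕜 := ℝ)).exists_bound_of_continuous
      ((ψ.contDiff (n := 1)).continuous_fderiv one_ne_zero)
  have hM0 : 0 ≤ M := (norm_nonneg _).trans (hM 0)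
  let r : ℕ → ℝ := fun n => ((n : ℝ) + 1)⁻¹
  have hr : ∀ n, 0 < r n := fun n => by positivity
  have hr0 : Tendsto r atTop (𝓝 0) := by
    simpa [r] using tendsto_one_div_add_atTop_nhds_zero_nat (𝕜 := ℝ)
  let χ : ℕ → Sp d → ℝ := fun n x => ψ (r n • x)
  have hχ : ∀ n, ContDiff ℝ 1 (χ n) := fun n =>
    (ψ.contDiff (n := 1)).comp (contDiff_const_smul (r n))
  have hχ1 : ∀ n x, ‖χ n x‖ ≤ 1 := fun n x => by
    rw [Real.norm_of_nonneg ψ.nonneg]; exact ψ.le_one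
  have hχ' : ∀ n x, ‖fderiv ℝ (χ n) x‖ ≤ r n * M := fun n x => by
    have h1 : HasFDerivAt (χ n) ((fderiv ℝ ψ (r n • x)).comp
        (r n • ContinuousLinearMap.id ℝ (Sp d))) x :=
      (((ψ.contDiff (n := 1)).differentiable one_ne_zero) _).hasFDerivAt.comp x
        ((r n • ContinuousLinearMap.id ℝ (Sp d)).hasFDerivAt)
    rw [h1.fderiv]
    simp only [ContinuousLinearMap.comp_smul, ContinuousLinearMap.comp_id, norm_smul,
      Real.norm_of_nonneg (hr n).le]
    exact mul_le_mul_of_nonneg_left (hM _) (hr n).le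
  have hcs : ∀ n, HasCompactSupport (χ n) := fun n =>
    ψ.hasCompactSupport.comp_homeomorph (Homeomorph.smulOfNeZero (r n) (hr n).ne')
  have hbound : ∀ n, eLpNorm (fun x => χ n x • g x) 2 volume
      ≤ C * (eLpNorm (fderiv ℝ g) 1 volume + ENNReal.ofReal (r n * M) * eLpNorm g 1 volume) := by
    intro n
    have h1 := eLpNorm_le_eLpNorm_fderiv_one (F := ℂ) (volume : Measure (Sp d))
      ((hχ n).smul hg) (hcs n).smul_right hconj
    refine h1.trans (mul_le_mul_right ?_ _)
    have hg1' : AEStronglyMeasurable (fun x => ‖fderiv ℝ g x‖) (volume : Measure (Sp d)) :=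
      (hg.continuous_fderiv one_ne_zero).norm.aestronglyMeasurable
    have hg2 : AEStronglyMeasurable (fun x => (r n * M) * ‖g x‖) (volume : Measure (Sp d)) :=
      (hg.continuous.norm.const_mul _).aestronglyMeasurable
    calc eLpNorm (fderiv ℝ (χ n • g)) 1 volume
        ≤ eLpNorm ((fun x => ‖fderiv ℝ g x‖) + fun x => (r n * M) * ‖g x‖) 1 volume := by
          refine eLpNorm_mono fun x => ?_
          have hx : HasFDerivAt (χ n • g) (χ n x • fderiv ℝ g x + (fderiv ℝ (χ n) x).smulRight (g x))
              x := (((hχ n).differentiable one_ne_zero) x).hasFDerivAt.smul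
                ((hg.differentiable one_ne_zero) x).hasFDerivAt
          rw [hx.fderiv]
          have hnn : 0 ≤ (r n * M) * ‖g x‖ := mul_nonneg (mul_nonneg (hr n).le hM0) (norm_nonneg _)
          rw [Pi.add_apply, Real.norm_of_nonneg (add_nonneg (norm_nonneg _) hnn)]
          refine (norm_add_le _ _).trans (add_le_add ?_ ?_)
          · rw [norm_smul]
            exact mul_le_of_le_one_left (norm_nonneg _) (hχ1 n x)
          · rw [ContinuousLinearMap.norm_smulRight_apply]
            exact mul_le_mul_of_nonneg_right (hχ' n x) (norm_nonneg _)
      _ ≤ _ := eLpNorm_add_le hg1' hg2 le_rfl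
      _ ≤ _ := by
          refine add_le_add (by rw [eLpNorm_norm]) ?_
          refine eLpNorm_le_mul_eLpNorm_of_ae_le_mul (Eventually.of_forall fun x => ?_) 1
          rw [norm_mul, norm_norm, Real.norm_of_nonneg (mul_nonneg (hr n).le hM0)]
  have hlim : ∀ x, Tendsto (fun n => χ n x • g x) atTop (𝓝 (g x)) := fun x => by
    have h1 : Tendsto (fun n => χ n x) atTop (𝓝 (ψ ((0 : ℝ) • x))) :=
      (ψ.continuous.tendsto _).comp (hr0.smul_const x)
    have h2 : ψ ((0 : ℝ) • x) = 1 := by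
      rw [zero_smul]
      exact ψ.one_of_mem_closedBall (by simp [ψ])
    rw [h2] at h1
    simpa using h1.smul_const (g x)
  refine (Lp.eLpNorm_lim_le_liminf_eLpNorm (fun n =>
    ((hχ n).continuous.smul hg.continuous).aestronglyMeasurable) g
    (Eventually.of_forall hlim)).trans ?_
  have hT : Tendsto (fun n => C * (eLpNorm (fderiv ℝ g) 1 volume
      + ENNReal.ofReal (r n * M) * eLpNorm g 1 volume)) atTop
      (𝓝 (C * (eLpNorm (fderiv ℝ g) 1 volume + 0 * eLpNorm g 1 volume))) := by
    refine ENNReal.Tendsto.const_mul (Tendsto.const_add _ ?_) (Or.inr ENNReal.coe_ne_top)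
    refine ENNReal.Tendsto.mul_const ?_ (Or.inr hg1)
    have : Tendsto (fun n => r n * M) atTop (𝓝 (0 * M)) := hr0.mul_const M
    rw [zero_mul] at this
    simpa using ENNReal.tendsto_ofReal this
  rw [zero_mul, add_zero] at hT
  calc _ ≤ atTop.liminf fun n => C * (eLpNorm (fderiv ℝ g) 1 volume
      + ENNReal.ofReal (r n * M) * eLpNorm g 1 volume) := liminf_le_liminf (Eventually.of_forall hbound)
    _ = _ := hT.liminf_eq

theorem norm_fderiv_le_sum (f : 𝓢(Sp d, ℂ)) (x : Sp d) :
    ‖fderiv ℝ f x‖ ≤ ∑ j, ‖(∂_{(stdVec j : Sp d)} f : 𝓢(Sp d, ℂ)) x‖ := by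
  refine ContinuousLinearMap.opNorm_le_bound _ (Finset.sum_nonneg fun _ _ => norm_nonneg _)
    fun y => ?_
  have hy : y = ∑ j, y j • (stdVec j : Sp d) := by
    have := (EuclideanSpace.basisFun (Fin d) ℝ).sum_repr y
    simpa using this.symm
  conv_lhs => rw [hy]
  rw [map_sum, Finset.sum_mul]
  refine (norm_sum_le _ _).trans (Finset.sum_le_sum fun j _ => ?_)
  rw [map_smul, norm_smul, SchwartzMap.lineDerivOp_apply_eq_fderiv, mul_comm]
  exact mul_le_mul_of_nonneg_left (EuclideanSpace.norm_eq y ▸ by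
    refine Real.le_sqrt_of_sq_le ?_
    exact Finset.single_le_sum (f := fun j => ‖y j‖ ^ 2) (fun _ _ => by positivity)
      (Finset.mem_univ j)) (norm_nonneg _)

theorem eLpNorm_toLp (f : 𝓢(Sp d, ℂ)) :
    eLpNorm f 2 volume = ENNReal.ofReal ‖(f.toLp 2 : L2 d)‖ := by
  rw [SchwartzMap.norm_toLp, ENNReal.ofReal_toReal (f.memLp 2 volume).2.ne]

theorem eLpNorm_fderiv_le (f : 𝓢(Sp d, ℂ)) :
    eLpNorm (fderiv ℝ f) 2 volume ≤ ENNReal.ofReal (d * ‖H1.ofSchwartz f‖) := by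
  calc _ ≤ eLpNorm (∑ j, fun x => ‖(∂_{stdVec j} f : 𝓢(Sp d, ℂ)) x‖) 2 volume := by
        refine eLpNorm_mono fun x => ?_
        rw [Finset.sum_apply, Real.norm_of_nonneg (Finset.sum_nonneg fun _ _ => norm_nonneg _)]
        exact norm_fderiv_le_sum f x
    _ ≤ ∑ j, eLpNorm (fun x => ‖(∂_{stdVec j} f : 𝓢(Sp d, ℂ)) x‖) 2 volume :=
        eLpNorm_sum_le (fun j _ => (∂_{stdVec j} f : 𝓢(Sp d, ℂ)).continuous.norm.aestronglyMeasurable)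
          one_le_two
    _ ≤ ∑ _j : Fin d, ENNReal.ofReal ‖H1.ofSchwartz f‖ := by
        refine Finset.sum_le_sum fun j _ => ?_
        rw [eLpNorm_norm, eLpNorm_toLp]
        exact ENNReal.ofReal_le_ofReal (H1.norm_pd_le (H1.ofSchwartz f) j)
    _ = _ := by
        rw [Finset.sum_const, Finset.card_univ, Fintype.card_fin, nsmul_eq_mul,
          ENNReal.ofReal_mul (Nat.cast_nonneg d), ENNReal.ofReal_natCast]

/-- Hölder's inequality applied to `∇(f^{k+1}) = (k+1) fᵏ ∇f`. -/
theorem eLpNorm_fderiv_pow_le (f : 𝓢(Sp d, ℂ)) (k : ℕ) :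
    eLpNorm (fderiv ℝ fun x => f x ^ (k + 1)) 1 volume
      ≤ (k + 1 : ℕ) * eLpNorm (fun x => f x ^ k) 2 volume * eLpNorm (fderiv ℝ f) 2 volume := by
  have h := eLpNorm_le_eLpNorm_mul_eLpNorm_of_nnnorm (p := 2) (q := 2) (r := 1)
    (μ := (volume : Measure (Sp d))) (f := fun x => f x ^ k) (g := fderiv ℝ f)
    (f.continuous.pow k).aestronglyMeasurable
    ((f.smooth 1).continuous_fderiv one_ne_zero).aestronglyMeasurable
    (fun a b => ((k + 1 : ℕ) : ℂ) • a • b) ((k + 1 : ℕ) : NNReal)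
    (Eventually.of_forall fun x => by
      rw [nnnorm_smul, nnnorm_smul, mul_assoc]
      refine mul_le_mul_left (le_of_eq ?_) _
      rw [Complex.nnnorm_natCast])
  have e : (fun x => ((k + 1 : ℕ) : ℂ) • (f x ^ k) • fderiv ℝ f x)
      = fderiv ℝ fun x => f x ^ (k + 1) := by
    funext x
    rw [((f.differentiable x).hasFDerivAt.pow (k + 1)).fderiv]
    simp [smul_smul]
  rw [e] at h
  simpa using h

theorem eLpNorm_one_pow_ne_top (f : 𝓢(Sp d, ℂ)) (k : ℕ) :
    eLpNorm (fun x => f x ^ (k + 1)) 1 volume ≠ ⊤ := by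
  obtain ⟨M, hM⟩ : ∃ M, ∀ x, ‖f x‖ ≤ M :=
    ⟨_, SchwartzMap.norm_le_seminorm ℝ f⟩
  have : eLpNorm (fun x => f x ^ (k + 1)) 1 volume
      ≤ ENNReal.ofReal (M ^ k) * eLpNorm f 1 volume := by
    refine eLpNorm_le_mul_eLpNorm_of_ae_le_mul (Eventually.of_forall fun x => ?_) 1
    rw [norm_pow, pow_succ]
    gcongr
    exact hM x
  exact (this.trans_lt (ENNReal.mul_lt_top ENNReal.ofReal_lt_top (f.memLp 1 volume).2)).ne

/-- The embedding of `W^{1,1}` in `L²` is applied twice: to `f³`, whose gradient is `3 f² ∇f`, and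
then to `f²`, whose gradient is `2 f ∇f`. The cube `f³` has the modulus of `|f|² f`, but it is a
polynomial in `f` and so causes no trouble with derivatives. -/
theorem exists_eLpNorm_cube_schwartz_le (hd : d = 2) :
    ∃ C : ℝ, 0 ≤ C ∧ ∀ f : 𝓢(Sp d, ℂ), eLpNorm (fun x => f x ^ 3) 2 volume
      ≤ ENNReal.ofReal (C * ‖H1.ofSchwartz f‖ ^ 2 * ‖(H1.ofSchwartz f).fn‖) := by
  obtain ⟨C, hC, h⟩ := eLpNorm_two_le_eLpNorm_fderiv hd
  refine ⟨6 * C.toReal ^ 2 * d ^ 2, by positivity, fun f => ?_⟩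
  have h1 := h (fun x => f x ^ 2) ((f.smooth 1).pow 2) (eLpNorm_one_pow_ne_top f 1)
  have h2 := h (fun x => f x ^ 3) ((f.smooth 1).pow 3) (eLpNorm_one_pow_ne_top f 2)
  have h3 := eLpNorm_fderiv_pow_le f 1
  have h4 := eLpNorm_fderiv_pow_le f 2
  have h5 := eLpNorm_fderiv_le f
  simp only [pow_one] at h3
  rw [eLpNorm_toLp] at h3
  have hC' : C = ENNReal.ofReal C.toReal := (ENNReal.ofReal_toReal hC).symm
  calc eLpNorm (fun x => f x ^ 3) 2 volume
      ≤ C * (((2 + 1 : ℕ) : ℝ≥0∞) * (C * (((1 + 1 : ℕ) : ℝ≥0∞) *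
          ENNReal.ofReal ‖(f.toLp 2 : L2 d)‖ * ENNReal.ofReal (d * ‖H1.ofSchwartz f‖)))
          * ENNReal.ofReal (d * ‖H1.ofSchwartz f‖)) := by
        refine h2.trans ?_
        gcongr
        refine h4.trans ?_
        gcongr
        refine h1.trans ?_
        gcongr
        refine h3.trans ?_
        gcongr
    _ = _ := by
        rw [hC', ENNReal.toReal_ofReal ENNReal.toReal_nonneg, ← ENNReal.ofReal_natCast,
          ← ENNReal.ofReal_natCast]
        rw [← ENNReal.ofReal_mul (by positivity), ← ENNReal.ofReal_mul (by positivity),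
          ← ENNReal.ofReal_mul (by positivity), ← ENNReal.ofReal_mul (by positivity),
          ← ENNReal.ofReal_mul (by positivity), ← ENNReal.ofReal_mul (by positivity)]
        congr 1
        rw [H1.ofSchwartz_fn]
        push_cast
        ring

/-! ### The nonlinearity `|u|^{4/d} u` -/

/-- The exponent `4/d`, a natural number for `d ∈ {1, 2}`. -/
def pw (d : ℕ) : ℕ := 4 / d

theorem pw_cast (hd : d = 1 ∨ d = 2) : (4 / (d : ℝ)) = (pw d : ℕ) := by
  rcases hd with rfl | rfl <;> norm_num [pw]

/-- The pointwise nonlinearity. -/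
def nlf (p : ℕ) (z : ℂ) : ℂ := ((‖z‖ ^ p : ℝ) : ℂ) * z

theorem continuous_nlf (p : ℕ) : Continuous (nlf p) := by unfold nlf; fun_prop

theorem norm_nlf (p : ℕ) (z : ℂ) : ‖nlf p z‖ = ‖z‖ ^ (p + 1) := by
  rw [nlf, norm_mul, Complex.norm_real, Real.norm_of_nonneg (by positivity), pow_succ]

theorem aestronglyMeasurable_nlf (p : ℕ) (f : L2 d) :
    AEStronglyMeasurable (fun x => nlf p (f x)) volume :=
  (continuous_nlf p).comp_aestronglyMeasurable (Lp.aestronglyMeasurable f)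

/-- Dimension one uses `H¹ ⊂ L^∞`; dimension two uses the cubic estimate and Fatou's lemma along
Schwartz approximations. One factor is kept in `L²`, so that for differences `v - w` the `L²`
smallness of the regularisation error is not lost. -/
theorem exists_eLpNorm_nlf_le (hd : d = 1 ∨ d = 2) :
    ∃ C : ℝ, 0 ≤ C ∧ ∀ v : H1 d, eLpNorm (fun x => nlf (pw d) (v.fn x)) 2 volume
      ≤ ENNReal.ofReal (C * ‖v‖ ^ pw d * ‖v.fn‖) := by
  rcases hd with hd | hd
  · obtain ⟨C, hC, h⟩ := exists_ae_norm_le_of_dim_one hd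
    refine ⟨C ^ pw d, by positivity, fun v => ?_⟩
    have : eLpNorm (fun x => nlf (pw d) (v.fn x)) 2 volume
        ≤ ENNReal.ofReal (C ^ pw d * ‖v‖ ^ pw d) * eLpNorm v.fn 2 volume := by
      refine eLpNorm_le_mul_eLpNorm_of_ae_le_mul ?_ 2
      filter_upwards [h v] with x hx
      rw [norm_nlf, pow_succ, ← mul_pow]
      gcongr
    rwa [← ENNReal.ofReal_toReal (Lp.eLpNorm_ne_top v.fn), ← Lp.norm_def,
      ← ENNReal.ofReal_mul (by positivity)] at this
  · obtain ⟨C, hC, h⟩ := exists_eLpNorm_cube_schwartz_le hd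
    refine ⟨C, hC, fun v => ?_⟩
    have hp : pw d = 2 := by rw [pw, hd]
    obtain ⟨f, hf⟩ := H1.exists_seq_schwartz v
    have hfn : Tendsto (fun n => (H1.ofSchwartz (f n)).fn) atTop (𝓝 v.fn) :=
      ((H1.fnL d).continuous.tendsto v).comp hf
    obtain ⟨ns, hns, hlim⟩ := (tendstoInMeasure_of_tendsto_Lp hfn).exists_seq_tendsto_ae
    have hb : ∀ n, eLpNorm (fun x => nlf (pw d) ((H1.ofSchwartz (f n)).fn x)) 2 volume
        ≤ ENNReal.ofReal (C * ‖H1.ofSchwartz (f n)‖ ^ 2 * ‖(H1.ofSchwartz (f n)).fn‖) := fun n => by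
      refine le_trans (le_of_eq ?_) (h (f n))
      refine eLpNorm_congr_norm_ae ?_
      filter_upwards [(f n).coeFn_toLp 2] with x hx
      rw [norm_nlf, norm_pow, H1.ofSchwartz_fn, hx, hp]
    refine (Lp.eLpNorm_lim_le_liminf_eLpNorm (p := 2) (f := fun n x => nlf (pw d)
      ((H1.ofSchwartz (f (ns n))).fn x)) (fun n => aestronglyMeasurable_nlf _ _)
      (fun x => nlf (pw d) (v.fn x)) ?_).trans ?_
    · filter_upwards [hlim] with x hx
      exact ((continuous_nlf _).tendsto _).comp hx
    · have hT : Tendsto (fun n => ENNReal.ofReal (C * ‖H1.ofSchwartz (f (ns n))‖ ^ 2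
          * ‖(H1.ofSchwartz (f (ns n))).fn‖)) atTop
          (𝓝 (ENNReal.ofReal (C * ‖v‖ ^ 2 * ‖v.fn‖))) := by
        refine ENNReal.tendsto_ofReal ?_
        exact (((hf.norm.pow 2).const_mul C).mul hfn.norm).comp hns.tendsto_atTop
      rw [hp]
      calc _ ≤ _ := liminf_le_liminf (Eventually.of_forall fun n => by
              have := hb (ns n); rw [hp] at this; exact this)
        _ = _ := hT.liminf_eq

theorem memLp_nlf (hd : d = 1 ∨ d = 2) (v : H1 d) :
    MemLp (fun x => nlf (pw d) (v.fn x)) 2 volume := by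
  obtain ⟨C, _, h⟩ := exists_eLpNorm_nlf_le hd
  exact ⟨aestronglyMeasurable_nlf _ _, (h v).trans_lt ENNReal.ofReal_lt_top⟩

/-- The nonlinearity as an element of `L²` (zero outside of dimensions one and two). -/
def nl (v : H1 d) : L2 d :=
  open Classical in
  if h : MemLp (fun x => nlf (pw d) (v.fn x)) 2 (volume : Measure (Sp d)) then h.toLp else 0

theorem nl_coeFn (hd : d = 1 ∨ d = 2) (v : H1 d) :
    nl v =ᵐ[volume] fun x => nlf (pw d) (v.fn x) := by
  rw [nl, dif_pos (memLp_nlf hd v)]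
  exact (memLp_nlf hd v).coeFn_toLp

theorem exists_norm_nl_le (hd : d = 1 ∨ d = 2) :
    ∃ C : ℝ, 0 ≤ C ∧ ∀ v : H1 d, ‖nl v‖ ≤ C * ‖v‖ ^ pw d * ‖v.fn‖ := by
  obtain ⟨C, hC, h⟩ := exists_eLpNorm_nlf_le hd
  refine ⟨C, hC, fun v => ?_⟩
  rw [Lp.norm_def, eLpNorm_congr_ae (nl_coeFn hd v)]
  exact ENNReal.toReal_le_of_le_ofReal (by positivity) (h v)

/-- The bound involves `b` and `a - b` but not `a`, because in applications only `b`, a value of the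
regularised function, is bounded pointwise. -/
theorem norm_nlf_sub_le (p : ℕ) (a b : ℂ) :
    ‖nlf p a - nlf p b‖ ≤ (p + 1) * 2 ^ p * (‖b‖ ^ p + ‖a - b‖ ^ p) * ‖a - b‖ := by
  set m := ‖b‖ + ‖a - b‖
  have hm : 0 ≤ m := by positivity
  have ha : ‖a‖ ≤ m := by
    calc ‖a‖ = ‖b + (a - b)‖ := by ring_nf
      _ ≤ _ := norm_add_le _ _
  have hb : ‖b‖ ≤ m := le_add_of_nonneg_right (norm_nonneg _)
  have hpow : |‖a‖ ^ p - ‖b‖ ^ p| * ‖b‖ ≤ p * m ^ p * ‖a - b‖ := by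
    rcases Nat.eq_zero_or_pos p with rfl | hp
    · simp
    · have h1 : |‖a‖ ^ p - ‖b‖ ^ p| ≤ |‖a‖ - ‖b‖| * p * max |‖a‖| |‖b‖| ^ (p - 1) :=
        abs_pow_sub_pow_le _ _ _
      have h2 : max |‖a‖| |‖b‖| ≤ m := by simp [ha, hb]
      have h3 : |‖a‖ - ‖b‖| ≤ ‖a - b‖ := abs_norm_sub_norm_le _ _
      calc _ ≤ (‖a - b‖ * p * m ^ (p - 1)) * m := by
            refine mul_le_mul (h1.trans ?_) hb (norm_nonneg _) (by positivity)
            gcongr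
        _ = p * (m ^ (p - 1) * m) * ‖a - b‖ := by ring
        _ = _ := by rw [← pow_succ, Nat.sub_add_cancel hp]
  have h1 : nlf p a - nlf p b
      = ((‖a‖ ^ p : ℝ) : ℂ) * (a - b) + ((‖a‖ ^ p - ‖b‖ ^ p : ℝ) : ℂ) * b := by
    unfold nlf; push_cast; ring
  have h2 : ‖nlf p a - nlf p b‖ ≤ (p + 1) * m ^ p * ‖a - b‖ := by
    rw [h1]
    refine (norm_add_le _ _).trans ?_
    rw [norm_mul, norm_mul, Complex.norm_real, Complex.norm_real,
      Real.norm_of_nonneg (by positivity), Real.norm_eq_abs]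
    have : ‖a‖ ^ p * ‖a - b‖ ≤ m ^ p * ‖a - b‖ := by gcongr
    linarith
  have h3 : m ^ p ≤ 2 ^ p * (‖b‖ ^ p + ‖a - b‖ ^ p) := by
    have := add_pow_le (norm_nonneg b) (norm_nonneg (a - b)) p
    refine this.trans ?_
    gcongr
    · norm_num
    · omega
  calc _ ≤ (p + 1) * m ^ p * ‖a - b‖ := h2
    _ ≤ (p + 1) * (2 ^ p * (‖b‖ ^ p + ‖a - b‖ ^ p)) * ‖a - b‖ := by gcongr
    _ = _ := by ring

/-- `‖N(v) - N(w)‖ ≤ C (B^p + ‖v - w‖^p) ‖v - w‖_{L²}` if `|w| ≤ B`. -/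
theorem exists_norm_nl_sub_le_of_bounded (hd : d = 1 ∨ d = 2) :
    ∃ C : ℝ, 0 ≤ C ∧ ∀ (v w : H1 d) (B : ℝ), (∀ᵐ x, ‖w.fn x‖ ≤ B) →
      ‖nl v - nl w‖ ≤ C * (B ^ pw d + ‖v - w‖ ^ pw d) * ‖v.fn - w.fn‖ := by
  obtain ⟨C, hC, h⟩ := exists_norm_nl_le hd
  set p := pw d
  refine ⟨(p + 1) * 2 ^ p * (1 + C), by positivity, fun v w B hB => ?_⟩
  have hB0 : 0 ≤ B := by
    obtain ⟨x, hx⟩ := hB.exists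
    exact (norm_nonneg _).trans hx
  -- The term `|v - w|^{p+1}` of the pointwise estimate is the modulus of the nonlinearity at `v -
  -- w`; it is thus controlled by the bound for `nl` and needs no pointwise bound on `v`.
  have hle : ‖nl v - nl w‖ ≤ ‖(((p + 1) * 2 ^ p * B ^ p : ℝ) : ℂ) • (v.fn - w.fn)‖
      + ‖(((p + 1) * 2 ^ p : ℝ) : ℂ) • nl (v - w)‖ := by
    have : ‖nl v - nl w‖ ≤ ‖(((p + 1) * 2 ^ p * B ^ p : ℝ) : ℂ) • (v.fn - w.fn)‖
      + ‖(((p + 1) * 2 ^ p : ℝ) : ℂ) • nl (v - w)‖ := by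
      set F : L2 d := (((p + 1) * 2 ^ p * B ^ p : ℝ) : ℂ) • (v.fn - w.fn)
      set G : L2 d := (((p + 1) * 2 ^ p : ℝ) : ℂ) • nl (v - w)
      have hF := Lp.norm_def F
      have hG := Lp.norm_def G
      rw [← ENNReal.ofReal_le_ofReal_iff (by positivity), ENNReal.ofReal_add (norm_nonneg _)
        (norm_nonneg _), hF, hG, Lp.norm_def, ENNReal.ofReal_toReal (Lp.eLpNorm_ne_top _),
        ENNReal.ofReal_toReal (Lp.eLpNorm_ne_top _), ENNReal.ofReal_toReal (Lp.eLpNorm_ne_top _)]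
      rw [← eLpNorm_norm F, ← eLpNorm_norm G]
      refine le_trans (eLpNorm_mono_ae (g := (fun x => ‖F x‖) + fun x => ‖G x‖) ?_)
        (eLpNorm_add_le (Lp.aestronglyMeasurable F).norm (Lp.aestronglyMeasurable G).norm
          one_le_two)
      have hfs : (v - w).fn =ᵐ[volume] fun x => v.fn x - w.fn x := by
        rw [H1.fn_sub]; exact Lp.coeFn_sub _ _
      filter_upwards [hB, nl_coeFn hd v, nl_coeFn hd w, nl_coeFn hd (v - w), hfs,
        Lp.coeFn_sub (nl v) (nl w), Lp.coeFn_smul (((p + 1) * 2 ^ p * B ^ p : ℝ) : ℂ)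
        (v.fn - w.fn), Lp.coeFn_smul (((p + 1) * 2 ^ p : ℝ) : ℂ) (nl (v - w)),
        Lp.coeFn_sub v.fn w.fn] with x h1 h2 h3 h4 h5 h6 h7 h8 h9
      rw [h6, Pi.sub_apply, h2, h3, Pi.add_apply, Real.norm_of_nonneg (by positivity), h7, h8,
        Pi.smul_apply, Pi.smul_apply, h4, h5, norm_smul, norm_smul, norm_nlf, h9, Pi.sub_apply,
        Complex.norm_real, Complex.norm_real, Real.norm_of_nonneg (by positivity),
        Real.norm_of_nonneg (by positivity)]
      refine (norm_nlf_sub_le _ _ _).trans ?_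
      have e : ((p : ℝ) + 1) * 2 ^ p * (‖w.fn x‖ ^ p + ‖v.fn x - w.fn x‖ ^ p)
          * ‖v.fn x - w.fn x‖ = (p + 1) * 2 ^ p * ‖w.fn x‖ ^ p * ‖v.fn x - w.fn x‖
          + (p + 1) * 2 ^ p * ‖v.fn x - w.fn x‖ ^ (p + 1) := by ring
      rw [e]
      gcongr
    exact this
  refine hle.trans ?_
  rw [norm_smul, norm_smul, Complex.norm_real, Complex.norm_real,
    Real.norm_of_nonneg (by positivity), Real.norm_of_nonneg (by positivity)]
  have h1 := h (v - w)
  rw [H1.fn_sub] at h1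
  calc _ ≤ ((p : ℝ) + 1) * 2 ^ p * B ^ p * ‖v.fn - w.fn‖
        + (p + 1) * 2 ^ p * (C * ‖v - w‖ ^ p * ‖v.fn - w.fn‖) := by gcongr
    _ = ((p : ℝ) + 1) * 2 ^ p * (B ^ p + C * ‖v - w‖ ^ p) * ‖v.fn - w.fn‖ := by ring
    _ ≤ ((p : ℝ) + 1) * 2 ^ p * ((1 + C) * (B ^ p + ‖v - w‖ ^ p)) * ‖v.fn - w.fn‖ := by
        gcongr
        have : 0 ≤ C * B ^ p := by positivity
        have : 0 ≤ ‖v - w‖ ^ p := by positivity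
        nlinarith
    _ = _ := by ring

/-! ### Continuity of the nonlinearity and cancellations -/

/-- Elementary form of Young's inequality for the products in `norm_nlf_sub_le`. -/
theorem pow_mul_le_add {x y r : ℝ} (hx : 0 ≤ x) (hy : 0 ≤ y) (hr : 0 < r) (p : ℕ) :
    x ^ p * y ≤ r * x ^ (p + 1) + r⁻¹ ^ p * y ^ (p + 1) := by
  rcases le_total y (r * x) with h | h
  · have h1 : x ^ p * y ≤ x ^ p * (r * x) := by gcongr
    have h2 : 0 ≤ r⁻¹ ^ p * y ^ (p + 1) := by positivity
    calc _ ≤ _ := h1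
      _ = r * x ^ (p + 1) := by ring
      _ ≤ _ := by linarith
  · have h1 : x ≤ r⁻¹ * y := by
      rw [← div_eq_inv_mul, le_div_iff₀ hr]; linarith
    have h2 : x ^ p * y ≤ (r⁻¹ * y) ^ p * y := by gcongr
    have h3 : 0 ≤ r * x ^ (p + 1) := by positivity
    calc _ ≤ _ := h2
      _ = r⁻¹ ^ p * y ^ (p + 1) := by ring
      _ ≤ _ := by linarith

/-- Comparison of `L²` norms from a pointwise bound by a sum of two terms. -/
theorem norm_le_add_of_ae {f g h : L2 d} {a b : ℝ} (ha : 0 ≤ a) (hb : 0 ≤ b)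
    (H : ∀ᵐ x, ‖f x‖ ≤ a * ‖g x‖ + b * ‖h x‖) : ‖f‖ ≤ a * ‖g‖ + b * ‖h‖ := by
  have h0 : ‖f‖ ≤ ‖(a : ℂ) • g‖ + ‖(b : ℂ) • h‖ := by
    rw [← ENNReal.ofReal_le_ofReal_iff (by positivity), ENNReal.ofReal_add (norm_nonneg _)
      (norm_nonneg _), Lp.norm_def, Lp.norm_def, Lp.norm_def,
      ENNReal.ofReal_toReal (Lp.eLpNorm_ne_top _), ENNReal.ofReal_toReal (Lp.eLpNorm_ne_top _),
      ENNReal.ofReal_toReal (Lp.eLpNorm_ne_top _)]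
    set F : L2 d := (a : ℂ) • g
    set G : L2 d := (b : ℂ) • h
    rw [← eLpNorm_norm F, ← eLpNorm_norm G]
    refine le_trans (eLpNorm_mono_ae (g := (fun x => ‖F x‖) + fun x => ‖G x‖) ?_)
      (eLpNorm_add_le (Lp.aestronglyMeasurable F).norm (Lp.aestronglyMeasurable G).norm
        one_le_two)
    filter_upwards [H, Lp.coeFn_smul (a : ℂ) g, Lp.coeFn_smul (b : ℂ) h] with x h1 h2 h3
    rw [Pi.add_apply, Real.norm_of_nonneg (by positivity), h2, h3, Pi.smul_apply, Pi.smul_apply,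
      norm_smul, norm_smul, Complex.norm_real, Complex.norm_real, Real.norm_of_nonneg ha,
      Real.norm_of_nonneg hb]
    exact h1
  rwa [norm_smul, norm_smul, Complex.norm_real, Complex.norm_real, Real.norm_of_nonneg ha,
      Real.norm_of_nonneg hb] at h0

/-- Young's inequality with a free parameter replaces the pointwise bound on `w`. For continuity at
`w`, the parameter `r` first makes the `nl w` term small, and then `v → w` makes the other one
small. -/
theorem norm_nl_sub_le (hd : d = 1 ∨ d = 2) (v w : H1 d) {r : ℝ} (hr : 0 < r) :
    ‖nl v - nl w‖ ≤ ((pw d + 1) * 2 ^ pw d * r) * ‖nl w‖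
      + ((pw d + 1) * 2 ^ pw d * (r⁻¹ ^ pw d + 1)) * ‖nl (v - w)‖ := by
  refine norm_le_add_of_ae (by positivity) (by positivity) ?_
  have hfs : (v - w).fn =ᵐ[volume] fun x => v.fn x - w.fn x := by
    rw [H1.fn_sub]; exact Lp.coeFn_sub _ _
  filter_upwards [nl_coeFn hd v, nl_coeFn hd w, nl_coeFn hd (v - w), hfs,
    Lp.coeFn_sub (nl v) (nl w)] with x h2 h3 h4 h5 h6
  rw [h6, Pi.sub_apply, h2, h3, h4, h5, norm_nlf, norm_nlf]
  refine (norm_nlf_sub_le _ _ _).trans ?_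
  have := pow_mul_le_add (norm_nonneg (w.fn x)) (norm_nonneg (v.fn x - w.fn x)) hr (pw d)
  calc _ = ((pw d : ℝ) + 1) * 2 ^ pw d * (‖w.fn x‖ ^ pw d * ‖v.fn x - w.fn x‖
        + ‖v.fn x - w.fn x‖ ^ (pw d + 1)) := by ring
    _ ≤ ((pw d : ℝ) + 1) * 2 ^ pw d * ((r * ‖w.fn x‖ ^ (pw d + 1)
        + r⁻¹ ^ pw d * ‖v.fn x - w.fn x‖ ^ (pw d + 1)) + ‖v.fn x - w.fn x‖ ^ (pw d + 1)) := by
        gcongr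
    _ = _ := by ring

theorem continuous_nl (hd : d = 1 ∨ d = 2) : Continuous (nl : H1 d → L2 d) := by
  rw [continuous_iff_continuousAt]
  intro w
  rw [ContinuousAt, tendsto_iff_norm_sub_tendsto_zero]
  obtain ⟨C, hC, h⟩ := exists_norm_nl_le hd
  have h1 : Tendsto (fun v : H1 d => ‖nl (v - w)‖) (𝓝 w) (𝓝 0) := by
    refine squeeze_zero (fun _ => norm_nonneg _) (fun v => h (v - w)) ?_
    have : Continuous fun v : H1 d => C * ‖v - w‖ ^ pw d * ‖(v - w).fn‖ := by
      have : Continuous fun v : H1 d => (v - w).fn :=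
        (H1.fnL d).continuous.comp (continuous_id.sub continuous_const)
      fun_prop
    have h2 := this.tendsto w
    have h3 : ‖(w - w).fn‖ = 0 := by rw [H1.fn_sub, sub_self, norm_zero]
    rwa [h3, mul_zero] at h2
  refine Metric.tendsto_nhds.2 fun e he => ?_
  set c : ℝ := (pw d + 1) * 2 ^ pw d
  have hc : 0 < c := by positivity
  obtain ⟨r, hr, hre⟩ : ∃ r > 0, c * r * ‖nl w‖ < e / 2 := by
    refine ⟨e / (2 * c * (‖nl w‖ + 1)), by positivity, ?_⟩
    have : c * (e / (2 * c * (‖nl w‖ + 1))) * ‖nl w‖ = e / 2 * (‖nl w‖ / (‖nl w‖ + 1)) := by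
      field_simp
    rw [this]
    have : ‖nl w‖ / (‖nl w‖ + 1) < 1 := by rw [div_lt_one (by positivity)]; linarith
    nlinarith
  have h2 := h1.const_mul (c * (r⁻¹ ^ pw d + 1))
  rw [mul_zero] at h2
  filter_upwards [h2.eventually (gt_mem_nhds (show (0 : ℝ) < e / 2 by positivity))] with v hv
  rw [dist_zero_right, norm_norm]
  have := norm_nl_sub_le hd v w hr
  linarith

namespace H1

theorem continuous_fn : Continuous (fn : H1 d → L2 d) := (fnL d).continuous
theorem continuous_pd (j : Fin d) : Continuous (fun v : H1 d => v.pd j) := (pdL j).continuous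

/-- Integration by parts. -/
theorem inner_pd_left (v w : H1 d) (j : Fin d) :
    inner ℂ (v.pd j) w.fn = - inner ℂ v.fn (w.pd j) := by
  rw [inner_eq_integral_fourier, inner_eq_integral_fourier, ← integral_neg]
  refine integral_congr_ae ?_
  filter_upwards [fourier_pd v j, fourier_pd w j] with ξ h1 h2
  rw [h1, h2, map_mul]
  have : (starRingEnd ℂ) (dsym j ξ) = - dsym j ξ := by
    simp [dsym, Complex.conj_ofNat]
  rw [this]; ring

end H1

theorem hasLineDerivAt_normSq (f : 𝓢(Sp d, ℂ)) (j : Fin d) (x : Sp d) :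
    HasLineDerivAt ℝ (fun x => Complex.normSq (f x))
      (2 * ((starRingEnd ℂ) ((∂_{stdVec j} f : 𝓢(Sp d, ℂ)) x) * f x).re) x (stdVec j) := by
  have h := (f.differentiable x).hasFDerivAt.hasLineDerivAt (stdVec j)
  rw [← SchwartzMap.lineDerivOp_apply_eq_fderiv] at h
  set a := (∂_{stdVec j} f : 𝓢(Sp d, ℂ)) x
  unfold HasLineDerivAt at h ⊢
  have hre : HasDerivAt (fun t : ℝ => (f (x + t • stdVec j)).re) a.re 0 :=
    Complex.reCLM.hasFDerivAt.comp_hasDerivAt (0 : ℝ) h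
  have him : HasDerivAt (fun t : ℝ => (f (x + t • stdVec j)).im) a.im 0 :=
    Complex.imCLM.hasFDerivAt.comp_hasDerivAt (0 : ℝ) h
  have := (hre.fun_mul hre).fun_add (him.fun_mul him)
  simp only [Complex.normSq_apply]
  convert this using 1
  simp only [zero_smul, add_zero, Complex.mul_re, Complex.conj_re, Complex.conj_im]
  ring

/-- The exponent `4/d = 2m` is even, so `|f|^{4/d} = hᵐ` with `h = |f|²` smooth, and the integrand
is half of `hᵐ ∂ⱼh`, a multiple of `∂ⱼ(h^{m+1})`. -/
theorem inner_pd_nl_schwartz (hd : d = 1 ∨ d = 2) (f : 𝓢(Sp d, ℂ)) (j : Fin d) :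
    (inner ℂ ((H1.ofSchwartz f).pd j) (nl (H1.ofSchwartz f))).re = 0 := by
  obtain ⟨m, hm⟩ : ∃ m, pw d = 2 * m := by
    rcases hd with rfl | rfl
    exacts [⟨2, rfl⟩, ⟨1, rfl⟩]
  set h : Sp d → ℝ := fun x => Complex.normSq (f x)
  set g : Sp d → ℝ := fun x => 2 * ((starRingEnd ℂ) ((∂_{stdVec j} f : 𝓢(Sp d, ℂ)) x) * f x).re
  have hc : Continuous h := Complex.continuous_normSq.comp f.continuous
  have hg : Continuous g := by
    have := (∂_{stdVec j} f : 𝓢(Sp d, ℂ)).continuous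
    have := f.continuous
    fun_prop
  obtain ⟨M, hM⟩ : ∃ M, ∀ x, ‖f x‖ ≤ M := ⟨_, SchwartzMap.norm_le_seminorm ℝ f⟩
  have hb : ∀ x, ‖h x‖ ≤ M ^ 2 := fun x => by
    rw [Real.norm_of_nonneg (Complex.normSq_nonneg _), Complex.normSq_eq_norm_sq]
    have := hM x
    gcongr
  have hgi : Integrable g volume := by
    have h1 : Integrable (fun x => (starRingEnd ℂ) ((∂_{stdVec j} f : 𝓢(Sp d, ℂ)) x) * f x)
        volume := by
      refine (integrable_conj_mul ((∂_{stdVec j} f : 𝓢(Sp d, ℂ)).toLp 2 volume)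
        (f.toLp 2 volume)).congr ?_
      filter_upwards [(∂_{stdVec j} f : 𝓢(Sp d, ℂ)).coeFn_toLp 2 volume,
        f.coeFn_toLp 2 volume] with x h1 h2
      rw [h1, h2]
    exact (h1.re).const_mul 2
  have hhi : Integrable h volume := by
    refine (integrable_norm_sq (f.toLp 2 volume)).congr ?_
    filter_upwards [f.coeFn_toLp 2 volume] with x h1
    rw [h1, ← Complex.normSq_eq_norm_sq]
  have hpow : ∀ k, ∀ x, ‖h x ^ k‖ ≤ (M ^ 2) ^ k := fun k x => by
    rw [norm_pow]; exact pow_le_pow_left₀ (norm_nonneg _) (hb x) k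
  have hi1 : Integrable (fun x => h x ^ m * g x) volume :=
    hgi.bdd_mul (hc.pow m).aestronglyMeasurable (Eventually.of_forall (hpow m))
  have hder : ∀ x, HasLineDerivAt ℝ h (g x) x (stdVec j) := hasLineDerivAt_normSq f j
  have hder' : ∀ x, HasLineDerivAt ℝ (fun x => h x ^ m) (m * h x ^ (m - 1) * g x) x (stdVec j) :=
    fun x => by
      have := hder x
      unfold HasLineDerivAt at this ⊢
      simpa using this.fun_pow m
  have hm1 : m ≠ 0 := by
    rintro rfl
    rcases hd with rfl | rfl <;> simp [pw] at hm
  have e0 : ∀ x, m * h x ^ (m - 1) * g x * h x = m * (h x ^ m * g x) := fun x => by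
    have : h x ^ m = h x ^ (m - 1) * h x := by rw [← pow_succ, Nat.sub_add_cancel (by omega)]
    rw [this]; ring
  have key := integral_bilinear_hasLineDerivAt_right_eq_neg_left_of_integrable
    (μ := (volume : Measure (Sp d)))
    (f := fun x => h x ^ m) (f' := fun x => m * h x ^ (m - 1) * g x) (g := h) (g' := g)
    (v := stdVec j) (B := ContinuousLinearMap.mul ℝ ℝ)
    (by simp only [ContinuousLinearMap.mul_apply', e0]; exact hi1.const_mul _) hi1
    (by simp only [ContinuousLinearMap.mul_apply']
        exact hhi.bdd_mul (hc.pow m).aestronglyMeasurable (Eventually.of_forall (hpow m)))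
    (fun x _ => hder' x) (fun x _ => hder x)
  simp only [ContinuousLinearMap.mul_apply', e0, integral_const_mul] at key
  -- Integrating by parts between `hᵐ` and `h` shows that the integral `I` satisfies `I = -m I`.
  have hz : ∫ x, h x ^ m * g x = 0 := by
    have : (0 : ℝ) ≤ m := Nat.cast_nonneg m
    have h3 : (1 + (m : ℝ)) * ∫ x, h x ^ m * g x = 0 := by linarith
    rcases mul_eq_zero.1 h3 with h4 | h4
    · linarith
    · exact h4
  have e1 : (inner ℂ ((H1.ofSchwartz f).pd j) (nl (H1.ofSchwartz f))).re
      = ∫ x, (1 / 2 : ℝ) * (h x ^ m * g x) := by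
    have hre : ∀ F : Sp d → ℂ, Integrable F volume → (∫ x, F x).re = ∫ x, (F x).re :=
      fun F hF => (integral_re hF).symm
    rw [inner_eq_integral, hre _ (integrable_conj_mul _ _)]
    refine integral_congr_ae ?_
    filter_upwards [nl_coeFn hd (H1.ofSchwartz f), f.coeFn_toLp 2 volume,
      (∂_{stdVec j} f : 𝓢(Sp d, ℂ)).coeFn_toLp 2 volume] with x h1 h2 h3
    rw [h1, H1.ofSchwartz_fn, H1.ofSchwartz_pd, h2, h3, nlf, hm, pow_mul,
      ← Complex.normSq_eq_norm_sq, mul_left_comm, Complex.re_ofReal_mul]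
    simp only [h, g]
    ring
  rw [e1, integral_const_mul, hz, mul_zero]

/-- The cancellation `Re (∂ⱼ v, |v|^p v) = 0`. -/
theorem inner_pd_nl (hd : d = 1 ∨ d = 2) (v : H1 d) (j : Fin d) :
    (inner ℂ (v.pd j) (nl v)).re = 0 := by
  refine H1.induction_schwartz (P := fun v : H1 d => (inner ℂ (v.pd j) (nl v)).re = 0) ?_
    (fun f => inner_pd_nl_schwartz hd f j) v
  exact isClosed_eq (Complex.continuous_re.comp
    ((H1.continuous_pd j).inner (continuous_nl hd))) continuous_const

/-! ### Energy and momentum as inner products -/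

/-- The potential part of the energy. -/
def potential (v : H1 d) : ℝ := (1 / (pw d + 2 : ℝ)) * (inner ℂ v.fn (nl v)).re

theorem continuous_potential (hd : d = 1 ∨ d = 2) : Continuous (potential : H1 d → ℝ) :=
  (Complex.continuous_re.comp (H1.continuous_fn.inner (continuous_nl hd))).const_mul _

theorem inner_nl_eq_integral (hd : d = 1 ∨ d = 2) (v : H1 d) :
    (inner ℂ v.fn (nl v)).re = ∫ x, ‖v.fn x‖ ^ (pw d + 2) := by
  have h : ∫ x, (starRingEnd ℂ) (v.fn x) * nl v x
      = ∫ x, ((‖v.fn x‖ ^ (pw d + 2) : ℝ) : ℂ) := by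
    refine integral_congr_ae ?_
    filter_upwards [nl_coeFn hd v] with x hx
    rw [hx, nlf, mul_left_comm, mul_comm ((starRingEnd ℂ) (v.fn x)), Complex.mul_conj,
      Complex.normSq_eq_norm_sq, ← Complex.ofReal_mul, ← pow_add]
  rw [inner_eq_integral, h, integral_complex_ofReal, Complex.ofReal_re]

theorem energy_eq (hd : d = 1 ∨ d = 2) (v : H1 d) :
    energy v = 1 / 2 * ∑ j, ‖v.pd j‖ ^ 2 - potential v := by
  have h1 : (2 + 4 / (d : ℝ)) = ((pw d + 2 : ℕ) : ℝ) := by rw [pw_cast hd]; push_cast; ring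
  rw [energy, potential, inner_nl_eq_integral hd, integral_finsetSum _ fun j _ =>
    integrable_norm_sq _, h1]
  simp_rw [norm_sq_eq_integral, Real.rpow_natCast]
  push_cast
  rfl

theorem momentum_apply (v : H1 d) (j : Fin d) : momentum v j = (inner ℂ v.fn (v.pd j)).im := by
  rw [inner_eq_integral]; rfl

/-! ### Multiplication by bounded smooth functions -/

/-- `m` is smooth of temperate growth and `|m|`, `|∂ⱼ m|` are bounded by `K`. -/
structure IsCoeff (K : ℝ) (m : Sp d → ℂ) : Prop where
  growth : m.HasTemperateGrowth
  bound : ∀ x, ‖m x‖ ≤ K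
  bound_deriv : ∀ j x, ‖fderiv ℝ m x (stdVec j)‖ ≤ K

namespace IsCoeff

variable {K : ℝ} {m : Sp d → ℂ}

theorem nonneg (hm : IsCoeff K m) : 0 ≤ K := (norm_nonneg _).trans (hm.bound 0)

theorem memLp (hm : IsCoeff K m) : MemLp m ∞ (volume : Measure (Sp d)) :=
  memLp_top_of_continuous hm.growth.1.continuous hm.bound

theorem memLp_deriv (hm : IsCoeff K m) (j : Fin d) :
    MemLp (fun x => fderiv ℝ m x (stdVec j)) ∞ (volume : Measure (Sp d)) :=
  memLp_top_of_continuous ((hm.growth.1.continuous_fderiv (by simp)).clm_apply continuous_const)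
    (hm.bound_deriv j)

theorem I_mul (hm : IsCoeff K m) : IsCoeff K (fun x => Complex.I * m x) where
  growth := (Function.HasTemperateGrowth.const Complex.I).mul hm.growth
  bound x := by simpa using hm.bound x
  bound_deriv j x := by
    have : HasFDerivAt (fun x => Complex.I * m x) (Complex.I • fderiv ℝ m x) x :=
      ((hm.growth.1.differentiable (by simp)) x).hasFDerivAt.const_mul Complex.I
    rw [this.fderiv]
    simpa using hm.bound_deriv j x

end IsCoeff

theorem abs_re_inner_mulOp_le {K : ℝ} {m : Sp d → ℂ} (hK : 0 ≤ K) (hm : ∀ x, ‖m x‖ ≤ K)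
    (f g : L2 d) : |(inner ℂ f (mulOp m g)).re| ≤ K * ‖f‖ * ‖g‖ := by
  calc _ ≤ ‖inner ℂ f (mulOp m g)‖ := Complex.abs_re_le_norm _
    _ ≤ ‖f‖ * ‖mulOp m g‖ := norm_inner_le_norm _ _
    _ ≤ ‖f‖ * (K * ‖g‖) := by gcongr; exact norm_mulOp_le hK hm g
    _ = _ := by ring

namespace H1

theorem exists_mul_schwartz {K : ℝ} {m : Sp d → ℂ} (hm : IsCoeff K m) (f : 𝓢(Sp d, ℂ)) :
    ∃ w : H1 d, w.fn = mulOp m (ofSchwartz f).fn ∧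
      ∀ j, w.pd j = mulOp m ((ofSchwartz f).pd j)
        + mulOp (fun x => fderiv ℝ m x (stdVec j)) (ofSchwartz f).fn := by
  refine ⟨ofSchwartz (SchwartzMap.smulLeftCLM ℂ m f), ?_, fun j => ?_⟩
  · refine Lp.ext ?_
    rw [ofSchwartz_fn, ofSchwartz_fn]
    filter_upwards [(SchwartzMap.smulLeftCLM ℂ m f).coeFn_toLp 2 volume,
      mulOp_coeFn hm.memLp (f.toLp 2 volume), f.coeFn_toLp 2 volume] with x h1 h2 h3
    rw [h1, h2, h3, SchwartzMap.smulLeftCLM_apply_apply hm.growth, smul_eq_mul]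
  · refine Lp.ext ?_
    rw [ofSchwartz_fn, ofSchwartz_pd, ofSchwartz_pd]
    filter_upwards [(∂_{stdVec j} (SchwartzMap.smulLeftCLM ℂ m f) : 𝓢(Sp d, ℂ)).coeFn_toLp 2 volume,
      mulOp_coeFn hm.memLp ((∂_{stdVec j} f : 𝓢(Sp d, ℂ)).toLp 2 volume),
      mulOp_coeFn (hm.memLp_deriv j) (f.toLp 2 volume), f.coeFn_toLp 2 volume,
      (∂_{stdVec j} f : 𝓢(Sp d, ℂ)).coeFn_toLp 2 volume, Lp.coeFn_add
        (mulOp m ((∂_{stdVec j} f : 𝓢(Sp d, ℂ)).toLp 2 volume))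
        (mulOp (fun x => fderiv ℝ m x (stdVec j)) (f.toLp 2 volume))]
      with x h1 h2 h3 h4 h5 h6
    rw [h6, Pi.add_apply, h1, h2, h3, h4, h5, SchwartzMap.lineDerivOp_apply_eq_fderiv,
      SchwartzMap.lineDerivOp_apply_eq_fderiv]
    have e : ⇑(SchwartzMap.smulLeftCLM ℂ m f) = fun x => m x * f x := by
      ext x; rw [SchwartzMap.smulLeftCLM_apply_apply hm.growth, smul_eq_mul]
    rw [e]
    have := ((hm.growth.1.differentiable (by simp)) x).hasFDerivAt.fun_mul
      (f.differentiable x).hasFDerivAt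
    rw [this.fderiv]
    simp
    ring

/-- The product rule in `H¹`. -/
theorem exists_mul {K : ℝ} {m : Sp d → ℂ} (hm : IsCoeff K m) (v : H1 d) :
    ∃ w : H1 d, w.fn = mulOp m v.fn ∧
      ∀ j, w.pd j = mulOp m (v.pd j) + mulOp (fun x => fderiv ℝ m x (stdVec j)) v.fn := by
  -- The candidate pair depends continuously on `v`, and `H¹` is a closed subspace of pairs, so
  -- membership only has to be checked on Schwartz functions.
  suffices h : (WithLp.toLp 2 (mulOp m v.fn, WithLp.toLp 2 fun j =>
      mulOp m (v.pd j) + mulOp (fun x => fderiv ℝ m x (stdVec j)) v.fn) :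
      WithLp 2 (L2 d × PiLp 2 (fun _ : Fin d => L2 d))) ∈ h1Submodule d from
    ⟨⟨_, h⟩, rfl, fun j => rfl⟩
  refine induction_schwartz (P := fun v : H1 d => (WithLp.toLp 2 (mulOp m v.fn, WithLp.toLp 2
      fun j => mulOp m (v.pd j) + mulOp (fun x => fderiv ℝ m x (stdVec j)) v.fn) :
      WithLp 2 (L2 d × PiLp 2 (fun _ : Fin d => L2 d))) ∈ h1Submodule d) ?_ (fun f => ?_) v
  · refine isClosed_h1Submodule.preimage ?_
    refine (WithLp.prod_continuous_toLp 2 _ _).comp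
      (((mulOp m).continuous.comp continuous_fn).prodMk
      ((PiLp.continuous_toLp 2 _).comp (continuous_pi fun j => ?_)))
    exact ((mulOp m).continuous.comp (continuous_pd j)).add ((mulOp _).continuous.comp continuous_fn)
  · obtain ⟨w, h1, h2⟩ := exists_mul_schwartz hm f
    have h3 := w.2
    have : w.1 = WithLp.toLp 2 (mulOp m (ofSchwartz f).fn, WithLp.toLp 2 fun j =>
        mulOp m ((ofSchwartz f).pd j)
          + mulOp (fun x => fderiv ℝ m x (stdVec j)) (ofSchwartz f).fn) := by
      rw [← h1]; simp_rw [← h2]; rfl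
    rwa [this] at h3

theorem norm_dsym_mul_dsym_mul_rsym_le {s : ℝ} (hs : 0 < s) (j k : Fin d) (ξ : Sp d) :
    ‖dsym j ξ * (dsym k ξ * (rsym s ξ : ℂ))‖ ≤ s⁻¹ := by
  have h1 := norm_dsym_sq_le j ξ
  have h2 := norm_dsym_sq_le k ξ
  have h3 := rsym_pos hs.le ξ
  have ha := asym_nonneg ξ
  rw [norm_mul, norm_mul, Complex.norm_real, Real.norm_of_nonneg h3.le]
  have h4 : ‖dsym j ξ‖ * ‖dsym k ξ‖ ≤ asym ξ := by
    nlinarith [sq_nonneg (‖dsym j ξ‖ - ‖dsym k ξ‖)]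
  have h5 := one_sub_rsym hs.le ξ
  calc _ = (‖dsym j ξ‖ * ‖dsym k ξ‖) * rsym s ξ := by ring
    _ ≤ asym ξ * rsym s ξ := by gcongr
    _ = s⁻¹ * (s * asym ξ * rsym s ξ) := by field_simp
    _ ≤ s⁻¹ * 1 := by gcongr; linarith
    _ = _ := mul_one _

theorem continuous_dsym_mul_dsym_mul_rsym {s : ℝ} (hs : 0 ≤ s) (j k : Fin d) :
    Continuous fun ξ : Sp d => dsym j ξ * (dsym k ξ * (rsym s ξ : ℂ)) :=
  (continuous_dsym j).mul ((continuous_dsym k).mul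
    (Complex.continuous_ofReal.comp (continuous_rsym hs)))

theorem memLp_dsym_mul_dsym_mul_rsym {s : ℝ} (hs : 0 < s) (j k : Fin d) :
    MemLp (fun ξ : Sp d => dsym j ξ * (dsym k ξ * (rsym s ξ : ℂ))) ∞ volume :=
  memLp_top_of_continuous (continuous_dsym_mul_dsym_mul_rsym hs.le j k)
    (norm_dsym_mul_dsym_mul_rsym_le hs j k)

/-- The partial derivative of the resolvent of an `H¹` function, in `H¹`. -/
def resPd {s : ℝ} (hs : 0 < s) (k : Fin d) (v : H1 d) : H1 d :=
  mk' (LogLogNLS.res s (v.pd k))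
    (fun j => fmul (fun ξ => dsym j ξ * (dsym k ξ * (rsym s ξ : ℂ))) v.fn) fun j => by
    rw [fourier_fmul]
    filter_upwards [mulOp_coeFn (memLp_dsym_mul_dsym_mul_rsym hs j k) (𝓕 v.fn),
      fourier_res hs.le (v.pd k), fourier_pd v k] with ξ h1 h2 h3
    rw [h1, h2, h3]; ring

@[simp] theorem resPd_fn {s : ℝ} (hs : 0 < s) (k : Fin d) (v : H1 d) :
    (resPd hs k v).fn = LogLogNLS.res s (v.pd k) := rfl

theorem resPd_pd_comm {s : ℝ} (hs : 0 < s) (j k : Fin d) (v : H1 d) :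
    (resPd hs k v).pd j = (resPd hs j v).pd k := by
  simp only [resPd, mk'_pd]
  simp_rw [mul_left_comm]

/-- `Re (v, β ∂ⱼ v) = - ½ (v, ∂ⱼβ v)` for real `β`. -/
theorem re_inner_mul_pd {K : ℝ} {β : Sp d → ℝ} (hβ : IsCoeff K (fun x => (β x : ℂ))) (v : H1 d)
    (j : Fin d) :
    (inner ℂ v.fn (mulOp (fun x => (β x : ℂ)) (v.pd j))).re
      = -(1 / 2) * (inner ℂ v.fn
        (mulOp (fun x => fderiv ℝ (fun x => (β x : ℂ)) x (stdVec j)) v.fn)).re := by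
  -- Integration by parts of `∂ⱼ` against `βv` reproduces the original quantity with the opposite
  -- sign, because `β` is real; only the term with `∂ⱼβ` remains.
  obtain ⟨w, h1, h2⟩ := exists_mul hβ v
  have h3 := inner_pd_left v w j
  rw [h1, h2, inner_add_right] at h3
  have h4 := inner_mulOp hβ.memLp (v.pd j) v.fn
  simp only [Complex.conj_ofReal] at h4
  rw [← h4] at h3
  have h5 : (inner ℂ (mulOp (fun x => (β x : ℂ)) (v.pd j)) v.fn).re
      = (inner ℂ v.fn (mulOp (fun x => (β x : ℂ)) (v.pd j))).re := inner_re_symm (𝕜 := ℂ) _ _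
  have h6 := congrArg Complex.re h3
  rw [Complex.neg_re, Complex.add_re, h5] at h6
  linarith

end H1

/-! ### The lower order terms of the equation -/

/-- The lower order terms `∑ⱼ i βⱼ ∂ⱼ v + c v`. -/
def linOp (β : Fin d → Sp d → ℝ) (c : Sp d → ℂ) (v : H1 d) : L2 d :=
  (∑ j, Complex.I • mulOp (fun x => (β j x : ℂ)) (v.pd j)) + mulOp c v.fn

theorem norm_linOp_le {K : ℝ} {β : Fin d → Sp d → ℝ} {c : Sp d → ℂ}
    (hβ : ∀ j, IsCoeff K (fun x => (β j x : ℂ))) (hc : IsCoeff K c) (v : H1 d) :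
    ‖linOp β c v‖ ≤ (d + 1) * K * ‖v‖ := by
  have hK := hc.nonneg
  calc _ ≤ (∑ j, ‖Complex.I • mulOp (fun x => (β j x : ℂ)) (v.pd j)‖) + ‖mulOp c v.fn‖ :=
        (norm_add_le _ _).trans (add_le_add_left (norm_sum_le _ _) _)
    _ ≤ (∑ _j : Fin d, K * ‖v‖) + K * ‖v‖ := by
        gcongr with j
        · rw [norm_smul, Complex.norm_I, one_mul]
          refine (norm_mulOp_le hK (hβ j).bound _).trans ?_
          gcongr
          exact H1.norm_pd_le v j
        · refine (norm_mulOp_le hK hc.bound _).trans ?_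
          gcongr
          exact H1.norm_fn_le v
    _ = _ := by simp; ring

/-- Cauchy–Schwarz would only give `√s`. The full power comes from splitting `∂ⱼv = T∂ⱼv + ∂ⱼ(v -
Tv)`. For the first part `H1.inner_sub_res` yields `s ∑ₖ ⟨T∂ₖv, ∂ₖ(β T∂ⱼv)⟩`, whose second order
term is `β ∂ⱼ(T∂ₖv)` and is removed by antisymmetry. For the second part antisymmetry leaves a
multiple of `‖v - Tv‖²`, which is at most `s ‖v‖²`. -/
theorem abs_re_inner_sub_res_mul_pd_le {K s : ℝ} (hs : 0 < s) {β : Sp d → ℝ}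
    (hβ : IsCoeff K (fun x => (β x : ℂ))) (v : H1 d) (j : Fin d) :
    |(inner ℂ (v.fn - res s v.fn) (mulOp (fun x => (β x : ℂ)) (v.pd j))).re|
      ≤ s * K * (2 * d + 1) * ‖v‖ ^ 2 := by
  have hK := hβ.nonneg
  set m : Sp d → ℂ := fun x => (β x : ℂ)
  set g : H1 d := v - H1.res hs.le v
  have hg : g.fn = v.fn - res s v.fn := H1.fn_sub _ _
  have hv : v.pd j = res s (v.pd j) + g.pd j := by
    rw [H1.pd_sub, H1.res_pd]; abel
  have hr : ∀ k, ‖res s (v.pd k)‖ ≤ ‖v‖ := fun k =>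
    (norm_res_le hs.le _).trans (H1.norm_pd_le v k)
  have e1 : (inner ℂ (v.fn - res s v.fn) (mulOp m (v.pd j))).re
      = (inner ℂ (v.fn - res s v.fn) (mulOp m (res s (v.pd j)))).re
        + (inner ℂ g.fn (mulOp m (g.pd j))).re := by
    conv_lhs => rw [hv]
    rw [map_add, inner_add_right, Complex.add_re, ← hg]
  obtain ⟨w, hw1, hw2⟩ := H1.exists_mul hβ (H1.resPd hs j v)
  have e2 : (inner ℂ (v.fn - res s v.fn) (mulOp m (res s (v.pd j)))).re
      = s * ∑ k, (-(1 / 2) * (inner ℂ (res s (v.pd k))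
          (mulOp (fun x => fderiv ℝ m x (stdVec j)) (res s (v.pd k)))).re
        + (inner ℂ (res s (v.pd k)) (mulOp (fun x => fderiv ℝ m x (stdVec k))
          (res s (v.pd j)))).re) := by
    rw [H1.resPd_fn] at hw1
    rw [← hw1, H1.inner_sub_res hs.le, Complex.re_ofReal_mul, Complex.re_sum]
    congr 1
    refine Finset.sum_congr rfl fun k _ => ?_
    rw [hw2, H1.resPd_pd_comm, inner_add_right, Complex.add_re]
    have := H1.re_inner_mul_pd hβ (H1.resPd hs k v) j
    rw [H1.resPd_fn] at this
    rw [this]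
    rfl
  have b1 : |(inner ℂ (v.fn - res s v.fn) (mulOp m (res s (v.pd j)))).re|
      ≤ s * (d * (2 * K * ‖v‖ ^ 2)) := by
    rw [e2, abs_mul, abs_of_pos hs]
    gcongr
    refine (Finset.abs_sum_le_sum_abs _ _).trans ?_
    calc _ ≤ ∑ _k : Fin d, 2 * K * ‖v‖ ^ 2 := by
          refine Finset.sum_le_sum fun k _ => (abs_add_le _ _).trans ?_
          have h1 := abs_re_inner_mulOp_le hK (hβ.bound_deriv j) (res s (v.pd k)) (res s (v.pd k))
          have h2 := abs_re_inner_mulOp_le hK (hβ.bound_deriv k) (res s (v.pd k)) (res s (v.pd j))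
          have h3 : K * ‖res s (v.pd k)‖ * ‖res s (v.pd k)‖ ≤ K * ‖v‖ * ‖v‖ := by
            gcongr <;> exact hr k
          have h4 : K * ‖res s (v.pd k)‖ * ‖res s (v.pd j)‖ ≤ K * ‖v‖ * ‖v‖ := by
            gcongr
            exacts [hr k, hr j]
          rw [abs_mul, abs_neg, abs_of_pos (by norm_num : (0 : ℝ) < 1 / 2)]
          have h5 := abs_nonneg (inner ℂ (res s (v.pd k))
            (mulOp (fun x => fderiv ℝ m x (stdVec j)) (res s (v.pd k)))).re
          nlinarith
      _ = _ := by simp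
  have b2 : |(inner ℂ g.fn (mulOp m (g.pd j))).re| ≤ K * (s * ‖v‖ ^ 2) := by
    rw [H1.re_inner_mul_pd hβ g j, abs_mul, abs_neg, abs_of_pos (by norm_num : (0 : ℝ) < 1 / 2)]
    have h1 := abs_re_inner_mulOp_le hK (hβ.bound_deriv j) g.fn g.fn
    have h2 : ‖g.fn‖ ^ 2 ≤ s * ‖v‖ ^ 2 := by
      rw [hg]
      exact (H1.norm_sub_res_sq_le' hs.le v).trans
        (mul_le_mul_of_nonneg_left (H1.sum_norm_pd_sq_le v) hs.le)
    have h3 : K * ‖g.fn‖ * ‖g.fn‖ ≤ K * (s * ‖v‖ ^ 2) := by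
      rw [mul_assoc, ← sq]; gcongr
    have h5 := abs_nonneg (inner ℂ g.fn (mulOp (fun x => fderiv ℝ m x (stdVec j)) g.fn)).re
    linarith
  rw [e1]
  calc _ ≤ _ := abs_add_le _ _
    _ ≤ _ := add_le_add b1 b2
    _ = _ := by ring

/-- Here `c v` already belongs to `H¹`, so `H1.inner_sub_res` gives the factor `s` without any
cancellation, and `c` may be complex. -/
theorem abs_re_inner_sub_res_mul_fn_le {K s : ℝ} (hs : 0 < s) {c : Sp d → ℂ} (hc : IsCoeff K c)
    (v : H1 d) :
    |(inner ℂ (v.fn - res s v.fn) (mulOp c v.fn)).re| ≤ s * K * (2 * d) * ‖v‖ ^ 2 := by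
  have hK := hc.nonneg
  obtain ⟨w, hw1, hw2⟩ := H1.exists_mul hc v
  have hr : ∀ k, ‖res s (v.pd k)‖ ≤ ‖v‖ := fun k =>
    (norm_res_le hs.le _).trans (H1.norm_pd_le v k)
  rw [← hw1, H1.inner_sub_res hs.le, Complex.re_ofReal_mul, Complex.re_sum, abs_mul,
    abs_of_pos hs]
  calc s * |∑ k, (inner ℂ (res s (v.pd k)) (w.pd k)).re|
      ≤ s * ∑ _k : Fin d, 2 * K * ‖v‖ ^ 2 := by
        gcongr
        refine (Finset.abs_sum_le_sum_abs _ _).trans (Finset.sum_le_sum fun k _ => ?_)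
        rw [hw2, inner_add_right, Complex.add_re]
        refine (abs_add_le _ _).trans ?_
        have h1 := abs_re_inner_mulOp_le hK hc.bound (res s (v.pd k)) (v.pd k)
        have h2 := abs_re_inner_mulOp_le hK (hc.bound_deriv k) (res s (v.pd k)) v.fn
        have h3 : K * ‖res s (v.pd k)‖ * ‖v.pd k‖ ≤ K * ‖v‖ * ‖v‖ := by
          gcongr
          exacts [hr k, H1.norm_pd_le v k]
        have h4 : K * ‖res s (v.pd k)‖ * ‖v.fn‖ ≤ K * ‖v‖ * ‖v‖ := by
          gcongr
          exacts [hr k, H1.norm_fn_le v]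
        linarith
    _ = _ := by simp; ring

theorem mulOp_I_mul {m : Sp d → ℂ} (hm : MemLp m ∞ (volume : Measure (Sp d))) (f : L2 d) :
    mulOp (fun x => Complex.I * m x) f = Complex.I • mulOp m f := by
  refine Lp.ext ?_
  filter_upwards [mulOp_coeFn (hm.const_mul Complex.I) f, mulOp_coeFn hm f,
    Lp.coeFn_smul Complex.I (mulOp m f)] with x h1 h2 h3
  rw [h3, Pi.smul_apply, h1, h2, smul_eq_mul, mul_assoc]

/-- The contribution of the lower order terms to the regularised energy identity. -/
theorem abs_re_inner_sub_res_linOp_le {K s : ℝ} (hs : 0 < s) {β : Fin d → Sp d → ℝ}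
    {c : Sp d → ℂ} (hβ : ∀ j, IsCoeff K (fun x => (β j x : ℂ))) (hc : IsCoeff K c) (v : H1 d) :
    |(inner ℂ (v.fn - res s v.fn) (Complex.I • linOp β c v)).re|
      ≤ s * (K * (d * (2 * d + 3)) * ‖v‖ ^ 2) := by
  -- The factor `i` of the flow turns `iβⱼ∂ⱼ` into `-βⱼ∂ⱼ` with a real coefficient, as the
  -- antisymmetry argument requires.
  have e : Complex.I • linOp β c v
      = (∑ j, (-1 : ℂ) • mulOp (fun x => (β j x : ℂ)) (v.pd j))
        + mulOp (fun x => Complex.I * c x) v.fn := by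
    rw [linOp, smul_add, Finset.smul_sum, mulOp_I_mul hc.memLp]
    simp_rw [smul_smul, Complex.I_mul_I]
  rw [e, inner_add_right, inner_sum, Complex.add_re, Complex.re_sum]
  have h1 := abs_re_inner_sub_res_mul_fn_le hs hc.I_mul v
  have h2 : |∑ j, (inner ℂ (v.fn - res s v.fn)
      ((-1 : ℂ) • mulOp (fun x => (β j x : ℂ)) (v.pd j))).re|
      ≤ ∑ _j : Fin d, s * K * (2 * d + 1) * ‖v‖ ^ 2 := by
    refine (Finset.abs_sum_le_sum_abs _ _).trans (Finset.sum_le_sum fun j _ => ?_)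
    rw [neg_one_smul, inner_neg_right, Complex.neg_re, abs_neg]
    exact abs_re_inner_sub_res_mul_pd_le hs (hβ j) v j
  refine (abs_add_le _ _).trans ((add_le_add h2 h1).trans (le_of_eq ?_))
  simp
  ring

/-! ### The free group -/

theorem continuous_schrodingerSymbol_time (ξ : Sp d) :
    Continuous fun t => schrodingerSymbol d t ξ := by
  unfold schrodingerSymbol; fun_prop

theorem norm_schrodingerSymbol (t : ℝ) (ξ : Sp d) : ‖schrodingerSymbol d t ξ‖ = 1 := by
  rw [schrodingerSymbol, Complex.norm_exp_ofReal_mul_I]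

theorem schrodingerSymbol_add (t s : ℝ) (ξ : Sp d) :
    schrodingerSymbol d (t + s) ξ = schrodingerSymbol d t ξ * schrodingerSymbol d s ξ := by
  rw [schrodingerSymbol, schrodingerSymbol, schrodingerSymbol, ← Complex.exp_add]
  congr 1
  push_cast
  ring

theorem conj_schrodingerSymbol (t : ℝ) (ξ : Sp d) :
    (starRingEnd ℂ) (schrodingerSymbol d t ξ) = schrodingerSymbol d (-t) ξ := by
  rw [schrodingerSymbol, schrodingerSymbol, ← Complex.exp_conj, map_mul, Complex.conj_ofReal,
    Complex.conj_I]
  congr 1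
  push_cast
  ring

theorem schrodingerSymbol_zero (ξ : Sp d) : schrodingerSymbol d 0 ξ = 1 := by
  simp [schrodingerSymbol]

/-- The free group as a family of bounded operators. -/
def freeL (t : ℝ) : L2 d →L[ℂ] L2 d := fmul (schrodingerSymbol d t)

theorem freeGroup_eq (t : ℝ) (f : L2 d) : freeGroup t f = freeL t f := by
  rw [freeL, fmul_apply, mulOp_eq (memLp_schrodingerSymbol d t)]
  rfl

theorem norm_freeL_le (t : ℝ) (f : L2 d) : ‖freeL t f‖ ≤ ‖f‖ := by
  have := norm_fmul_le zero_le_one (fun ξ => (norm_schrodingerSymbol (d := d) t ξ).le) f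
  rwa [one_mul] at this

theorem freeL_freeL (t s : ℝ) (f : L2 d) : freeL t (freeL s f) = freeL (t + s) f := by
  rw [freeL, freeL, freeL, fmul_fmul (memLp_schrodingerSymbol d t) (memLp_schrodingerSymbol d s)]
  simp_rw [← schrodingerSymbol_add]

theorem freeL_zero (f : L2 d) : freeL 0 f = f := by
  rw [freeL, funext schrodingerSymbol_zero, fmul_const_one]

theorem inner_freeL_left (t : ℝ) (f g : L2 d) :
    inner ℂ (freeL t f) g = inner ℂ f (freeL (-t) g) := by
  have := inner_fmul (memLp_schrodingerSymbol d (-t)) f g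
  simp_rw [conj_schrodingerSymbol, neg_neg] at this
  exact this

theorem continuous_freeL_apply (f : L2 d) : Continuous fun t => freeL t f := by
  rw [continuous_iff_continuousAt]
  intro t
  refine tendsto_fmul (C := 2) (fun i => memLp_schrodingerSymbol d i)
    (memLp_schrodingerSymbol d t) (Eventually.of_forall fun i ξ => ?_)
    (Eventually.of_forall fun ξ => (continuous_schrodingerSymbol_time ξ).tendsto t) f
  refine (norm_sub_le _ _).trans ?_
  rw [norm_schrodingerSymbol, norm_schrodingerSymbol]
  norm_num

/-- Strong convergence of uniformly bounded operators along converging vectors. -/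
theorem tendsto_clm_apply_of_bound {ι : Type*} {l : Filter ι} {R : ι → L2 d →L[ℂ] L2 d}
    {g : ι → L2 d} {f h : L2 d} {C : ℝ} (hC : ∀ i x, ‖R i x‖ ≤ C * ‖x‖)
    (hg : Tendsto g l (𝓝 f)) (hR : Tendsto (fun i => R i f) l (𝓝 h)) :
    Tendsto (fun i => R i (g i)) l (𝓝 h) := by
  have h1 : Tendsto (fun i => R i (g i - f)) l (𝓝 0) := by
    refine squeeze_zero_norm (fun i => hC i _) ?_
    have : Tendsto (fun i => C * ‖g i - f‖) l (𝓝 (C * ‖f - f‖)) :=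
      ((hg.sub_const f).norm).const_mul C
    simpa using this
  have := h1.add hR
  simpa using this

theorem ContinuousOn.freeL {S : Set ℝ} {a : ℝ → ℝ} {g : ℝ → L2 d} (ha : ContinuousOn a S)
    (hg : ContinuousOn g S) : ContinuousOn (fun t => freeL (a t) (g t)) S := fun t ht =>
  tendsto_clm_apply_of_bound (C := 1) (fun i x => by rw [one_mul]; exact norm_freeL_le _ _)
    (hg t ht) (((continuous_freeL_apply (g t)).tendsto _).comp (ha t ht))

theorem norm_exp_sub_exp_le (a b : ℝ) :
    ‖Complex.exp ((a : ℂ) * Complex.I) - Complex.exp ((b : ℂ) * Complex.I)‖ ≤ |a - b| := by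
  have : Complex.exp ((a : ℂ) * Complex.I) - Complex.exp ((b : ℂ) * Complex.I)
      = Complex.exp ((b : ℂ) * Complex.I) * (Complex.exp (Complex.I * ((a - b : ℝ) : ℂ)) - 1) := by
    rw [mul_sub, ← Complex.exp_add, mul_one]
    congr 2
    push_cast; ring
  rw [this, norm_mul, Complex.norm_exp_ofReal_mul_I, one_mul]
  exact Real.norm_exp_I_mul_ofReal_sub_one_le

/-- The symbol of the regularised group `(1 - sΔ)⁻¹ e^{itΔ}`. -/
def regSymbol (d : ℕ) (s t : ℝ) (ξ : Sp d) : ℂ := (rsym s ξ : ℂ) * schrodingerSymbol d t ξ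

theorem memLp_regSymbol {s : ℝ} (hs : 0 ≤ s) (t : ℝ) :
    MemLp (regSymbol d s t) ∞ (volume : Measure (Sp d)) :=
  memLp_top_mul (memLp_rsym hs) (memLp_schrodingerSymbol d t)

theorem norm_regSymbol_le {s : ℝ} (hs : 0 ≤ s) (t : ℝ) (ξ : Sp d) : ‖regSymbol d s t ξ‖ ≤ 1 := by
  rw [regSymbol, norm_mul, norm_schrodingerSymbol, mul_one]
  exact norm_rsym_ofReal_le hs ξ

theorem fmul_regSymbol {s : ℝ} (hs : 0 ≤ s) (t : ℝ) (f : L2 d) :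
    fmul (regSymbol d s t) f = res s (freeL t f) :=
  (fmul_fmul (memLp_rsym hs) (memLp_schrodingerSymbol d t) f).symm

theorem rsym_mul_asym {s : ℝ} (hs : 0 < s) (ξ : Sp d) :
    rsym s ξ * asym ξ = s⁻¹ * (1 - rsym s ξ) := by
  rw [one_sub_rsym hs.le]; field_simp

/-- Strong differentiability of the regularised group. -/
theorem tendsto_slope_regSymbol {s : ℝ} (hs : 0 < s) (t : ℝ) (f : L2 d) :
    Tendsto (fun h : ℝ => (h⁻¹ : ℂ) • (fmul (regSymbol d s (t + h)) f - fmul (regSymbol d s t) f))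
      (𝓝[≠] 0) (𝓝 (-(Complex.I * (s⁻¹ : ℝ)) • (freeL t f - res s (freeL t f)))) := by
  set m₀ : Sp d → ℂ := fun ξ => -(Complex.I * (s⁻¹ : ℝ)) *
    (schrodingerSymbol d t ξ - regSymbol d s t ξ)
  have hd1 : MemLp (fun ξ => schrodingerSymbol d t ξ - regSymbol d s t ξ) ∞
      (volume : Measure (Sp d)) := (memLp_schrodingerSymbol d t).sub (memLp_regSymbol hs.le t)
  have hm₀ : MemLp m₀ ∞ (volume : Measure (Sp d)) := hd1.const_mul _
  have hd2 : ∀ h : ℝ, MemLp (fun ξ => regSymbol d s (t + h) ξ - regSymbol d s t ξ) ∞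
      (volume : Measure (Sp d)) := fun h => (memLp_regSymbol hs.le _).sub (memLp_regSymbol hs.le t)
  have e0 : fmul m₀ f = -(Complex.I * (s⁻¹ : ℝ)) • (freeL t f - res s (freeL t f)) := by
    rw [fmul_const_mul hd1, fmul_sub (memLp_schrodingerSymbol d t) (memLp_regSymbol hs.le t),
      fmul_regSymbol hs.le]
    rfl
  have e1 : ∀ h : ℝ, (h⁻¹ : ℂ) • (fmul (regSymbol d s (t + h)) f - fmul (regSymbol d s t) f)
      = fmul (fun ξ => (h⁻¹ : ℂ) * (regSymbol d s (t + h) ξ - regSymbol d s t ξ)) f := fun h => by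
    rw [fmul_const_mul (hd2 h), fmul_sub (memLp_regSymbol hs.le _) (memLp_regSymbol hs.le t)]
  rw [← e0]
  simp_rw [e1]
  -- The difference quotient of the phase grows like `4π²|ξ|²`, and the resolvent symbol compensates
  -- it up to `s⁻¹`. This uniform bound is what makes the regularised group strongly differentiable
  -- on all of `L²`.
  have hb : ∀ (h : ℝ) (ξ : Sp d),
      ‖(h⁻¹ : ℂ) * (regSymbol d s (t + h) ξ - regSymbol d s t ξ)‖ ≤ s⁻¹ := fun h ξ => by
    have h1 : ‖schrodingerSymbol d (t + h) ξ - schrodingerSymbol d t ξ‖ ≤ |h| * asym ξ := by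
      refine (norm_exp_sub_exp_le _ _).trans (le_of_eq ?_)
      rw [← abs_of_nonneg (asym_nonneg ξ), ← abs_mul, ← abs_neg, asym]
      congr 1
      ring
    have h2 : ‖regSymbol d s (t + h) ξ - regSymbol d s t ξ‖ ≤ |h| * s⁻¹ := by
      rw [regSymbol, regSymbol, ← mul_sub, norm_mul, Complex.norm_real,
        Real.norm_of_nonneg (rsym_pos hs.le ξ).le]
      have hr := rsym_pos hs.le ξ
      calc _ ≤ rsym s ξ * (|h| * asym ξ) := by gcongr
        _ = |h| * (rsym s ξ * asym ξ) := by ring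
        _ = |h| * (s⁻¹ * (1 - rsym s ξ)) := by rw [rsym_mul_asym hs]
        _ ≤ |h| * (s⁻¹ * 1) := by gcongr; linarith
        _ = _ := by ring
    rw [norm_mul, norm_inv, Complex.norm_real, Real.norm_eq_abs]
    rcases eq_or_ne h 0 with rfl | hh
    · simp [hs.le]
    · calc _ ≤ |h|⁻¹ * (|h| * s⁻¹) := by gcongr
        _ = s⁻¹ := by rw [← mul_assoc, inv_mul_cancel₀ (abs_ne_zero.2 hh), one_mul]
  have hb0 : ∀ ξ, ‖m₀ ξ‖ ≤ s⁻¹ * 2 := fun ξ => by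
    simp only [m₀, norm_mul, norm_neg, Complex.norm_I, one_mul, Complex.norm_real,
      Real.norm_of_nonneg (inv_nonneg.2 hs.le)]
    gcongr
    refine (norm_sub_le _ _).trans ?_
    rw [norm_schrodingerSymbol]
    linarith [norm_regSymbol_le hs.le t ξ]
  refine tendsto_fmul (C := s⁻¹ + s⁻¹ * 2) (fun h => (hd2 h).const_mul _) hm₀
    (Eventually.of_forall fun h ξ => (norm_sub_le _ _).trans (add_le_add (hb h ξ) (hb0 ξ)))
    (Eventually.of_forall fun ξ => ?_) f
  have hder : HasDerivAt (fun t => regSymbol d s t ξ) (m₀ ξ) t := by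
    have h1 : HasDerivAt (fun t : ℝ => ((-(4 * Real.pi ^ 2 * t * ‖ξ‖ ^ 2) : ℝ) : ℂ))
        ((-(asym ξ) : ℝ) : ℂ) t := by
      refine HasDerivAt.ofReal_comp ?_
      have := ((hasDerivAt_id t).const_mul (-(asym ξ)))
      simp only [mul_one] at this
      refine this.congr_of_eventuallyEq (Eventually.of_forall fun τ => ?_)
      simp [asym]; ring
    have h2 := ((h1.mul_const Complex.I).cexp).const_mul (rsym s ξ : ℂ)
    refine h2.congr_deriv ?_
    have h3 : (rsym s ξ : ℂ) * asym ξ = (s⁻¹ : ℝ) * (1 - rsym s ξ) := by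
      exact_mod_cast congrArg (fun r : ℝ => (r : ℂ)) (rsym_mul_asym hs ξ)
    change (rsym s ξ : ℂ) * (schrodingerSymbol d t ξ * (((-(asym ξ) : ℝ) : ℂ) * Complex.I))
      = -(Complex.I * (s⁻¹ : ℝ)) * (schrodingerSymbol d t ξ
        - (rsym s ξ : ℂ) * schrodingerSymbol d t ξ)
    push_cast at h3 ⊢
    linear_combination (-(schrodingerSymbol d t ξ) * Complex.I) * h3
  have := hasDerivAt_iff_tendsto_slope_zero.1 hder
  refine this.congr fun h => ?_
  rw [Complex.real_smul]
  push_cast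
  rfl

/-! ### Derivatives along solutions -/

/-- `u ∈ C([0, T]; H¹)` solves `i uₜ + Δ u + G = 0` in the mild sense, with continuous `G`. -/
structure IsFlow (T : ℝ) (u : ℝ → H1 d) (G : ℝ → L2 d) : Prop where
  cont : ContinuousOn u (Icc 0 T)
  cont_G : ContinuousOn G (Icc 0 T)
  duhamel : ∀ t ∈ Icc 0 T,
    (u t).fn = freeL t (u 0).fn + Complex.I • ∫ s in (0 : ℝ)..t, freeL (t - s) (G s)

namespace IsFlow

variable {T : ℝ} {u : ℝ → H1 d} {G : ℝ → L2 d}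

theorem freeL_neg_eq (h : IsFlow T u G) {t : ℝ} (ht : t ∈ Icc 0 T) :
    freeL (-t) (u t).fn = (u 0).fn + Complex.I • ∫ s in (0 : ℝ)..t, freeL (-s) (G s) := by
  have hsub : uIcc 0 t ⊆ Icc 0 T := by
    rw [uIcc_of_le ht.1]; exact Icc_subset_Icc_right ht.2
  have hi : IntervalIntegrable (fun s => freeL (t - s) (G s)) volume 0 t :=
    ((ContinuousOn.freeL (by fun_prop) h.cont_G).mono hsub).intervalIntegrable
  rw [h.duhamel t ht, map_add, freeL_freeL, neg_add_cancel, freeL_zero, map_smul,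
    ← ContinuousLinearMap.intervalIntegral_comp_comm _ hi]
  congr 2
  refine intervalIntegral.integral_congr fun s _ => ?_
  rw [freeL_freeL]
  congr 2
  ring

/-- The pulled-back curve `e^{-itΔ} u(t)` no longer sees the Laplacian, so it is differentiable in
`L²` although `u` itself need not be. Later derivatives along the flow are computed from this curve.
-/
theorem hasDerivAt_freeL_neg (h : IsFlow T u G) {t : ℝ} (ht : t ∈ Ioo 0 T) :
    HasDerivAt (fun t => freeL (-t) (u t).fn) (Complex.I • freeL (-t) (G t)) t := by
  have hc : ContinuousOn (fun s => freeL (-s) (G s)) (Icc 0 T) :=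
    ContinuousOn.freeL (by fun_prop) h.cont_G
  have hsub : uIcc 0 t ⊆ Icc 0 T := by
    rw [uIcc_of_le ht.1.le]; exact Icc_subset_Icc_right ht.2.le
  have hca : ContinuousAt (fun s => freeL (-s) (G s)) t :=
    hc.continuousAt (Icc_mem_nhds ht.1 ht.2)
  have h1 := intervalIntegral.integral_hasDerivAt_right
    (hc.mono hsub).intervalIntegrable
    ((hc.mono Ioo_subset_Icc_self).stronglyMeasurableAtFilter isOpen_Ioo t ht) hca
  have h2 := (h1.const_smul Complex.I).const_add (u 0).fn
  refine h2.congr_of_eventuallyEq ?_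
  filter_upwards [Icc_mem_nhds ht.1 ht.2] with τ hτ
  exact h.freeL_neg_eq hτ

/-- A product rule for `T e^{itΔ}` acting on `e^{-itΔ} u(t)`. The Laplacian enters only through the
bounded operator `ΔT = -s⁻¹(1 - T)`. -/
theorem hasDerivAt_res (h : IsFlow T u G) {s : ℝ} (hs : 0 < s) {t : ℝ} (ht : t ∈ Ioo 0 T) :
    HasDerivAt (fun t => res s (u t).fn)
      (-(Complex.I * (s⁻¹ : ℝ)) • ((u t).fn - res s (u t).fn) + Complex.I • res s (G t)) t := by
  set v : ℝ → L2 d := fun t => freeL (-t) (u t).fn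
  have hv := h.hasDerivAt_freeL_neg ht
  have huv : ∀ τ, res s (u τ).fn = fmul (regSymbol d s τ) (v τ) := fun τ => by
    rw [fmul_regSymbol hs.le, freeL_freeL, add_neg_cancel, freeL_zero]
  simp_rw [huv]
  rw [hasDerivAt_iff_tendsto_slope_zero]
  have h1 := hasDerivAt_iff_tendsto_slope_zero.1 hv
  have hR : ∀ f : L2 d, Tendsto (fun r : ℝ => fmul (regSymbol d s (t + r)) f) (𝓝[≠] 0)
      (𝓝 (fmul (regSymbol d s t) f)) := fun f => by
    simp_rw [fmul_regSymbol hs.le]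
    have : Continuous fun r : ℝ => res s (freeL (t + r) f) :=
      (res s).continuous.comp ((continuous_freeL_apply f).comp (by fun_prop))
    have := this.tendsto 0
    rw [add_zero] at this
    exact this.mono_left nhdsWithin_le_nhds
  have h2 := tendsto_clm_apply_of_bound (R := fun r : ℝ => fmul (regSymbol d s (t + r))) (C := 1)
    (fun i x => norm_fmul_le zero_le_one (norm_regSymbol_le hs.le _) x) h1 (hR _)
  have h3 := tendsto_slope_regSymbol hs t (v t)
  have h4 := h3.add h2
  have e1 : freeL t (v t) = (u t).fn := by rw [freeL_freeL, add_neg_cancel, freeL_zero]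
  have e2 : fmul (regSymbol d s t) (Complex.I • freeL (-t) (G t)) = Complex.I • res s (G t) := by
    rw [map_smul, fmul_regSymbol hs.le, freeL_freeL, add_neg_cancel, freeL_zero]
  rw [e1, e2] at h4
  have e3 : fmul (regSymbol d s t) (v t) = res s (u t).fn := (huv t).symm
  rw [e3]
  refine h4.congr fun r => ?_
  rw [e3]
  have e4 : ∀ x : L2 d, (r⁻¹ : ℝ) • x = (r⁻¹ : ℂ) • x := fun x => by
    rw [← Complex.ofReal_inv]; rfl
  simp only [e4, map_smul, map_sub, ← smul_add]
  congr 1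
  abel

/-- The derivative of the quadratic form of a real Fourier multiplier. -/
theorem hasDerivAt_inner_fmul (h : IsFlow T u G) {m : Sp d → ℝ}
    (hm : MemLp (fun x => (m x : ℂ)) ∞ (volume : Measure (Sp d))) {t : ℝ} (ht : t ∈ Ioo 0 T) :
    HasDerivAt (fun t => (inner ℂ (fmul (fun x => (m x : ℂ)) (u t).fn) (u t).fn).re)
      (2 * (inner ℂ (fmul (fun x => (m x : ℂ)) (u t).fn) (Complex.I • G t)).re) t := by
  set L : L2 d →L[ℂ] L2 d := fmul (fun x => (m x : ℂ))
  have hL : ∀ τ f, L (freeL τ f) = freeL τ (L f) := fun τ f =>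
    fmul_comm hm (memLp_schrodingerSymbol d τ) f
  -- The multiplier commutes with the unitary free group, so the form can be evaluated on the
  -- pulled-back curve, and the Laplacian contributes nothing to its derivative.
  have hun : ∀ τ f g, inner ℂ (L (freeL τ f)) (freeL τ g) = inner ℂ (L f) g := fun τ f g => by
    rw [hL, inner_freeL_left, freeL_freeL, neg_add_cancel, freeL_zero]
  have hv := h.hasDerivAt_freeL_neg ht
  have hLv : HasDerivAt (fun t => L (freeL (-t) (u t).fn)) (L (Complex.I • freeL (-t) (G t))) t :=
    (L.restrictScalars ℝ).hasFDerivAt.comp_hasDerivAt t hv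
  have h1 := hLv.inner ℂ hv
  have h2 : HasDerivAt (fun t => (inner ℂ (L (freeL (-t) (u t).fn)) (freeL (-t) (u t).fn)).re)
      _ t := Complex.reCLM.hasFDerivAt.comp_hasDerivAt t h1
  simp_rw [hun] at h2
  refine h2.congr_deriv ?_
  have e1 : inner ℂ (L (Complex.I • freeL (-t) (G t))) (freeL (-t) (u t).fn)
      = inner ℂ (L (Complex.I • G t)) (u t).fn := by
    rw [← map_smul, hun]
  have e2 : (inner ℂ (L (Complex.I • G t)) (u t).fn).re
      = (inner ℂ (L (u t).fn) (Complex.I • G t)).re := by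
    rw [inner_fmul_of_real hm]
    exact inner_re_symm (𝕜 := ℂ) _ _
  rw [e1, ← map_smul, hun, Complex.reCLM_apply, Complex.add_re, e2, two_mul]

end IsFlow

/-! ### Differentiability of the potential energy -/

theorem normSq_add_expand (a b : ℂ) :
    ((starRingEnd ℂ) b * (a - b)).re = (‖a‖ ^ 2 - ‖b‖ ^ 2 - ‖a - b‖ ^ 2) / 2 := by
  simp only [← Complex.normSq_eq_norm_sq, Complex.normSq_apply, Complex.mul_re, Complex.conj_re,
    Complex.conj_im, Complex.sub_re, Complex.sub_im]
  ring

/-- Second order Taylor estimate for `|z|^{p+2} / (p+2)`. -/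
theorem abs_taylor_le (hd : d = 1 ∨ d = 2) {a b : ℂ} {B : ℝ} (ha : ‖a‖ ≤ B) (hb : ‖b‖ ≤ B) :
    |1 / (pw d + 2 : ℝ) * ‖a‖ ^ (pw d + 2) - 1 / (pw d + 2 : ℝ) * ‖b‖ ^ (pw d + 2)
      - ((starRingEnd ℂ) (nlf (pw d) b) * (a - b)).re| ≤ 3 * B ^ pw d * ‖a - b‖ ^ 2 := by
  -- Polarisation expresses the remainder through `|a|²`, `|b|²` and `|a - b|²`. For the exponents
  -- `4` and `2` it then becomes an explicit nonnegative polynomial in these quantities.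
  have e0 : ((starRingEnd ℂ) (nlf (pw d) b) * (a - b)).re
      = ‖b‖ ^ pw d * ((‖a‖ ^ 2 - ‖b‖ ^ 2 - ‖a - b‖ ^ 2) / 2) := by
    rw [← normSq_add_expand, nlf, map_mul, Complex.conj_ofReal, mul_assoc, Complex.re_ofReal_mul]
  rw [e0]
  have hB : 0 ≤ B := (norm_nonneg _).trans ha
  have h1 : (‖a‖ ^ 2 - ‖b‖ ^ 2) ^ 2 ≤ 4 * B ^ 2 * ‖a - b‖ ^ 2 := by
    have h2 : |‖a‖ - ‖b‖| ≤ ‖a - b‖ := abs_norm_sub_norm_le _ _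
    have h3 : (‖a‖ - ‖b‖) ^ 2 ≤ ‖a - b‖ ^ 2 := by
      rw [← sq_abs]; gcongr
    have h4 : (‖a‖ + ‖b‖) ^ 2 ≤ (2 * B) ^ 2 := by
      gcongr; linarith
    calc _ = (‖a‖ + ‖b‖) ^ 2 * (‖a‖ - ‖b‖) ^ 2 := by ring
      _ ≤ (2 * B) ^ 2 * ‖a - b‖ ^ 2 := by gcongr
      _ = _ := by ring
  have hb2 : ‖b‖ ^ 2 ≤ B ^ 2 := by gcongr
  have ha2 : ‖a‖ ^ 2 ≤ B ^ 2 := by gcongr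
  set X := ‖a‖ ^ 2
  set Y := ‖b‖ ^ 2
  set D := ‖a - b‖ ^ 2
  have hX : 0 ≤ X := by positivity
  have hY : 0 ≤ Y := by positivity
  have hD : 0 ≤ D := by positivity
  rcases hd with rfl | rfl
  · have hp : pw 1 = 4 := rfl
    have e1 : ‖a‖ ^ 6 = X ^ 3 := by simp only [X]; ring
    have e2 : ‖b‖ ^ 6 = Y ^ 3 := by simp only [Y]; ring
    have e3 : ‖b‖ ^ 4 = Y ^ 2 := by simp only [Y]; ring
    have e4 : B ^ 4 = (B ^ 2) ^ 2 := by ring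
    simp only [hp, Nat.reduceAdd, e1, e2, e3, e4]
    set Z := B ^ 2
    have hZ : 0 ≤ Z := by positivity
    have e : 1 / (((4 : ℕ) : ℝ) + 2) * X ^ 3 - 1 / (((4 : ℕ) : ℝ) + 2) * Y ^ 3
        - Y ^ 2 * ((X - Y - D) / 2) = (X - Y) ^ 2 * (X + 2 * Y) / 6 + Y ^ 2 * D / 2 := by
      push_cast; ring
    rw [e, abs_of_nonneg (by positivity)]
    have h5 : (X - Y) ^ 2 * (X + 2 * Y) ≤ (4 * Z * D) * (3 * Z) := by
      gcongr; linarith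
    have h6 : Y ^ 2 * D ≤ Z ^ 2 * D := by gcongr
    nlinarith [mul_nonneg (sq_nonneg Z) hD]
  · have hp : pw 2 = 2 := rfl
    have e1 : ‖a‖ ^ 4 = X ^ 2 := by simp only [X]; ring
    have e2 : ‖b‖ ^ 4 = Y ^ 2 := by simp only [Y]; ring
    simp only [hp, Nat.reduceAdd, e1, e2]
    change |_ - _ - Y * _| ≤ _
    set Z := B ^ 2
    have e : 1 / (((2 : ℕ) : ℝ) + 2) * X ^ 2 - 1 / (((2 : ℕ) : ℝ) + 2) * Y ^ 2
        - Y * ((X - Y - D) / 2) = (X - Y) ^ 2 / 4 + Y * D / 2 := by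
      push_cast; ring
    rw [e, abs_of_nonneg (by positivity)]
    have h6 : Y * D ≤ Z * D := by gcongr
    nlinarith [mul_nonneg (sq_nonneg B) hD]

theorem integrable_pow_norm (hd : d = 1 ∨ d = 2) (v : H1 d) :
    Integrable (fun x => ‖v.fn x‖ ^ (pw d + 2)) volume := by
  refine (integrable_conj_mul v.fn (nl v)).norm.congr ?_
  filter_upwards [nl_coeFn hd v] with x hx
  rw [hx, norm_mul, norm_nlf, RCLike.norm_conj]
  ring

theorem potential_eq_integral (hd : d = 1 ∨ d = 2) (v : H1 d) :
    potential v = ∫ x, 1 / (pw d + 2 : ℝ) * ‖v.fn x‖ ^ (pw d + 2) := by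
  rw [potential, inner_nl_eq_integral hd, integral_const_mul]

theorem abs_potential_sub_le (hd : d = 1 ∨ d = 2) (v w : H1 d) {B : ℝ}
    (hv : ∀ᵐ x, ‖v.fn x‖ ≤ B) (hw : ∀ᵐ x, ‖w.fn x‖ ≤ B) :
    |potential v - potential w - (inner ℂ (nl w) (v.fn - w.fn)).re|
      ≤ 3 * B ^ pw d * ‖v.fn - w.fn‖ ^ 2 := by
  have i1 := (integrable_pow_norm hd v).const_mul (1 / (pw d + 2 : ℝ))
  have i2 := (integrable_pow_norm hd w).const_mul (1 / (pw d + 2 : ℝ))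
  have i3 := integrable_conj_mul (nl w) (v.fn - w.fn)
  have e : (inner ℂ (nl w) (v.fn - w.fn)).re
      = ∫ x, ((starRingEnd ℂ) (nl w x) * (v.fn - w.fn : L2 d) x).re := by
    rw [inner_eq_integral]
    exact (integral_re i3).symm
  have i4 : Integrable (fun x => 1 / (pw d + 2 : ℝ) * ‖v.fn x‖ ^ (pw d + 2)
      - 1 / (pw d + 2 : ℝ) * ‖w.fn x‖ ^ (pw d + 2)) volume := i1.sub i2
  have i5 : Integrable (fun x => ((starRingEnd ℂ) (nl w x) * (v.fn - w.fn : L2 d) x).re) volume :=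
    i3.re
  rw [potential_eq_integral hd, potential_eq_integral hd, e, ← integral_sub i1 i2,
    ← integral_sub i4 i5, norm_sq_eq_integral, ← integral_const_mul]
  refine (abs_integral_le_integral_abs).trans (integral_mono_ae (i4.sub i5).abs
    ((integrable_norm_sq _).const_mul _) ?_)
  filter_upwards [hv, hw, nl_coeFn hd w, Lp.coeFn_sub v.fn w.fn] with x h1 h2 h3 h4
  rw [h3, h4]
  exact abs_taylor_le hd h1 h2

/-- The potential energy is differentiable along bounded `L²`-differentiable curves. -/
theorem hasDerivAt_potential (hd : d = 1 ∨ d = 2) {w : ℝ → H1 d} {w' : L2 d} {t B : ℝ}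
    (hw : HasDerivAt (fun t => (w t).fn) w' t) (hB : ∀ᶠ τ in 𝓝 t, ∀ᵐ x, ‖(w τ).fn x‖ ≤ B) :
    HasDerivAt (fun t => potential (w t)) (inner ℂ (nl (w t)) w').re t := by
  set r : ℝ → ℝ := fun τ => potential (w τ) - potential (w t)
    - (inner ℂ (nl (w t)) ((w τ).fn - (w t).fn)).re
  have hr : HasDerivAt r 0 t := by
    rw [hasDerivAt_iff_isLittleO]
    have h0 : r t = 0 := by simp [r]
    simp only [h0, sub_zero, smul_zero]
    -- With the uniform pointwise bound the Taylor remainder is quadratic in the `L²` distance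
    -- alone, so `L²` differentiability of the curve suffices.
    have h1 : r =O[𝓝 t] fun τ => ‖(w τ).fn - (w t).fn‖ ^ 2 := by
      refine Asymptotics.IsBigO.of_bound (3 * B ^ pw d) ?_
      filter_upwards [hB] with τ hτ
      rw [Real.norm_eq_abs, Real.norm_of_nonneg (by positivity)]
      exact abs_potential_sub_le hd _ _ hτ hB.self_of_nhds
    have h2 : (fun τ => ‖(w τ).fn - (w t).fn‖ ^ 2) =O[𝓝 t] fun τ => (τ - t) ^ 2 :=
      (hw.isBigO_sub.norm_left).pow 2
    refine (h1.trans h2).trans_isLittleO ?_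
    have h3 : (fun τ : ℝ => (τ - t) * (τ - t)) =o[𝓝 t] fun τ => (τ - t) * 1 := by
      refine (Asymptotics.isBigO_refl _ _).mul_isLittleO ?_
      rw [Asymptotics.isLittleO_one_iff]
      have : Continuous fun τ : ℝ => τ - t := by fun_prop
      simpa using this.tendsto t
    simpa [sq] using h3
  have hin : HasDerivAt (fun τ => (inner ℂ (nl (w t)) ((w τ).fn - (w t).fn)).re)
      (inner ℂ (nl (w t)) w').re t := by
    have h1 := (hasDerivAt_const t (nl (w t))).inner ℂ (hw.sub_const (w t).fn)
    have h2 := Complex.reCLM.hasFDerivAt.comp_hasDerivAt t h1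
    refine h2.congr_deriv ?_
    simp
  have h := (hr.add hin).add_const (potential (w t))
  rw [zero_add] at h
  refine h.congr_of_eventuallyEq (Eventually.of_forall fun τ => ?_)
  simp [r]

/-! ### Estimates for the regularised nonlinearity -/

/-- Supremum bounds for the regularisation, with logarithmic loss. -/
theorem exists_res_bound (hd : d = 1 ∨ d = 2) : ∃ C : ℝ, 0 ≤ C ∧ ∀ (j : ℕ) (v : H1 d),
    ∃ B : ℝ, 0 ≤ B ∧ (∀ᵐ x, ‖res (sc j) v.fn x‖ ≤ B) ∧ B ^ pw d ≤ C * (1 + j) * ‖v‖ ^ pw d := by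
  rcases hd with hd | hd
  · obtain ⟨C, hC, h⟩ := exists_ae_norm_le_of_dim_one hd
    refine ⟨C ^ pw d, by positivity, fun j v => ⟨C * ‖v‖, by positivity, ?_, ?_⟩⟩
    · filter_upwards [h (H1.res (sc_pos j).le v)] with x hx
      rw [H1.res_fn] at hx
      refine hx.trans ?_
      gcongr
      exact H1.norm_res_le _ v
    · rw [mul_pow, mul_assoc, mul_comm (1 + (j : ℝ)), ← mul_assoc]
      refine le_mul_of_one_le_right (by positivity) ?_
      have : (0 : ℝ) ≤ j := Nat.cast_nonneg j
      linarith
  · obtain ⟨C, hC, h⟩ := exists_ae_norm_res_le (d := d) (Or.inr hd)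
    refine ⟨C ^ 2, by positivity, fun j v => ⟨C * √(1 + j) * ‖v‖, by positivity, h j v, ?_⟩⟩
    have hp : pw d = 2 := by rw [pw, hd]
    rw [hp, mul_pow, mul_pow, Real.sq_sqrt (by positivity)]

/-- The regularised function plays the role of the bounded one. The factor `1 + j` is the square of
the supremum bound `√(1 + j)` in dimension two; it is also harmless in dimension one. -/
theorem exists_norm_nl_sub_nl_res_le (hd : d = 1 ∨ d = 2) : ∃ C : ℝ, 0 ≤ C ∧
    ∀ (j : ℕ) (v : H1 d), ‖nl v - nl (H1.res (sc_pos j).le v)‖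
      ≤ C * (1 + j) * ‖v‖ ^ pw d * ‖v.fn - res (sc j) v.fn‖ := by
  obtain ⟨C₁, hC₁, h₁⟩ := exists_res_bound hd
  obtain ⟨C₂, hC₂, h₂⟩ := exists_norm_nl_sub_le_of_bounded hd
  refine ⟨C₂ * (C₁ + 2 ^ pw d), by positivity, fun j v => ?_⟩
  obtain ⟨B, hB0, hB, hBp⟩ := h₁ j v
  have h3 := h₂ v (H1.res (sc_pos j).le v) B hB
  rw [H1.res_fn] at h3
  refine h3.trans (mul_le_mul_of_nonneg_right ?_ (norm_nonneg _))
  have h4 : ‖v - H1.res (sc_pos j).le v‖ ^ pw d ≤ (2 * ‖v‖) ^ pw d := by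
    gcongr
    exact H1.norm_sub_res_le _ v
  have hj : (0 : ℝ) ≤ j := Nat.cast_nonneg j
  have h5 : (2 * ‖v‖) ^ pw d ≤ 2 ^ pw d * (1 + j) * ‖v‖ ^ pw d := by
    rw [mul_pow, mul_assoc, mul_comm (1 + (j : ℝ)), ← mul_assoc]
    exact le_mul_of_one_le_right (by positivity) (by linarith)
  calc C₂ * (B ^ pw d + ‖v - H1.res (sc_pos j).le v‖ ^ pw d)
      ≤ C₂ * (C₁ * (1 + j) * ‖v‖ ^ pw d + 2 ^ pw d * (1 + j) * ‖v‖ ^ pw d) := by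
        gcongr
        exact h4.trans h5
    _ = _ := by ring

/-! ### Regularised energy -/

theorem fmul_one_sub_rsym {s : ℝ} (hs : 0 ≤ s) (f : L2 d) :
    fmul (fun ξ => ((1 - rsym s ξ : ℝ) : ℂ)) f = f - res s f := by
  have h1 : MemLp (fun _ : Sp d => (1 : ℂ)) ∞ volume :=
    memLp_top_of_continuous (C := 1) continuous_const (by simp)
  have := fmul_sub h1 (memLp_rsym hs) f
  rw [fmul_const_one] at this
  rw [res, ← this]
  simp

theorem memLp_one_sub_rsym {s : ℝ} (hs : 0 ≤ s) :
    MemLp (fun ξ => ((1 - rsym s ξ : ℝ) : ℂ)) ∞ (volume : Measure (Sp d)) := by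
  have h1 : MemLp (fun _ : Sp d => (1 : ℂ)) ∞ volume :=
    memLp_top_of_continuous (C := 1) continuous_const (by simp)
  have h2 : MemLp (fun ξ => (1 : ℂ) - (rsym s ξ : ℂ)) ∞ (volume : Measure (Sp d)) :=
    h1.sub (memLp_rsym hs)
  simpa using h2

theorem H1.continuous_res {s : ℝ} (hs : 0 ≤ s) : Continuous (H1.res hs : H1 d → H1 d) := by
  have hsub : ∀ v w : H1 d, H1.res hs v - H1.res hs w = H1.res hs (v - w) := fun v w =>
    H1.ext_fn (by rw [H1.fn_sub, H1.res_fn, H1.res_fn, H1.res_fn, H1.fn_sub, map_sub])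
  refine LipschitzWith.continuous (K := 1) (LipschitzWith.of_dist_le_mul fun v w => ?_)
  rw [dist_eq_norm, dist_eq_norm, hsub, NNReal.coe_one, one_mul]
  exact H1.norm_res_le hs _

/-- The energy, regularised at scale `s`. -/
def regEnergy {s : ℝ} (hs : 0 ≤ s) (v : H1 d) : ℝ :=
  (s⁻¹ / 2) * (inner ℂ (v.fn - res s v.fn) v.fn).re - potential (H1.res hs v)

theorem continuous_regEnergy (hd : d = 1 ∨ d = 2) {s : ℝ} (hs : 0 ≤ s) :
    Continuous (regEnergy hs : H1 d → ℝ) := by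
  refine Continuous.sub (Continuous.mul continuous_const (Complex.continuous_re.comp
    (Continuous.inner (H1.continuous_fn.sub ((res s).continuous.comp H1.continuous_fn))
    H1.continuous_fn))) ((continuous_potential hd).comp (H1.continuous_res hs))

theorem tendsto_regEnergy (hd : d = 1 ∨ d = 2) (v : H1 d) :
    Tendsto (fun j => regEnergy (sc_pos j).le v) atTop (𝓝 (energy v)) := by
  rw [energy_eq hd]
  have hres : Tendsto (fun j => H1.res (sc_pos j).le v) atTop (𝓝 v) := by
    rw [tendsto_iff_norm_sub_tendsto_zero]
    have h1 : ∀ f : L2 d, Tendsto (fun j => ‖res (sc j) f - f‖ ^ 2) atTop (𝓝 0) := fun f => by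
      have := (tendsto_iff_norm_sub_tendsto_zero.1
        (tendsto_res (fun n => (sc_pos n).le) tendsto_sc f)).pow 2
      simpa using this
    have h2 : Tendsto (fun j => ‖H1.res (sc_pos j).le v - v‖ ^ 2) atTop (𝓝 0) := by
      simp_rw [H1.norm_sq, H1.fn_sub, H1.pd_sub, H1.res_fn, H1.res_pd]
      have := (h1 v.fn).add (tendsto_finsetSum Finset.univ fun j _ => h1 (v.pd j))
      simpa using this
    have := h2.sqrt
    simpa using this
  refine Tendsto.sub ?_ (((continuous_potential hd).tendsto v).comp hres)
  have h3 : ∀ j, (sc j)⁻¹ / 2 * (inner ℂ (v.fn - res (sc j) v.fn) v.fn).re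
      = 1 / 2 * ∑ k, (inner ℂ (res (sc j) (v.pd k)) (v.pd k)).re := fun j => by
    have := (sc_pos j).ne'
    rw [H1.inner_sub_res (sc_pos j).le, Complex.re_ofReal_mul, Complex.re_sum]
    field_simp
  simp_rw [h3]
  refine Tendsto.const_mul _ (tendsto_finsetSum _ fun k _ => ?_)
  have h4 := (tendsto_res (fun n => (sc_pos n).le) tendsto_sc (v.pd k)).inner (𝕜 := ℂ)
    (tendsto_const_nhds (x := v.pd k))
  have h5 := (Complex.continuous_re.tendsto _).comp h4
  rw [inner_self_eq_norm_sq_to_K] at h5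
  have h6 : ((((‖v.pd k‖ : ℝ) : ℂ)) ^ 2).re = ‖v.pd k‖ ^ 2 := by
    rw [← Complex.ofReal_pow, Complex.ofReal_re]
  exact h6 ▸ h5

theorem re_inner_comm (f g : L2 d) : (inner ℂ f g).re = (inner ℂ g f).re :=
  inner_re_symm (𝕜 := ℂ) f g

theorem im_inner_comm (f g : L2 d) : (inner ℂ f g).im = -(inner ℂ g f).im :=
  inner_im_symm (𝕜 := ℂ) f g

theorem re_inner_I_smul (f g : L2 d) :
    (inner ℂ f (Complex.I • g)).re = - (inner ℂ g (Complex.I • f)).re := by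
  rw [inner_smul_right, inner_smul_right]
  simp [im_inner_comm f g]

/-- The rate of change of the regularised energy, for the velocity
`i (s⁻¹ (Tv - v) + |v|^p v + L)` of `v`. -/
def energyRate {s : ℝ} (hs : 0 ≤ s) (v : H1 d) (g : L2 d) : ℝ :=
  s⁻¹ * (inner ℂ (v.fn - res s v.fn) (Complex.I • g)).re
    - (inner ℂ (nl (H1.res hs v))
      (-(Complex.I * (s⁻¹ : ℝ)) • (v.fn - res s v.fn) + Complex.I • res s g)).re

/-- All purely nonlinear contributions reduce to terms containing `δ = N(v) - N(Tv)`. The kinetic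
part produces `s⁻¹⟨(1-T)v, iN(v)⟩` and the potential part removes `s⁻¹⟨(1-T)v, iN(Tv)⟩`. The pairing
of `N(Tv)` with `iT N(v)` may be replaced by one with `δ`, since `Re⟨N(v), iT N(v)⟩` vanishes by
self-adjointness of `T`. -/
theorem energyRate_eq {s : ℝ} (hs : 0 ≤ s) (v : H1 d) (L : L2 d) :
    energyRate hs v (nl v + L)
      = s⁻¹ * (inner ℂ (v.fn - res s v.fn) (Complex.I • (nl v - nl (H1.res hs v)))).re
        + s⁻¹ * (inner ℂ (v.fn - res s v.fn) (Complex.I • L)).re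
        + (inner ℂ (nl v - nl (H1.res hs v)) (Complex.I • res s (nl v))).re
        + (inner ℂ (nl v - nl (H1.res hs v)) (Complex.I • res s L)).re
        - (inner ℂ (nl v) (Complex.I • res s L)).re := by
  have h0 : (inner ℂ (nl v) (Complex.I • res s (nl v))).re = 0 := by
    have h1 := re_inner_I_smul (nl v) (res s (nl v))
    rw [inner_smul_right, inner_smul_right, inner_res hs] at h1
    rw [inner_smul_right]
    linarith
  have h2 : (inner ℂ (nl (H1.res hs v)) (-(Complex.I * (s⁻¹ : ℝ)) • (v.fn - res s v.fn))).re
      = s⁻¹ * (inner ℂ (v.fn - res s v.fn) (Complex.I • nl (H1.res hs v))).re := by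
    rw [re_inner_I_smul (v.fn - res s v.fn), neg_smul, inner_neg_right, mul_comm, mul_smul,
      inner_smul_right, Complex.neg_re, Complex.re_ofReal_mul]
    ring
  rw [energyRate, inner_add_right (nl (H1.res hs v)), Complex.add_re, h2, map_add, smul_add,
    smul_add, smul_sub, inner_add_right, inner_add_right, inner_sub_right,
    inner_sub_left (nl v), inner_sub_left (nl v),
    Complex.add_re, Complex.add_re, Complex.sub_re, Complex.sub_re, Complex.sub_re, h0]
  ring

theorem abs_re_inner_I_le (f g : L2 d) : |(inner ℂ f (Complex.I • g)).re| ≤ ‖f‖ * ‖g‖ := by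
  refine (Complex.abs_re_le_norm _).trans ((norm_inner_le_norm _ _).trans (le_of_eq ?_))
  rw [norm_smul, Complex.norm_I, one_mul]

/-- The terms in `L` without `δ` give the true rate, where the hypothesis with the factor `s`
cancels `s⁻¹`. The error `s⁻¹‖(1-T)v‖ ‖δ‖` is borderline, a bounded quantity times `1 + j`, and is
kept in quadratic form so that it can be summed over scales; the other errors are `O((1+j)√s)`. -/
theorem exists_abs_energyRate_le (hd : d = 1 ∨ d = 2) : ∃ C : ℝ, 0 ≤ C ∧
    ∀ (j : ℕ) (v : H1 d) (L : L2 d) (K M : ℝ), ‖v‖ ≤ M → 0 ≤ K → ‖L‖ ≤ K * ‖v‖ →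
      |(inner ℂ (v.fn - res (sc j) v.fn) (Complex.I • L)).re| ≤ sc j * (K * ‖v‖ ^ 2) →
      |energyRate (sc_pos j).le v (nl v + L)| ≤ K * (‖v‖ ^ 2 + ‖nl v‖ * ‖v‖)
        + C * M ^ pw d * (1 + M ^ (pw d + 2) + K * M ^ 2)
          * ((1 + j) * ((sc j)⁻¹ * ‖v.fn - res (sc j) v.fn‖ ^ 2) + (1 + j) * √(sc j)) := by
  obtain ⟨C₁, hC₁, h₁⟩ := exists_norm_nl_sub_nl_res_le hd
  obtain ⟨C₂, hC₂, h₂⟩ := exists_norm_nl_le hd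
  refine ⟨C₁ * (1 + C₂), by positivity, fun j v L K M hM hK hL hL' => ?_⟩
  have hM0 : 0 ≤ M := (norm_nonneg _).trans hM
  have hs := sc_pos j
  set s := sc j
  set D := ‖v.fn - res s v.fn‖
  have hD : D ≤ √s * M := (H1.norm_sub_res_le_sqrt hs.le v).trans (by gcongr)
  set p := pw d
  set δ := nl v - nl (H1.res hs.le v)
  have hδ : ‖δ‖ ≤ C₁ * M ^ p * (1 + j) * D := by
    refine (h₁ j v).trans ?_
    calc C₁ * (1 + j) * ‖v‖ ^ p * D ≤ C₁ * (1 + j) * M ^ p * D := by gcongr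
      _ = _ := by ring
  have hδ' : ‖δ‖ ≤ C₁ * M ^ p * ((1 + j) * √s) * M :=
    hδ.trans (by
      calc C₁ * M ^ p * (1 + j) * D ≤ C₁ * M ^ p * (1 + j) * (√s * M) := by gcongr
        _ = _ := by ring)
  have hN : ‖nl v‖ ≤ C₂ * M ^ (p + 1) := by
    refine (h₂ v).trans ?_
    calc C₂ * ‖v‖ ^ p * ‖v.fn‖ ≤ C₂ * M ^ p * M := by
          gcongr
          exact (H1.norm_fn_le v).trans hM
      _ = _ := by ring
  have hLM : ‖L‖ ≤ K * M := hL.trans (by gcongr)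
  have hD0 : 0 ≤ D := norm_nonneg _
  have t1 : |s⁻¹ * (inner ℂ (v.fn - res s v.fn) (Complex.I • δ)).re|
      ≤ C₁ * M ^ p * ((1 + j) * (s⁻¹ * D ^ 2)) := by
    rw [abs_mul, abs_of_pos (inv_pos.2 hs)]
    calc _ ≤ s⁻¹ * (D * (C₁ * M ^ p * (1 + j) * D)) := by
          gcongr
          exact (abs_re_inner_I_le _ _).trans (by gcongr)
      _ = _ := by ring
  have t2 : |s⁻¹ * (inner ℂ (v.fn - res s v.fn) (Complex.I • L)).re| ≤ K * ‖v‖ ^ 2 := by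
    rw [abs_mul, abs_of_pos (inv_pos.2 hs)]
    calc _ ≤ s⁻¹ * (s * (K * ‖v‖ ^ 2)) := by gcongr
      _ = _ := by rw [← mul_assoc, inv_mul_cancel₀ hs.ne', one_mul]
  have t3 : |(inner ℂ δ (Complex.I • res s (nl v))).re|
      ≤ C₁ * M ^ p * ((1 + j) * √s) * M * (C₂ * M ^ (p + 1)) :=
    (abs_re_inner_I_le _ _).trans (mul_le_mul hδ' ((norm_res_le hs.le _).trans hN)
      (norm_nonneg _) (by positivity))
  have t4 : |(inner ℂ δ (Complex.I • res s L)).re|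
      ≤ C₁ * M ^ p * ((1 + j) * √s) * M * (K * M) :=
    (abs_re_inner_I_le _ _).trans (mul_le_mul hδ' ((norm_res_le hs.le _).trans hLM)
      (norm_nonneg _) (by positivity))
  have t5 : |(inner ℂ (nl v) (Complex.I • res s L)).re| ≤ ‖nl v‖ * (K * ‖v‖) :=
    (abs_re_inner_I_le _ _).trans (mul_le_mul_of_nonneg_left ((norm_res_le hs.le _).trans hL)
      (norm_nonneg _))
  rw [energyRate_eq]
  have tri : ∀ a b c e f : ℝ, |a + b + c + e - f| ≤ |a| + |b| + |c| + |e| + |f| :=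
    fun a b c e f => by
      refine (abs_sub _ _).trans (add_le_add_left ?_ _)
      refine (abs_add_le _ _).trans (add_le_add_left ?_ _)
      exact abs_add_three _ _ _
  refine (tri _ _ _ _ _).trans ((add_le_add (add_le_add (add_le_add (add_le_add t1 t2) t3) t4)
    t5).trans ?_)
  set X : ℝ := (1 + j) * (s⁻¹ * D ^ 2)
  set Y : ℝ := (1 + j) * √s
  have hX : 0 ≤ X := by positivity
  have hY : 0 ≤ Y := by positivity
  have hP : 0 ≤ C₁ * M ^ p := by positivity
  have e : C₁ * M ^ p * X + C₁ * M ^ p * Y * M * (C₂ * M ^ (p + 1)) + C₁ * M ^ p * Y * M * (K * M)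
      ≤ C₁ * (1 + C₂) * M ^ p * (1 + M ^ (p + 2) + K * M ^ 2) * (X + Y) := by
    have e1 : C₁ * M ^ p * X + C₁ * M ^ p * Y * M * (C₂ * M ^ (p + 1))
        + C₁ * M ^ p * Y * M * (K * M)
        = C₁ * M ^ p * (X + (C₂ * M ^ (p + 2) + K * M ^ 2) * Y) := by ring
    have e2 : C₁ * (1 + C₂) * M ^ p * (1 + M ^ (p + 2) + K * M ^ 2) * (X + Y)
        = C₁ * M ^ p * ((1 + C₂) * (1 + M ^ (p + 2) + K * M ^ 2) * (X + Y)) := by ring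
    rw [e1, e2]
    refine mul_le_mul_of_nonneg_left ?_ hP
    set Z := M ^ (p + 2)
    set W := K * M ^ 2
    have hZ : 0 ≤ Z := by positivity
    have hW : 0 ≤ W := by positivity
    have e3 : (1 + C₂) * (1 + Z + W) * (X + Y) - (X + (C₂ * Z + W) * Y)
        = (C₂ + (1 + C₂) * (Z + W)) * X + (1 + Z + C₂ + C₂ * W) * Y := by ring
    have e4 : 0 ≤ (C₂ + (1 + C₂) * (Z + W)) * X + (1 + Z + C₂ + C₂ * W) * Y := by positivity
    linarith
  linarith

/-- The flow of the equation, with lower order terms satisfying the bounds of `linOp`. -/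
structure IsPerturbedFlow (T K : ℝ) (u : ℝ → H1 d) (G : ℝ → L2 d) : Prop extends IsFlow T u G where
  K_nonneg : 0 ≤ K
  norm_le : ∀ t ∈ Icc 0 T, ‖G t - nl (u t)‖ ≤ K * ‖u t‖
  inner_le : ∀ t ∈ Icc 0 T, ∀ s > 0,
    |(inner ℂ ((u t).fn - res s (u t).fn) (Complex.I • (G t - nl (u t)))).re|
      ≤ s * (K * ‖u t‖ ^ 2)

/-! ### Integration in time and choice of good scales -/

theorem abs_sub_le_integral_of_abs_deriv_le {g g' φ : ℝ → ℝ} {t : ℝ} (ht : 0 ≤ t)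
    (hg : ContinuousOn g (Icc 0 t)) (hd : ∀ x ∈ Ioo 0 t, HasDerivAt g (g' x) x)
    (hφ : ContinuousOn φ (Icc 0 t)) (h : ∀ x ∈ Ioo 0 t, |g' x| ≤ φ x) :
    |g t - g 0| ≤ ∫ τ in (0 : ℝ)..t, φ τ := by
  rw [abs_le']
  constructor
  · exact intervalIntegral.sub_le_integral_of_hasDeriv_right_of_le ht hg
      (fun x hx => (hd x hx).hasDerivWithinAt) hφ.integrableOn_Icc
      fun x hx => (le_abs_self _).trans (h x hx)
  · have := intervalIntegral.sub_le_integral_of_hasDeriv_right_of_le ht hg.neg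
      (fun x hx => (hd x hx).neg.hasDerivWithinAt) hφ.integrableOn_Icc
      fun x hx => (neg_le_abs _).trans (h x hx)
    simp only [Pi.neg_apply] at this
    linarith

/-- Otherwise `a j` would eventually dominate a multiple of the harmonic series. This defeats the
logarithmic loss in the error of the energy. -/
theorem frequently_lt_of_sum_le {a : ℕ → ℝ} {S : ℝ} (ha : ∀ j, 0 ≤ a j)
    (hS : ∀ n, ∑ j ∈ Finset.range n, a j ≤ S) {ε : ℝ} (hε : 0 < ε) :
    ∃ᶠ j : ℕ in atTop, (1 + j) * a j < ε := by
  intro hcon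
  have hsum : Summable a := summable_of_sum_range_le ha hS
  simp only [not_lt] at hcon
  obtain ⟨N, hN⟩ := eventually_atTop.1 hcon
  have h1 : Summable fun j : ℕ => a (j + N) := (summable_nat_add_iff N).2 hsum
  have h2 : Summable fun j : ℕ => ε * (1 / ((j + (N + 1) : ℕ) : ℝ)) := by
    refine Summable.of_nonneg_of_le (fun j => by positivity) (fun j => ?_) h1
    have h3 := hN (j + N) (by omega)
    have h4 : (0 : ℝ) < ((j + (N + 1) : ℕ) : ℝ) := by positivity
    rw [mul_one_div, div_le_iff₀ h4]
    push_cast at h3 ⊢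
    linarith
  have h3 := (summable_mul_left_iff hε.ne').1 h2
  exact Real.not_summable_one_div_natCast ((summable_nat_add_iff (N + 1)).1 h3)

/-- The ratio `4` between consecutive scales matches `H1.norm_sub_res_sq_le`, so the sum telescopes
to the Dirichlet form of `v` at the finest scale. -/
theorem sum_inv_mul_norm_sub_res_sq_le (v : H1 d) (n : ℕ) :
    ∑ j ∈ Finset.range n, (sc j)⁻¹ * ‖v.fn - res (sc j) v.fn‖ ^ 2 ≤ 4 / 3 * ‖v‖ ^ 2 := by
  have h1 : ∀ j, (sc j)⁻¹ * ‖v.fn - res (sc j) v.fn‖ ^ 2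
      ≤ 4 / 3 * (H1.resEnergy (sc (j + 1)) v - H1.resEnergy (sc j) v) := fun j => by
    have h := H1.norm_sub_res_sq_le (sc_pos j) v
    rw [← sc_succ] at h
    rw [inv_mul_le_iff₀ (sc_pos j)]
    linarith
  refine (Finset.sum_le_sum fun j _ => h1 j).trans ?_
  rw [← Finset.mul_sum, Finset.sum_range_sub fun j => H1.resEnergy (sc j) v]
  have h2 := H1.resEnergy_le (sc_pos n).le v
  have h3 := H1.sum_norm_pd_sq_le v
  have h4 := H1.resEnergy_nonneg (sc_pos 0).le v
  linarith

theorem tendsto_one_add_mul_sqrt_sc : Tendsto (fun j : ℕ => (1 + (j : ℝ)) * √(sc j)) atTop (𝓝 0) := by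
  have e : ∀ j : ℕ, √(sc j) = (1 / 2 : ℝ) ^ j := fun j => by
    rw [sc, show (1 / 4 : ℝ) = (1 / 2) ^ 2 by norm_num, ← pow_mul, mul_comm, pow_mul,
      Real.sqrt_sq (by positivity)]
  simp_rw [e, add_mul, one_mul]
  have := (tendsto_pow_atTop_nhds_zero_of_lt_one (r := (1 / 2 : ℝ)) (by norm_num)
    (by norm_num)).add (tendsto_self_mul_const_pow_of_lt_one (r := (1 / 2 : ℝ)) (by norm_num)
    (by norm_num))
  simpa using this

namespace IsPerturbedFlow

variable {T K : ℝ} {u : ℝ → H1 d} {G : ℝ → L2 d}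

theorem exists_norm_le (h : IsPerturbedFlow T K u G) : ∃ M : ℝ, 0 ≤ M ∧ ∀ t ∈ Icc 0 T, ‖u t‖ ≤ M := by
  obtain ⟨M, hM⟩ := isCompact_Icc.exists_bound_of_continuousOn h.cont
  exact ⟨max M 0, le_max_right _ _, fun t ht => (hM t ht).trans (le_max_left _ _)⟩

theorem hasDerivAt_regEnergy (hd : d = 1 ∨ d = 2) (h : IsPerturbedFlow T K u G) (j : ℕ) {t : ℝ}
    (ht : t ∈ Ioo 0 T) :
    HasDerivAt (fun t => regEnergy (sc_pos j).le (u t)) (energyRate (sc_pos j).le (u t) (G t)) t := by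
  have h1 := h.hasDerivAt_inner_fmul (memLp_one_sub_rsym (sc_pos j).le) ht
  simp_rw [fmul_one_sub_rsym (sc_pos j).le] at h1
  obtain ⟨C, hC, hb⟩ := exists_ae_norm_res_le hd
  obtain ⟨M, hM0, hM⟩ := h.exists_norm_le
  have h2 := hasDerivAt_potential hd (w := fun t => H1.res (sc_pos j).le (u t))
    (h.hasDerivAt_res (sc_pos j) ht) (B := C * √(1 + j) * M) (by
      filter_upwards [Icc_mem_nhds ht.1 ht.2] with τ hτ
      filter_upwards [hb j (u τ)] with x hx
      refine hx.trans ?_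
      have := hM τ hτ
      gcongr)
  refine ((h1.const_mul ((sc j)⁻¹ / 2)).sub h2).congr_deriv ?_
  rw [energyRate]
  ring

/-- The energy estimate. -/
theorem abs_energy_sub_le (hd : d = 1 ∨ d = 2) (h : IsPerturbedFlow T K u G) {t : ℝ}
    (ht : t ∈ Icc 0 T) :
    |energy (u t) - energy (u 0)|
      ≤ ∫ τ in (0 : ℝ)..t, K * (‖u τ‖ ^ 2 + ‖nl (u τ)‖ * ‖u τ‖) := by
  obtain ⟨C, hC, hrate⟩ := exists_abs_energyRate_le hd
  obtain ⟨M, hM0, hM⟩ := h.exists_norm_le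
  have hK := h.K_nonneg
  have hut : ContinuousOn u (Icc 0 t) := h.cont.mono (Icc_subset_Icc_right ht.2)
  set A : ℝ := C * M ^ pw d * (1 + M ^ (pw d + 2) + K * M ^ 2)
  have hA : 0 ≤ A := by positivity
  set φ : ℝ → ℝ := fun τ => K * (‖u τ‖ ^ 2 + ‖nl (u τ)‖ * ‖u τ‖)
  set ψ : ℕ → ℝ → ℝ := fun j τ => (sc j)⁻¹ * ‖(u τ).fn - res (sc j) (u τ).fn‖ ^ 2
  have hφ : ContinuousOn φ (Icc 0 t) :=
    ((hut.norm.pow 2).add (((continuous_nl hd).comp_continuousOn hut).norm.mul hut.norm)).const_smul K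
  have hufn : ContinuousOn (fun τ => (u τ).fn) (Icc 0 t) := H1.continuous_fn.comp_continuousOn hut
  have hψ : ∀ j, ContinuousOn (ψ j) (Icc 0 t) := fun j =>
    ((hufn.sub ((res (sc j)).continuous.comp_continuousOn hufn)).norm.pow 2).const_smul (sc j)⁻¹
  have hint : ∀ {f : ℝ → ℝ}, ContinuousOn f (Icc 0 t) → IntervalIntegrable f volume 0 t :=
    fun hf => (hf.mono (by rw [uIcc_of_le ht.1])).intervalIntegrable
  set a : ℕ → ℝ := fun j => ∫ τ in (0 : ℝ)..t, ψ j τ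
  have hψ0 : ∀ j τ, 0 ≤ ψ j τ := fun j τ => by
    have := sc_pos j
    positivity
  have ha0 : ∀ j, 0 ≤ a j := fun j => intervalIntegral.integral_nonneg ht.1 fun τ _ => hψ0 j τ
  -- The pointwise-in-time summability over scales is integrated, so that one scale can be chosen
  -- for the whole time interval rather than for each time separately.
  have haS : ∀ n, ∑ j ∈ Finset.range n, a j ≤ t * (4 / 3 * M ^ 2) := fun n => by
    simp only [a]
    rw [← intervalIntegral.integral_finsetSum fun j _ => hint (hψ j)]
    have : ∫ _τ in (0 : ℝ)..t, (4 / 3 * M ^ 2) = t * (4 / 3 * M ^ 2) := by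
      rw [intervalIntegral.integral_const, sub_zero, smul_eq_mul]
    rw [← this]
    refine intervalIntegral.integral_mono_on ht.1
      (hint (continuousOn_finsetSum _ fun j _ => hψ j)) (by simp) fun τ hτ => ?_
    refine (sum_inv_mul_norm_sub_res_sq_le (u τ) n).trans ?_
    have := hM τ ⟨hτ.1, hτ.2.trans ht.2⟩
    gcongr
  have hstep : ∀ j, |regEnergy (sc_pos j).le (u t) - regEnergy (sc_pos j).le (u 0)|
      ≤ (∫ τ in (0 : ℝ)..t, φ τ) + A * ((1 + j) * a j + t * ((1 + j) * √(sc j))) := fun j => by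
    have h1 := abs_sub_le_integral_of_abs_deriv_le ht.1
      (g := fun t => regEnergy (sc_pos j).le (u t))
      (φ := fun τ => φ τ + A * ((1 + j) * ψ j τ + (1 + j) * √(sc j)))
      ((continuous_regEnergy hd (sc_pos j).le).comp_continuousOn hut)
      (fun x hx => h.hasDerivAt_regEnergy hd j ⟨hx.1, hx.2.trans_le ht.2⟩)
      (hφ.add ((((hψ j).const_smul (1 + (j : ℝ))).add continuousOn_const).const_smul A))
      (fun x hx => by
        have hx' : x ∈ Icc 0 T := ⟨hx.1.le, hx.2.le.trans ht.2⟩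
        have h3 := hrate j (u x) (G x - nl (u x)) K M (hM x hx') hK (h.norm_le x hx')
          (h.inner_le x hx' (sc j) (sc_pos j))
        rwa [add_sub_cancel] at h3)
    refine h1.trans (le_of_eq ?_)
    have i1 : IntervalIntegrable (fun τ => (1 + (j : ℝ)) * ψ j τ) volume 0 t :=
      (hint (hψ j)).const_mul _
    have i2 : IntervalIntegrable (fun _ : ℝ => (1 + (j : ℝ)) * √(sc j)) volume 0 t := by simp
    rw [intervalIntegral.integral_add (hint hφ) ((i1.add i2).const_mul A)]
    congr 1
    rw [intervalIntegral.integral_const_mul, intervalIntegral.integral_add i1 i2,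
      intervalIntegral.integral_const_mul, intervalIntegral.integral_const, sub_zero, smul_eq_mul]
  refine le_of_forall_pos_le_add fun ε hε => ?_
  have hlim : Tendsto (fun j => |regEnergy (sc_pos j).le (u t) - regEnergy (sc_pos j).le (u 0)|)
      atTop (𝓝 |energy (u t) - energy (u 0)|) :=
    ((tendsto_regEnergy hd (u t)).sub (tendsto_regEnergy hd (u 0))).abs
  set η : ℝ := ε / (3 * (A + 1))
  have hη : 0 < η := by positivity
  have hAη : A * η ≤ ε / 3 := by
    have : A * η = ε / 3 * (A / (A + 1)) := by simp only [η]; field_simp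
    rw [this]
    refine mul_le_of_le_one_right (by positivity) ?_
    rw [div_le_one (by positivity)]; linarith
  have ev1 := hlim.eventually (lt_mem_nhds (show |energy (u t) - energy (u 0)| - ε / 3
    < |energy (u t) - energy (u 0)| by linarith))
  have ev2 := (tendsto_one_add_mul_sqrt_sc.const_mul t).eventually
    (gt_mem_nhds (show t * 0 < η by rw [mul_zero]; exact hη))
  -- The good scales occur infinitely often, while convergence of the regularised energies and
  -- smallness of `(1+j)√s` hold for all large `j`; some `j` has all three properties.
  obtain ⟨j, hj1, hj2, hj3⟩ := ((frequently_lt_of_sum_le ha0 haS hη).and_eventually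
    (ev1.and ev2)).exists
  have h4 := hstep j
  have h5 : A * ((1 + j) * a j + t * ((1 + j) * √(sc j))) ≤ A * (η + η) := by gcongr
  linarith

end IsPerturbedFlow

/-! ### Momentum -/

/-- The real symbol of `-i ∂ₖ (1 - sΔ)⁻¹`. -/
def momSymbol (s : ℝ) (k : Fin d) (ξ : Sp d) : ℝ := 2 * Real.pi * ξ k * rsym s ξ

theorem momSymbol_eq (s : ℝ) (k : Fin d) (ξ : Sp d) :
    (momSymbol s k ξ : ℂ) = -Complex.I * (dsym k ξ * (rsym s ξ : ℂ)) := by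
  rw [momSymbol, dsym]
  push_cast
  linear_combination (2 * Real.pi * (ξ k : ℂ) * (rsym s ξ : ℂ)) * Complex.I_mul_I

theorem memLp_momSymbol {s : ℝ} (hs : 0 < s) (k : Fin d) :
    MemLp (fun ξ => (momSymbol s k ξ : ℂ)) ∞ (volume : Measure (Sp d)) := by
  simp_rw [momSymbol_eq]
  exact (memLp_dsym_mul_rsym hs k).const_mul _

theorem fmul_momSymbol {s : ℝ} (hs : 0 < s) (k : Fin d) (v : H1 d) :
    fmul (fun ξ => (momSymbol s k ξ : ℂ)) v.fn = -Complex.I • res s (v.pd k) := by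
  simp_rw [momSymbol_eq]
  rw [fmul_const_mul (memLp_dsym_mul_rsym hs k)]
  congr 1
  apply fourier_injective
  rw [fourier_fmul]
  refine Lp.ext ?_
  filter_upwards [mulOp_coeFn (memLp_dsym_mul_rsym hs k) (𝓕 v.fn), fourier_res hs.le (v.pd k),
    H1.fourier_pd v k] with ξ h1 h2 h3
  rw [h1, h2, h3]
  ring

theorem re_inner_neg_I_smul (f g : L2 d) :
    (inner ℂ (-Complex.I • f) g).re = (inner ℂ g f).im := by
  rw [inner_smul_left, im_inner_comm g f]
  simp

namespace IsPerturbedFlow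

variable {T K : ℝ} {u : ℝ → H1 d} {G : ℝ → L2 d}

/-- The momentum estimate. -/
theorem abs_momentum_sub_le (hd : d = 1 ∨ d = 2) (h : IsPerturbedFlow T K u G) {t : ℝ}
    (ht : t ∈ Icc 0 T) (k : Fin d) :
    |momentum (u t) k - momentum (u 0) k| ≤ ∫ τ in (0 : ℝ)..t, 2 * K * ‖u τ‖ ^ 2 := by
  obtain ⟨C₁, hC₁, h₁⟩ := exists_norm_nl_sub_nl_res_le hd
  obtain ⟨M, hM0, hM⟩ := h.exists_norm_le
  have hK := h.K_nonneg
  have hut : ContinuousOn u (Icc 0 t) := h.cont.mono (Icc_subset_Icc_right ht.2)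
  -- The regularised momentum is the quadratic form of the bounded real multiplier `momSymbol`,
  -- hence differentiable along the flow.
  set g : ℕ → ℝ → ℝ := fun j τ => (inner ℂ (u τ).fn (res (sc j) ((u τ).pd k))).im
  have hder : ∀ j, ∀ x ∈ Ioo 0 t,
      HasDerivAt (g j) (-2 * (inner ℂ (res (sc j) ((u x).pd k)) (G x)).re) x := fun j x hx => by
    have h1 := h.hasDerivAt_inner_fmul (memLp_momSymbol (sc_pos j) k)
      (t := x) ⟨hx.1, hx.2.trans_le ht.2⟩
    simp_rw [fmul_momSymbol (sc_pos j), re_inner_neg_I_smul] at h1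
    refine h1.congr_deriv ?_
    rw [inner_smul_left, re_inner_comm _ (G x)]
    simp
  have hbd : ∀ j, ∀ x ∈ Ioo 0 t, |-2 * (inner ℂ (res (sc j) ((u x).pd k)) (G x)).re|
      ≤ 2 * K * ‖u x‖ ^ 2 + 2 * (M * (C₁ * M ^ pw d * M)) * ((1 + j) * √(sc j)) := fun j x hx => by
    have hx' : x ∈ Icc 0 T := ⟨hx.1.le, hx.2.le.trans ht.2⟩
    have hux := hM x hx'
    have hr : ‖res (sc j) ((u x).pd k)‖ ≤ ‖u x‖ :=
      (norm_res_le (sc_pos j).le _).trans (H1.norm_pd_le _ k)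
    -- The last term cancels exactly against `T∂ₖu = ∂ₖ(Tu)`. The first is multiplied by no negative
    -- power of `s`, so it tends to zero along every sequence of scales.
    have e1 : G x = (nl (u x) - nl (H1.res (sc_pos j).le (u x))) + (G x - nl (u x))
        + nl (H1.res (sc_pos j).le (u x)) := by abel
    have e2 := inner_pd_nl hd (H1.res (sc_pos j).le (u x)) k
    rw [H1.res_pd] at e2
    rw [e1, inner_add_right, inner_add_right, Complex.add_re, Complex.add_re, e2, add_zero, abs_mul]
    have b1 : |(inner ℂ (res (sc j) ((u x).pd k))
        (nl (u x) - nl (H1.res (sc_pos j).le (u x)))).re|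
        ≤ M * (C₁ * M ^ pw d * M) * ((1 + j) * √(sc j)) := by
      refine (Complex.abs_re_le_norm _).trans ((norm_inner_le_norm _ _).trans ?_)
      have h3 := h₁ j (u x)
      have h4 := H1.norm_sub_res_le_sqrt (sc_pos j).le (u x)
      calc _ ≤ M * (C₁ * (1 + j) * M ^ pw d * (√(sc j) * M)) := by
            gcongr
            · exact hr.trans hux
            · refine h3.trans ?_
              gcongr
              exact h4.trans (by gcongr)
        _ = _ := by ring
    have b2 : |(inner ℂ (res (sc j) ((u x).pd k)) (G x - nl (u x))).re| ≤ K * ‖u x‖ ^ 2 := by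
      refine (Complex.abs_re_le_norm _).trans ((norm_inner_le_norm _ _).trans ?_)
      calc _ ≤ ‖u x‖ * (K * ‖u x‖) := by
            gcongr
            exact h.norm_le x hx'
        _ = _ := by ring
    have b3 := abs_add_le (inner ℂ (res (sc j) ((u x).pd k))
        (nl (u x) - nl (H1.res (sc_pos j).le (u x)))).re
        (inner ℂ (res (sc j) ((u x).pd k)) (G x - nl (u x))).re
    rw [abs_neg, abs_two]
    linarith
  have hc : ContinuousOn (fun τ => 2 * K * ‖u τ‖ ^ 2) (Icc 0 t) := (hut.norm.pow 2).const_smul (2 * K)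
  have hg : ∀ j, ContinuousOn (g j) (Icc 0 t) := fun j =>
    Complex.continuous_im.comp_continuousOn ((H1.continuous_fn.comp_continuousOn hut).inner
      ((res (sc j)).continuous.comp_continuousOn ((H1.continuous_pd k).comp_continuousOn hut)))
  have hstep : ∀ j, |g j t - g j 0| ≤ (∫ τ in (0 : ℝ)..t, 2 * K * ‖u τ‖ ^ 2)
      + t * (2 * (M * (C₁ * M ^ pw d * M)) * ((1 + j) * √(sc j))) := fun j => by
    have h1 := abs_sub_le_integral_of_abs_deriv_le ht.1 (hg j) (hder j)
      (hc.add (continuousOn_const (c := 2 * (M * (C₁ * M ^ pw d * M)) * ((1 + j) * √(sc j)))))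
      (hbd j)
    refine h1.trans (le_of_eq ?_)
    simp only [Pi.add_apply]
    rw [intervalIntegral.integral_add (hc.mono (by rw [uIcc_of_le ht.1])).intervalIntegrable
      (by simp), intervalIntegral.integral_const]
    simp
  have hlim : ∀ τ, Tendsto (fun j => g j τ) atTop (𝓝 (momentum (u τ) k)) := fun τ => by
    rw [momentum_apply]
    exact (Complex.continuous_im.tendsto _).comp ((tendsto_const_nhds (x := (u τ).fn)).inner
      (tendsto_res (fun n => (sc_pos n).le) tendsto_sc ((u τ).pd k)))
  have hl1 := ((hlim t).sub (hlim 0)).abs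
  have hl2 : Tendsto (fun j : ℕ => (∫ τ in (0 : ℝ)..t, 2 * K * ‖u τ‖ ^ 2)
      + t * (2 * (M * (C₁ * M ^ pw d * M)) * ((1 + j) * √(sc j)))) atTop
      (𝓝 ((∫ τ in (0 : ℝ)..t, 2 * K * ‖u τ‖ ^ 2)
      + t * (2 * (M * (C₁ * M ^ pw d * M)) * 0))) :=
    ((tendsto_one_add_mul_sqrt_sc.const_mul _).const_mul t).const_add _
  have := le_of_tendsto_of_tendsto' hl1 hl2 hstep
  simpa using this

end IsPerturbedFlow

section

/-! ### From the equation to perturbed flows -/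

theorem norm_le_of_normM_le {F : Type*} [NormedAddCommGroup F] [NormedSpace ℝ F] {f : Sp d → F}
    {K : ℝ} (h : normM f ≤ ENNReal.ofReal K) (hK : 0 ≤ K) (x : Sp d) : ‖f x‖ ≤ K := by
  have h1 : ‖f x‖ₑ ≤ normM f := by
    unfold normM
    refine le_trans ?_ (le_iSup₂ (α := ℝ≥0∞) (0 : Fin d → ℕ) (by simp))
    refine le_trans ?_ (le_iSup₂ (α := ℝ≥0∞) 0 (by simp))
    refine le_trans ?_ (le_iSup₂ (α := ℝ≥0∞) Fin.elim0 x)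
    simp
  have h2 := h1.trans h
  rw [← ofReal_norm, ENNReal.ofReal_le_ofReal_iff hK] at h2
  exact h2

theorem norm_fderiv_le_of_normM_le {F : Type*} [NormedAddCommGroup F] [NormedSpace ℝ F]
    {f : Sp d → F} {K : ℝ} (h : normM f ≤ ENNReal.ofReal K) (hK : 0 ≤ K) (j : Fin d) (x : Sp d) :
    ‖fderiv ℝ f x (stdVec j)‖ ≤ K := by
  have h1 : ‖fderiv ℝ f x (stdVec j)‖ₑ ≤ normM f := by
    unfold normM
    refine le_trans ?_ (le_iSup₂ (α := ℝ≥0∞) (0 : Fin d → ℕ) (by simp))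
    refine le_trans ?_ (le_iSup₂ (α := ℝ≥0∞) 1 (by simp))
    refine le_trans ?_ (le_iSup₂ (α := ℝ≥0∞) (fun _ => j) x)
    simp [iteratedFDeriv_one_apply]
  have h2 := h1.trans h
  rw [← ofReal_norm, ENNReal.ofReal_le_ofReal_iff hK] at h2
  exact h2

theorem hasTemperateGrowth_ofReal_comp {f : Sp d → ℝ} (hf : f.HasTemperateGrowth) :
    (fun x => (f x : ℂ)).HasTemperateGrowth := by
  fun_prop

variable {N : ℕ} {φ : Fin N → 𝓢(Sp d, ℝ)} {B : Fin N → ℝ → ℝ}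

theorem hasTemperateGrowth_coeffBeta (j : Fin d) (t : ℝ) :
    (coeffBeta φ B j t).HasTemperateGrowth := by
  unfold coeffBeta
  have : ∀ k, (⇑(∂_{(stdVec j : Sp d)} (φ k) : 𝓢(Sp d, ℝ))).HasTemperateGrowth := fun k =>
    SchwartzMap.hasTemperateGrowth _
  fun_prop

theorem hasTemperateGrowth_coeffC (t : ℝ) : (coeffC φ B t).HasTemperateGrowth := by
  unfold coeffC
  have h1 : ∀ (j : Fin d) k, (⇑(∂_{(stdVec j : Sp d)} (φ k) : 𝓢(Sp d, ℝ))).HasTemperateGrowth :=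
    fun j k => SchwartzMap.hasTemperateGrowth _
  have h2 : ∀ k, (⇑(Δ (φ k) : 𝓢(Sp d, ℝ))).HasTemperateGrowth := fun k =>
    SchwartzMap.hasTemperateGrowth _
  fun_prop


theorem isCoeff_coeffBeta {K : ℝ} (hK : 0 ≤ K) (h : CoeffBound φ B K) {t : ℝ}
    (ht : t ∈ Icc (0 : ℝ) 1) (j : Fin d) : IsCoeff K (fun x => (coeffBeta φ B j t x : ℂ)) := by
  have hj : normM (coeffBeta φ B j t) ≤ ENNReal.ofReal K :=
    ((Finset.single_le_sum (f := fun j => normM (coeffBeta φ B j t)) (fun _ _ => zero_le)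
      (Finset.mem_univ j)).trans le_self_add).trans (h t ht)
  have hg : (coeffBeta φ B j t).HasTemperateGrowth := hasTemperateGrowth_coeffBeta j t
  refine ⟨hasTemperateGrowth_ofReal_comp hg, fun x => ?_, fun k x => ?_⟩
  · rw [Complex.norm_real]
    exact norm_le_of_normM_le hj hK x
  · have h1 : HasFDerivAt (fun x => (coeffBeta φ B j t x : ℂ))
        (Complex.ofRealCLM.comp (fderiv ℝ (coeffBeta φ B j t) x)) x :=
      Complex.ofRealCLM.hasFDerivAt.comp x ((hg.1.differentiable (by simp)) x).hasFDerivAt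
    rw [h1.fderiv, ContinuousLinearMap.comp_apply, Complex.ofRealCLM_apply, Complex.norm_real]
    exact norm_fderiv_le_of_normM_le hj hK k x

theorem isCoeff_coeffC {K : ℝ} (hK : 0 ≤ K) (h : CoeffBound φ B K) {t : ℝ}
    (ht : t ∈ Icc (0 : ℝ) 1) : IsCoeff K (coeffC φ B t) := by
  have hj : normM (coeffC φ B t) ≤ ENNReal.ofReal K := le_add_self.trans (h t ht)
  exact ⟨hasTemperateGrowth_coeffC t, norm_le_of_normM_le hj hK, norm_fderiv_le_of_normM_le hj hK⟩

/-- Pointwise continuity in time with a uniform bound gives strong continuity of the multiplication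
operators. Clamping time to `[0, 1]` makes the bound valid for every index of the filter. -/
theorem continuousOn_mulOp {K : ℝ} {m : ℝ → Sp d → ℂ} {S : Set ℝ} {f : ℝ → L2 d}
    (hS : S ⊆ Icc 0 1) (hm : ∀ t ∈ Icc (0 : ℝ) 1, IsCoeff K (m t))
    (hc : ∀ x, ContinuousOn (fun t => m t x) (Icc 0 1)) (hf : ContinuousOn f S) :
    ContinuousOn (fun t => mulOp (m t) (f t)) S := by
  have hcl : ∀ t : ℝ, ((projIcc 0 1 zero_le_one t : Icc (0 : ℝ) 1) : ℝ) ∈ Icc (0 : ℝ) 1 :=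
    fun t => Subtype.coe_prop _
  set m' : ℝ → Sp d → ℂ := fun t => m (projIcc 0 1 zero_le_one t)
  have hm' : ∀ t ∈ S, m' t = m t := fun t ht => by
    simp only [m', projIcc_of_mem zero_le_one (hS ht)]
  have hcont : ∀ x, Continuous fun t => m' t x := fun x =>
    (hc x).comp_continuous (continuous_subtype_val.comp continuous_projIcc) hcl
  have hK : 0 ≤ K := (hm 0 (by simp)).nonneg
  have h1 : ContinuousOn (fun t => mulOp (m' t) (f t)) S := fun t ht =>
    tendsto_clm_apply_of_bound (fun i x => norm_mulOp_le hK (hm _ (hcl i)).bound x) (hf t ht)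
      (tendsto_mulOp (C := K + K) (fun i => (hm _ (hcl i)).memLp) (hm _ (hcl t)).memLp
        (Eventually.of_forall fun i x => (norm_sub_le _ _).trans
          (add_le_add ((hm _ (hcl i)).bound x) ((hm _ (hcl t)).bound x)))
        (Eventually.of_forall fun x => ((hcont x).tendsto t).mono_left nhdsWithin_le_nhds) _)
  exact h1.congr fun t ht => by simp only [hm' t ht]

theorem continuousOn_coeffBeta (hB : ∀ k, ContinuousOn (B k) (Ici 0)) (j : Fin d) (x : Sp d) :
    ContinuousOn (fun t => (coeffBeta φ B j t x : ℂ)) (Icc 0 1) := by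
  have hB' : ∀ k, ContinuousOn (B k) (Icc 0 1) := fun k => (hB k).mono Icc_subset_Ici_self
  unfold coeffBeta
  fun_prop

theorem continuousOn_coeffC (hB : ∀ k, ContinuousOn (B k) (Ici 0)) (x : Sp d) :
    ContinuousOn (fun t => coeffC φ B t x) (Icc 0 1) := by
  have hB' : ∀ k, ContinuousOn (B k) (Icc 0 1) := fun k => (hB k).mono Icc_subset_Ici_self
  unfold coeffC
  fun_prop

theorem linOp_coeFn {K : ℝ} {β : Fin d → Sp d → ℝ} {c : Sp d → ℂ}
    (hβ : ∀ j, IsCoeff K (fun x => (β j x : ℂ))) (hc : IsCoeff K c) (v : H1 d) :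
    linOp β c v =ᵐ[volume] fun x =>
      (∑ j, Complex.I * (β j x : ℂ) * v.pd j x) + c x * v.fn x := by
  have h1 : ∀ᵐ x, ∀ j, mulOp (fun x => (β j x : ℂ)) (v.pd j) x = (β j x : ℂ) * v.pd j x :=
    ae_all_iff.2 fun j => mulOp_coeFn (hβ j).memLp _
  have h3 : ∀ᵐ x, ∀ j, (Complex.I • mulOp (fun x => (β j x : ℂ)) (v.pd j) : L2 d) x
      = Complex.I • mulOp (fun x => (β j x : ℂ)) (v.pd j) x :=
    ae_all_iff.2 fun j => Lp.coeFn_smul _ _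
  have h4 := Lp.coeFn_finsetSum Finset.univ
    (fun j => (Complex.I • mulOp (fun x => (β j x : ℂ)) (v.pd j) : L2 d))
  unfold linOp
  filter_upwards [h1, mulOp_coeFn hc.memLp v.fn, h3, h4, Lp.coeFn_add
    (∑ j, Complex.I • mulOp (fun x => (β j x : ℂ)) (v.pd j)) (mulOp c v.fn)] with x h1 h2 h3 h4 h5
  rw [h5, Pi.add_apply, h2, h4, Finset.sum_apply]
  congr 1
  refine Finset.sum_congr rfl fun j _ => ?_
  rw [h3, h1, smul_eq_mul, mul_assoc]

/-- The constant in the estimates of the lower order terms. -/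
def linConst (d : ℕ) : ℝ := d * (2 * d + 3) + (d + 1)

theorem IsMildSolution.exists_isPerturbedFlow (hd : d = 1 ∨ d = 2) {K T : ℝ} {u : ℝ → H1 d}
    (hK : 0 ≤ K) (hB : ∀ k, ContinuousOn (B k) (Ici 0)) (hφ : CoeffBound φ B K) (hT : T ≤ 1)
    (h : IsMildSolution φ B T u) : ∃ G, IsPerturbedFlow T (linConst d * K) u G := by
  obtain ⟨hu, G, -, hG, hduh⟩ := h
  have hS : Icc 0 T ⊆ Icc (0 : ℝ) 1 := Icc_subset_Icc_right hT
  have hβ : ∀ t ∈ Icc (0 : ℝ) 1, ∀ j, IsCoeff K (fun x => (coeffBeta φ B j t x : ℂ)) :=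
    fun t ht j => isCoeff_coeffBeta hK hφ ht j
  have hc : ∀ t ∈ Icc (0 : ℝ) 1, IsCoeff K (coeffC φ B t) := fun t ht => isCoeff_coeffC hK hφ ht
  -- The forcing in a mild solution is only assumed integrable; identifying it with explicit terms
  -- makes it continuous in `L²`, as needed to differentiate the Duhamel integral.
  have hGeq : ∀ t ∈ Icc 0 T,
      G t = nl (u t) + linOp (fun j => coeffBeta φ B j t) (coeffC φ B t) (u t) := fun t ht => by
    refine Lp.ext ?_
    filter_upwards [hG t ht, nl_coeFn hd (u t), linOp_coeFn (hβ t (hS ht)) (hc t (hS ht))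
      (u t), Lp.coeFn_add (nl (u t)) (linOp (fun j => coeffBeta φ B j t) (coeffC φ B t) (u t))]
      with x h1 h2 h3 h4
    rw [h1, h4, Pi.add_apply, h2, h3, nlf, pw_cast hd, Real.rpow_natCast]
    ring
  have hlin : ContinuousOn
      (fun t => linOp (fun j => coeffBeta φ B j t) (coeffC φ B t) (u t)) (Icc 0 T) := by
    unfold linOp
    refine ContinuousOn.add (continuousOn_finsetSum _ fun j _ => ?_) ?_
    · exact (continuousOn_mulOp hS (fun t ht => hβ t ht j) (continuousOn_coeffBeta hB j)
        ((H1.continuous_pd j).comp_continuousOn hu)).const_smul Complex.I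
    · exact continuousOn_mulOp hS hc (continuousOn_coeffC hB)
        (H1.continuous_fn.comp_continuousOn hu)
  have hd1 : (d * (2 * d + 3) : ℝ) ≤ linConst d := by unfold linConst; linarith
  have hd2 : (d + 1 : ℝ) ≤ linConst d := by
    have : (0 : ℝ) ≤ d * (2 * d + 3) := by positivity
    unfold linConst; linarith
  have hd3 : 0 ≤ linConst d := by unfold linConst; positivity
  refine ⟨G, ⟨⟨hu, ?_, fun t ht => ?_⟩, ?_, fun t ht => ?_, fun t ht s hs => ?_⟩⟩
  · exact (((continuous_nl hd).comp_continuousOn hu).add hlin).congr hGeq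
  · simp_rw [← freeGroup_eq]
    exact hduh t ht
  · positivity
  · rw [hGeq t ht, add_sub_cancel_left]
    refine (norm_linOp_le (hβ t (hS ht)) (hc t (hS ht)) (u t)).trans ?_
    gcongr
  · rw [hGeq t ht, add_sub_cancel_left]
    refine (abs_re_inner_sub_res_linOp_le hs (hβ t (hS ht)) (hc t (hS ht)) (u t)).trans ?_
    rw [mul_comm K]
    gcongr

end

/-! ### Scaling -/

/-- The change of variables `x ↦ (x - x₀) / l`. -/
def rescale (l : ℝ) (x₀ x : Sp d) : Sp d := l⁻¹ • (x - x₀)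

theorem measurableEmbedding_rescale {l : ℝ} (hl : 0 < l) (x₀ : Sp d) :
    MeasurableEmbedding (rescale l x₀) :=
  (measurableEmbedding_const_smul₀ (inv_ne_zero hl.ne')).comp (measurableEmbedding_subRight x₀)

theorem map_rescale {l : ℝ} (hl : 0 < l) (x₀ : Sp d) :
    Measure.map (rescale l x₀) volume = ENNReal.ofReal (l ^ d) • (volume : Measure (Sp d)) := by
  have h1 : Measure.map (rescale l x₀) (volume : Measure (Sp d))
      = Measure.map (fun x => l⁻¹ • x) (Measure.map (fun x => x - x₀) volume) :=
    (Measure.map_map (measurable_const_smul _) (measurable_id.sub_const x₀)).symm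
  rw [h1, map_sub_right_eq_self, Measure.map_addHaar_smul _ (inv_ne_zero hl.ne'),
    finrank_euclideanSpace_fin]
  congr 2
  rw [inv_pow, inv_inv, abs_of_pos (by positivity)]

theorem quasiMeasurePreserving_rescale {l : ℝ} (hl : 0 < l) (x₀ : Sp d) :
    Measure.QuasiMeasurePreserving (rescale l x₀) volume volume := by
  refine ⟨(measurableEmbedding_rescale hl x₀).measurable, ?_⟩
  rw [map_rescale hl]
  exact Measure.smul_absolutelyContinuous

theorem integral_rescale {l : ℝ} (hl : 0 < l) (x₀ : Sp d) {F : Type*} [NormedAddCommGroup F]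
    [NormedSpace ℝ F] (f : Sp d → F) :
    ∫ x, f (rescale l x₀ x) = (l ^ d) • ∫ y, f y := by
  rw [← (measurableEmbedding_rescale hl x₀).integral_map, map_rescale hl, integral_smul_measure,
    ENNReal.toReal_ofReal (by positivity)]

theorem norm_sq_of_rescale {l : ℝ} (hl : 0 < l) (x₀ : Sp d) {a : ℂ} {f g : L2 d}
    (h : ∀ᵐ x, ‖f x‖ = ‖a * g (rescale l x₀ x)‖) : ‖f‖ ^ 2 = ‖a‖ ^ 2 * l ^ d * ‖g‖ ^ 2 := by
  rw [norm_sq_eq_integral, norm_sq_eq_integral]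
  calc ∫ x, ‖f x‖ ^ 2 = ∫ x, (fun y => ‖a‖ ^ 2 * ‖g y‖ ^ 2) (rescale l x₀ x) := by
        refine integral_congr_ae ?_
        filter_upwards [h] with x hx
        rw [hx, norm_mul, mul_pow]
    _ = _ := by
        refine (integral_rescale hl x₀ fun y => ‖a‖ ^ 2 * ‖g y‖ ^ 2).trans ?_
        rw [integral_const_mul, smul_eq_mul]; ring

theorem norm_eq_of_rescale {l : ℝ} (hl : 0 < l) (x₀ : Sp d) {a c : ℂ} {f g : L2 d}
    (hc : ‖c‖ ^ 2 * l ^ d = 1)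
    (h : ∀ᵐ x, ‖f x‖ = ‖a * c * g (rescale l x₀ x)‖) : ‖f‖ = ‖a‖ * ‖g‖ := by
  have h1 := norm_sq_of_rescale hl x₀ h
  rw [norm_mul, mul_pow, mul_assoc, mul_assoc, ← mul_assoc (‖c‖ ^ 2), hc, one_mul,
    ← mul_pow] at h1
  exact (sq_eq_sq₀ (norm_nonneg _) (by positivity)).1 h1

theorem hasTemperateGrowth_affine (l : ℝ) (x₀ : Sp d) :
    (fun y : Sp d => x₀ + l • y).HasTemperateGrowth := by
  have : (fun y : Sp d => l • y).HasTemperateGrowth :=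
    (l • ContinuousLinearMap.id ℝ (Sp d)).hasTemperateGrowth
  exact (Function.HasTemperateGrowth.const x₀).add this

theorem antilipschitz_affine {l : ℝ} (hl : 0 < l) (x₀ : Sp d) :
    AntilipschitzWith (Real.toNNReal l⁻¹) (fun y : Sp d => x₀ + l • y) := by
  refine AntilipschitzWith.of_le_mul_dist fun x y => ?_
  rw [dist_add_left, dist_smul₀, Real.coe_toNNReal _ (by positivity), Real.norm_of_nonneg hl.le,
    ← mul_assoc, inv_mul_cancel₀ hl.ne', one_mul]

/-- `y ↦ g (x₀ + l y)` as a Schwartz function. -/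
def affineComp {l : ℝ} (hl : 0 < l) (x₀ : Sp d) (g : 𝓢(Sp d, ℂ)) : 𝓢(Sp d, ℂ) :=
  SchwartzMap.compCLMOfAntilipschitz ℝ (hasTemperateGrowth_affine l x₀)
    (antilipschitz_affine hl x₀) g

theorem affineComp_apply {l : ℝ} (hl : 0 < l) (x₀ : Sp d) (g : 𝓢(Sp d, ℂ)) (y : Sp d) :
    affineComp hl x₀ g y = g (x₀ + l • y) := rfl

theorem affineComp_rescale {l : ℝ} (hl : 0 < l) (x₀ : Sp d) (g : 𝓢(Sp d, ℂ)) (x : Sp d) :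
    affineComp hl x₀ g (rescale l x₀ x) = g x := by
  rw [affineComp_apply, rescale, smul_smul, mul_inv_cancel₀ hl.ne', one_smul, add_sub_cancel]

theorem lineDeriv_affineComp {l : ℝ} (hl : 0 < l) (x₀ : Sp d) (g : 𝓢(Sp d, ℂ)) (j : Fin d)
    (y : Sp d) : (∂_{(stdVec j : Sp d)} (affineComp hl x₀ g) : 𝓢(Sp d, ℂ)) y
      = l * affineComp hl x₀ (∂_{(stdVec j : Sp d)} g) y := by
  rw [SchwartzMap.lineDerivOp_apply_eq_fderiv, affineComp_apply,
    SchwartzMap.lineDerivOp_apply_eq_fderiv]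
  have h1 : HasFDerivAt (fun y : Sp d => x₀ + l • y) (l • ContinuousLinearMap.id ℝ (Sp d)) y :=
    ((l • ContinuousLinearMap.id ℝ (Sp d)).hasFDerivAt).const_add x₀
  have h2 : HasFDerivAt (affineComp hl x₀ g)
      ((fderiv ℝ g (x₀ + l • y)).comp (l • ContinuousLinearMap.id ℝ (Sp d))) y :=
    HasFDerivAt.comp (g := g) (f := fun y : Sp d => x₀ + l • y) y
      (g.differentiable (x₀ + l • y)).hasFDerivAt h1
  rw [h2.fderiv]
  simp

theorem inner_toLp_right (f : L2 d) (g : 𝓢(Sp d, ℂ)) :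
    inner ℂ f (g.toLp 2 volume) = ∫ x, (starRingEnd ℂ) (f x) * g x := by
  rw [inner_eq_integral]
  refine integral_congr_ae ?_
  filter_upwards [g.coeFn_toLp 2 volume] with x hx
  rw [hx]

theorem memLp_rescale {l : ℝ} (hl : 0 < l) (x₀ : Sp d) (f : L2 d) :
    MemLp (fun x => f (rescale l x₀ x)) 2 (volume : Measure (Sp d)) := by
  have h := Lp.memLp f
  have h1 : MemLp f 2 (Measure.map (rescale l x₀) (volume : Measure (Sp d))) := by
    rw [map_rescale hl]
    exact h.smul_measure ENNReal.ofReal_ne_top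
  exact h1.comp_of_map (measurableEmbedding_rescale hl x₀).measurable.aemeasurable

/-- The chain rule for weak derivatives under rescaling. -/
theorem H1.pd_rescale {l : ℝ} (hl : 0 < l) (x₀ : Sp d) {c : ℂ} {u q : H1 d}
    (h : ∀ᵐ x, u.fn x = c * q.fn (rescale l x₀ x)) (j : Fin d) :
    ∀ᵐ x, u.pd j x = (l⁻¹ : ℝ) * c * q.pd j (rescale l x₀ x) := by
  have hW : MemLp (fun x => (l⁻¹ : ℝ) * c * q.pd j (rescale l x₀ x)) 2
      (volume : Measure (Sp d)) := (memLp_rescale hl x₀ (q.pd j)).const_mul _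
  have hl' : (l : ℂ) ≠ 0 := by exact_mod_cast hl.ne'
  -- The identity is tested against Schwartz functions: one integration by parts in `x`, the change
  -- of variables, and one integration by parts in `y` against the transported test function.
  suffices hu : u.pd j - hW.toLp = 0 by
    rw [sub_eq_zero] at hu
    rw [hu]
    exact hW.coeFn_toLp
  refine (SchwartzMap.denseRange_toLpCLM (E := Sp d) (F := ℂ) (p := 2) (μ := volume)
      ENNReal.ofNat_ne_top).eq_zero_of_inner_left ℂ fun g => ?_
  rw [SchwartzMap.toLpCLM_apply, inner_sub_left, sub_eq_zero]
  have h1 := H1.inner_pd_left u (H1.ofSchwartz g) j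
  have h2 := H1.inner_pd_left q (H1.ofSchwartz (affineComp hl x₀ g)) j
  rw [H1.ofSchwartz_fn, H1.ofSchwartz_pd, inner_toLp_right, inner_toLp_right] at h1 h2
  rw [inner_toLp_right, h1, inner_toLp_right]
  have e1 : ∫ x, (starRingEnd ℂ) (u.fn x) * (∂_{(stdVec j : Sp d)} g : 𝓢(Sp d, ℂ)) x
      = ∫ x, (fun y => (starRingEnd ℂ) c * (l⁻¹ : ℝ) * ((starRingEnd ℂ) (q.fn y)
        * (∂_{(stdVec j : Sp d)} (affineComp hl x₀ g) : 𝓢(Sp d, ℂ)) y)) (rescale l x₀ x) := by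
    refine integral_congr_ae ?_
    filter_upwards [h] with x hx
    rw [hx, lineDeriv_affineComp, affineComp_rescale, map_mul]
    push_cast
    field_simp
  have e2 : ∫ x, (starRingEnd ℂ) ((hW.toLp _ : L2 d) x) * g x
      = ∫ x, (fun y => (starRingEnd ℂ) c * (l⁻¹ : ℝ) * ((starRingEnd ℂ) (q.pd j y)
        * affineComp hl x₀ g y)) (rescale l x₀ x) := by
    refine integral_congr_ae ?_
    filter_upwards [hW.coeFn_toLp] with x hx
    rw [hx, affineComp_rescale, map_mul, map_mul, Complex.conj_ofReal]
    ring
  have r1 := integral_rescale hl x₀ fun y => (starRingEnd ℂ) c * (l⁻¹ : ℝ) *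
    ((starRingEnd ℂ) (q.fn y) * (∂_{(stdVec j : Sp d)} (affineComp hl x₀ g) : 𝓢(Sp d, ℂ)) y)
  have r2 := integral_rescale hl x₀ fun y => (starRingEnd ℂ) c * (l⁻¹ : ℝ) *
    ((starRingEnd ℂ) (q.pd j y) * affineComp hl x₀ g y)
  rw [e1, e2, r1, r2, integral_const_mul, integral_const_mul, h2]
  simp

section

variable {l : ℝ} {x₀ : Sp d} {c : ℂ} {u q : H1 d}

theorem norm_fn_rescale (hl : 0 < l) (hc : ‖c‖ ^ 2 * l ^ d = 1)
    (h : ∀ᵐ x, u.fn x = c * q.fn (rescale l x₀ x)) : ‖u.fn‖ = ‖q.fn‖ := by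
  have := norm_eq_of_rescale hl x₀ (a := 1) hc (h.mono fun x hx => by rw [hx, one_mul])
  rwa [norm_one, one_mul] at this

theorem norm_pd_rescale (hl : 0 < l) (hc : ‖c‖ ^ 2 * l ^ d = 1)
    (h : ∀ᵐ x, u.fn x = c * q.fn (rescale l x₀ x)) (j : Fin d) :
    ‖u.pd j‖ = l⁻¹ * ‖q.pd j‖ := by
  have := norm_eq_of_rescale hl x₀ (a := (l⁻¹ : ℝ)) hc
    ((H1.pd_rescale hl x₀ h j).mono fun x hx => by rw [hx])
  rwa [Complex.norm_real, Real.norm_of_nonneg (inv_nonneg.2 hl.le)] at this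

theorem norm_nl_rescale (hd : d = 1 ∨ d = 2) (hl : 0 < l) (hc : ‖c‖ ^ 2 * l ^ d = 1)
    (h : ∀ᵐ x, u.fn x = c * q.fn (rescale l x₀ x)) : ‖nl u‖ = (l⁻¹) ^ 2 * ‖nl q‖ := by
  -- This is mass-criticality: the power `4/d` of the `L²`-normalised amplitude `l^{-d/2}` scales
  -- like two derivatives.
  have hp : ‖c‖ ^ pw d = (l⁻¹) ^ 2 := by
    have h1 : ‖c‖ ^ 2 = (l⁻¹) ^ d := by
      rw [inv_pow]; exact eq_inv_of_mul_eq_one_left hc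
    rcases hd with rfl | rfl
    · calc ‖c‖ ^ pw 1 = (‖c‖ ^ 2) ^ 2 := by rw [← pow_mul]; rfl
        _ = _ := by rw [h1, pow_one]
    · exact h1
  have := norm_eq_of_rescale hl x₀ (a := ((‖c‖ ^ pw d : ℝ) : ℂ)) (f := nl u) (g := nl q) hc (by
    filter_upwards [nl_coeFn hd u, h, (quasiMeasurePreserving_rescale hl x₀).ae (nl_coeFn hd q)]
      with x h1 h2 h3
    rw [h1, h2, h3, norm_nlf, norm_mul, norm_mul, norm_mul, norm_nlf, Complex.norm_real,
      Real.norm_of_nonneg (by positivity)]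
    ring)
  rwa [Complex.norm_real, Real.norm_of_nonneg (by positivity), hp] at this

end

/-- Norms of a modulated function. -/
theorem IsModulated.norms (hd : d = 1 ∨ d = 2) {Qb : Sp d → ℂ} {ε u Qv : H1 d} {l γ : ℝ} {x₀ : Sp d}
    (hl : 0 < l) (hQ : ∀ᵐ y, Qv.fn y = Qb y) (h : IsModulated Qb ε l x₀ γ u) :
    ‖u.fn‖ = ‖(Qv + ε).fn‖ ∧ (∀ j, ‖u.pd j‖ = l⁻¹ * ‖(Qv + ε).pd j‖) ∧
      ‖nl u‖ = (l⁻¹) ^ 2 * ‖nl (Qv + ε)‖ := by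
  set c : ℂ := ((l ^ (-((d : ℝ) / 2)) : ℝ) : ℂ) * Complex.exp (Complex.I * (γ : ℂ))
  have hc : ‖c‖ ^ 2 * l ^ d = 1 := by
    rw [norm_mul, mul_comm Complex.I, Complex.norm_exp_ofReal_mul_I, mul_one, Complex.norm_real,
      Real.norm_of_nonneg (by positivity), ← Real.rpow_natCast, ← Real.rpow_natCast,
      ← Real.rpow_mul hl.le, ← Real.rpow_add hl]
    have : -((d : ℝ) / 2) * ((2 : ℕ) : ℝ) + d = 0 := by push_cast; ring
    rw [this, Real.rpow_zero]
  have h' : ∀ᵐ x, u.fn x = c * (Qv + ε).fn (rescale l x₀ x) := by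
    have hadd : ∀ᵐ y, (Qv + ε).fn y = Qb y + ε.fn y := by
      rw [H1.fn_add]
      filter_upwards [Lp.coeFn_add Qv.fn ε.fn, hQ] with y h1 h2
      rw [h1, Pi.add_apply, h2]
    filter_upwards [h, (quasiMeasurePreserving_rescale hl x₀).ae hadd] with x h1 h2
    rw [h1, h2, rescale]
    ring
  exact ⟨norm_fn_rescale hl hc h', norm_pd_rescale hl hc h', norm_nl_rescale hd hl hc h'⟩

/-! ### The gradient norm -/

namespace H1

/-- `‖∇v‖_{L²}`. -/
def gradNorm (v : H1 d) : ℝ := ‖v.1.snd‖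

theorem gradNorm_nonneg (v : H1 d) : 0 ≤ gradNorm v := norm_nonneg _

theorem gradNorm_sq (v : H1 d) : gradNorm v ^ 2 = ∑ j, ‖v.pd j‖ ^ 2 :=
  PiLp.norm_sq_eq_of_L2 _ _

theorem gradNorm_add_le (v w : H1 d) : gradNorm (v + w) ≤ gradNorm v + gradNorm w :=
  norm_add_le v.1.snd w.1.snd

theorem gradNorm_le_add (v w : H1 d) : gradNorm v ≤ gradNorm (v + w) + gradNorm w :=
  norm_le_add_norm_add v.1.snd w.1.snd

theorem norm_sq_eq_gradNorm (v : H1 d) : ‖v‖ ^ 2 = ‖v.fn‖ ^ 2 + gradNorm v ^ 2 := by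
  rw [norm_sq, gradNorm_sq]

theorem gradNorm_le_norm (v : H1 d) : gradNorm v ≤ ‖v‖ := by
  refine le_of_sq_le_sq ?_ (norm_nonneg _)
  rw [gradNorm_sq]
  exact sum_norm_pd_sq_le v

theorem norm_le_fn_add_gradNorm (v : H1 d) : ‖v‖ ≤ ‖v.fn‖ + gradNorm v := by
  have h1 := gradNorm_nonneg v
  refine le_of_sq_le_sq ?_ (by positivity)
  rw [norm_sq_eq_gradNorm]
  nlinarith [mul_nonneg (norm_nonneg v.fn) h1]

theorem continuous_gradNorm : Continuous (gradNorm : H1 d → ℝ) :=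
  ((WithLp.sndL 2 ℂ (L2 d) (PiLp 2 (fun _ : Fin d => L2 d))).continuous.comp
    continuous_subtype_val).norm

theorem gradNorm_sq_le_localNormSq (ε : H1 d) : gradNorm ε ^ 2 ≤ localNormSq ε := by
  have h1 : Integrable (fun y => ∑ j, ‖ε.pd j y‖ ^ 2) (volume : Measure (Sp d)) :=
    integrable_finsetSum _ fun j _ => integrable_norm_sq _
  have h2 : Integrable (fun y : Sp d => ‖ε.fn y‖ ^ 2 * Real.exp (-‖y‖)) volume := by
    refine (integrable_norm_sq ε.fn).mul_bdd (c := 1) ?_ (Eventually.of_forall fun y => ?_)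
    · exact (Real.continuous_exp.comp continuous_norm.neg).aestronglyMeasurable
    · rw [Real.norm_of_nonneg (Real.exp_pos _).le, Real.exp_le_one_iff]
      simp
  rw [gradNorm_sq, localNormSq, integral_add h1 h2, integral_finsetSum _ fun j _ =>
    integrable_norm_sq _]
  simp_rw [norm_sq_eq_integral]
  have : 0 ≤ ∫ y : Sp d, ‖ε.fn y‖ ^ 2 * Real.exp (-‖y‖) :=
    integral_nonneg fun y => by positivity
  linarith

/-- A vanishing gradient forces the Fourier transform to live where all `dsym j` vanish, that is at
the origin, a null set in positive dimension. -/
theorem fn_eq_zero_of_gradNorm_eq_zero (hd : 0 < d) {v : H1 d} (h : gradNorm v = 0) :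
    v.fn = 0 := by
  have hpd : ∀ j, v.pd j = 0 := fun j => by
    have h1 := gradNorm_sq v
    rw [h, zero_pow two_ne_zero] at h1
    have h2 := (Finset.sum_eq_zero_iff_of_nonneg fun _ _ => by positivity).1 h1.symm j
      (Finset.mem_univ j)
    simpa using h2
  have : Nonempty (Fin d) := ⟨⟨0, hd⟩⟩
  have : Nontrivial (Sp d) := inferInstance
  apply fourier_injective
  have h0 : (𝓕 (0 : L2 d) : L2 d) = 0 := map_zero (Lp.fourierTransformₗᵢ (Sp d) ℂ)
  rw [h0]
  refine Lp.ext ?_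
  have h1 : ∀ᵐ ξ, ∀ j, (𝓕 (v.pd j) : L2 d) ξ = dsym j ξ * (𝓕 v.fn : L2 d) ξ :=
    ae_all_iff.2 fun j => fourier_pd v j
  have h2 : ∀ᵐ ξ : Sp d, ξ ≠ 0 := by
    rw [ae_iff]; simp
  filter_upwards [h1, h2, Lp.coeFn_zero ℂ 2 (volume : Measure (Sp d))] with ξ h1 h2 h3
  simp_rw [hpd, h0, h3] at h1
  rw [h3]
  by_contra hne
  have h4 : asym ξ = 0 := by
    rw [← sum_norm_dsym_sq]
    refine Finset.sum_eq_zero fun j _ => ?_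
    have := (mul_eq_zero.1 (h1 j).symm).resolve_right hne
    rw [this, norm_zero, zero_pow two_ne_zero]
  have h5 : 0 < asym ξ := by
    have := norm_pos_iff.2 h2
    unfold asym; positivity
  linarith

end H1

theorem gradNorm_pos_of_isGroundState (hd : d = 1 ∨ d = 2) {Q : Sp d → ℝ} (hQ : IsGroundState Q)
    {v : H1 d} (hv : ∀ᵐ x, v.fn x = (Q x : ℂ)) : 0 < H1.gradNorm v := by
  refine lt_of_le_of_ne (H1.gradNorm_nonneg v) fun h => ?_
  have h0 := H1.fn_eq_zero_of_gradNorm_eq_zero (by rcases hd with rfl | rfl <;> norm_num) h.symm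
  rw [h0] at hv
  obtain ⟨x, hx1, hx2⟩ := (hv.and (Lp.coeFn_zero ℂ 2 (volume : Measure (Sp d)))).exists
  rw [hx2] at hx1
  have := hQ.pos x
  simp only [Pi.zero_apply] at hx1
  have h1 : Q x = 0 := by exact_mod_cast hx1.symm
  linarith

/-- Size of a modulated function in terms of its scale. -/
theorem exists_modulated_bounds (hd : d = 1 ∨ d = 2) (M : ℝ) (hM : 0 ≤ M) : ∃ D : ℝ, 0 < D ∧
    ∀ (Qb : Sp d → ℂ) (Qv ε u : H1 d) (l γ g : ℝ) (x₀ : Sp d),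
      (∀ᵐ y, Qv.fn y = Qb y) → ‖Qv‖ ≤ M → 2 * g ≤ H1.gradNorm Qv → ‖ε.fn‖ ≤ 1 →
      H1.gradNorm ε ≤ 1 → H1.gradNorm ε ≤ g → 0 < l → l ≤ 1 → IsModulated Qb ε l x₀ γ u →
      g ≤ l * H1.gradNorm u ∧ l * H1.gradNorm u ≤ D ∧ l * ‖u‖ ≤ D ∧ l ^ 2 * ‖nl u‖ ≤ D := by
  obtain ⟨C, hC, hnl⟩ := exists_norm_nl_le hd
  refine ⟨2 * (M + 1) + C * (2 * (M + 1)) ^ pw d * (2 * (M + 1)), by positivity,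
    fun Qb Qv ε u l γ g x₀ hQ hQM hQg hε1 hε2 hε3 hl hl1 h => ?_⟩
  obtain ⟨h1, h2, h3⟩ := h.norms hd hl hQ
  set q := Qv + ε
  have hgr : H1.gradNorm u = l⁻¹ * H1.gradNorm q := by
    refine (sq_eq_sq₀ (H1.gradNorm_nonneg _) (mul_nonneg (by positivity)
      (H1.gradNorm_nonneg _))).1 ?_
    rw [mul_pow, H1.gradNorm_sq, H1.gradNorm_sq, Finset.mul_sum]
    simp_rw [h2, mul_pow]
  have hlgr : l * H1.gradNorm u = H1.gradNorm q := by
    rw [hgr, ← mul_assoc, mul_inv_cancel₀ hl.ne', one_mul]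
  have hq1 : ‖q.fn‖ ≤ M + 1 := by
    rw [H1.fn_add]
    exact (norm_add_le _ _).trans (add_le_add ((H1.norm_fn_le _).trans hQM) hε1)
  have hq2 : H1.gradNorm q ≤ M + 1 :=
    (H1.gradNorm_add_le _ _).trans (add_le_add ((H1.gradNorm_le_norm _).trans hQM) hε2)
  have hq : ‖q‖ ≤ 2 * (M + 1) := by
    have := H1.norm_le_fn_add_gradNorm q
    linarith
  have hlu : l * ‖u‖ ≤ 2 * (M + 1) := by
    have h4 := H1.norm_le_fn_add_gradNorm u
    -- The `L²` part of the norm is scale invariant, so `l ≤ 1` is what bounds its product with `l`.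
    have h5 : l * ‖u.fn‖ ≤ 1 * ‖q.fn‖ := by rw [h1]; gcongr
    nlinarith
  have hnlq : ‖nl q‖ ≤ C * (2 * (M + 1)) ^ pw d * (2 * (M + 1)) := by
    refine (hnl q).trans ?_
    have := H1.norm_fn_le q
    gcongr
    linarith
  have hp : 0 ≤ C * (2 * (M + 1)) ^ pw d * (2 * (M + 1)) := by positivity
  refine ⟨?_, ?_, ?_, ?_⟩
  · rw [hlgr]
    have := H1.gradNorm_le_add Qv ε
    linarith
  · rw [hlgr]; linarith
  · linarith
  · rw [h3, ← mul_assoc, ← mul_pow, mul_inv_cancel₀ hl.ne', one_pow, one_mul]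
    linarith

/-! ### Integration over dyadic partitions -/

/-- The hypothesis is a product rather than a quotient so that intervals of length zero, which the
partition allows, need no separate treatment by its users. -/
theorem integral_le_of_mul_le {g : ℝ → ℝ} {a b c : ℝ} (hab : a ≤ b) (hg : ContinuousOn g (Icc a b))
    (h : ∀ s ∈ Icc a b, g s * (b - a) ≤ c) : ∫ s in a..b, g s ≤ c := by
  rcases hab.eq_or_lt with rfl | hlt
  · have := h a (by simp)
    simpa using this
  · have hpos : 0 < b - a := by linarith
    calc _ ≤ ∫ _s in a..b, c / (b - a) := by
          refine intervalIntegral.integral_mono_on hab ?_ (by simp) fun s hs => ?_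
          · exact (hg.mono (by rw [uIcc_of_le hab])).intervalIntegrable
          · rw [le_div_iff₀ hpos]; exact h s hs
      _ = c := by
          rw [intervalIntegral.integral_const, smul_eq_mul]
          field_simp

/-- The contribution of the `k`-th piece is at most `P k`, and `k² + k ≤ (k+1)²` sums these
contributions inductively. The last piece is cut at `t`. -/
theorem integral_le_of_partition {τ : ℕ → ℝ} {g : ℝ → ℝ} {m : ℕ} {P t : ℝ} (h0 : τ m = 0)
    (hP : 0 ≤ P) (hg : ContinuousOn g (Icc 0 t)) {N : ℕ} (hmN : m ≤ N)
    (hmono : ∀ k, m ≤ k → k < N → τ k ≤ τ (k + 1)) (hN : τ N ≤ t)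
    (hpiece : ∀ k, m ≤ k → k < N → ∀ s ∈ Icc (τ k) (τ (k + 1)),
      g s * (τ (k + 1) - τ k) ≤ P * k)
    (hlast : ∀ s ∈ Icc (τ N) t, g s * (t - τ N) ≤ P * N) :
    ∫ s in (0 : ℝ)..t, g s ≤ P * (N + 1) ^ 2 := by
  have key : ∀ k, m ≤ k → k ≤ N → 0 ≤ τ k ∧ (τ k ≤ t → ∫ s in (0 : ℝ)..τ k, g s ≤ P * k ^ 2) := by
    intro k hk
    induction k, hk using Nat.le_induction with
    | base =>
      refine fun _ => ⟨h0.ge, fun _ => ?_⟩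
      rw [h0, intervalIntegral.integral_same]
      positivity
    | succ k hk ih =>
      intro hkN
      obtain ⟨ih1, ih2⟩ := ih (by omega)
      have hm := hmono k hk (by omega)
      refine ⟨ih1.trans hm, fun ht => ?_⟩
      have hc1 : ContinuousOn g (Icc 0 (τ k)) := hg.mono (Icc_subset_Icc_right (hm.trans ht))
      have hc2 : ContinuousOn g (Icc (τ k) (τ (k + 1))) := hg.mono (Icc_subset_Icc ih1 ht)
      rw [← intervalIntegral.integral_add_adjacent_intervals (b := τ k)
        (hc1.mono (by rw [uIcc_of_le ih1])).intervalIntegrable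
        (hc2.mono (by rw [uIcc_of_le hm])).intervalIntegrable]
      have h2 := integral_le_of_mul_le hm hc2 (hpiece k hk (by omega))
      have h3 := ih2 (hm.trans ht)
      have hk0 : 0 ≤ P * k := by positivity
      push_cast
      nlinarith
  obtain ⟨h1, h2⟩ := key N hmN le_rfl
  have hc1 : ContinuousOn g (Icc 0 (τ N)) := hg.mono (Icc_subset_Icc_right hN)
  have hc2 : ContinuousOn g (Icc (τ N) t) := hg.mono (Icc_subset_Icc_left h1)
  rw [← intervalIntegral.integral_add_adjacent_intervals (b := τ N)
    (hc1.mono (by rw [uIcc_of_le h1])).intervalIntegrable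
    (hc2.mono (by rw [uIcc_of_le hN])).intervalIntegrable]
  have h3 := integral_le_of_mul_le hN hc2 hlast
  have h4 := h2 hN
  have hk0 : 0 ≤ P * N := by positivity
  nlinarith

theorem exists_mem_partition {τ : ℕ → ℝ} {m n : ℕ} {t : ℝ} (hmn : m < n) (h0 : τ m ≤ t)
    (ht : t ≤ τ n) : ∃ N, m ≤ N ∧ N < n ∧ τ N ≤ t ∧ t ≤ τ (N + 1) := by
  induction n, hmn using Nat.le_induction with
  | base => exact ⟨m, le_rfl, by omega, h0, ht⟩
  | succ k hk ih =>
    rcases le_total t (τ k) with h | h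
    · obtain ⟨N, h1, h2, h3, h4⟩ := ih h
      exact ⟨N, h1, by omega, h3, h4⟩
    · exact ⟨k, by omega, by omega, h, ht⟩

theorem exists_pow_four_le : ∃ C : ℝ, 0 < C ∧ ∀ N : ℕ, ((N : ℝ) + 1) ^ 4 ≤ C * 2 ^ N := by
  have h := tendsto_pow_const_div_const_pow_of_one_lt 4 (r := (2 : ℝ)) (by norm_num)
  obtain ⟨C, hC⟩ := h.bddAbove_range
  refine ⟨2 * max C 1, by positivity, fun N => ?_⟩
  have h1 := hC ⟨N + 1, rfl⟩
  simp only at h1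
  rw [div_le_iff₀ (by positivity)] at h1
  push_cast at h1
  calc _ ≤ C * 2 ^ (N + 1) := h1
    _ ≤ max C 1 * 2 ^ (N + 1) := by gcongr; exact le_max_left _ _
    _ = _ := by ring

/-- On a partition adapted to the dyadic values of `l`, integrals of functions bounded by
`R l(t) l⁻²` are small. -/
theorem exists_integral_le_sqrt (A : ℝ) (hA : 0 < A) : ∃ C : ℝ, 0 ≤ C ∧
    ∀ (m n : ℕ) (τ : ℕ → ℝ) (l g : ℝ → ℝ) (T t R : ℝ), m < n → τ m = 0 → τ n = T →
      (∀ k, m ≤ k → k < n → τ k ≤ τ (k + 1) ∧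
        (∀ t ∈ Icc (τ k) (τ (k + 1)), A⁻¹ * (2 : ℝ)⁻¹ ^ k ≤ l t ∧ l t ≤ A * (2 : ℝ)⁻¹ ^ k) ∧
        τ (k + 1) - τ k ≤ A * k * l (τ k) ^ 2) →
      t ∈ Icc 0 T → 0 ≤ R → ContinuousOn g (Icc 0 t) →
      (∀ s ∈ Icc 0 t, g s * l s ^ 2 ≤ R * l t) →
      ∫ s in (0 : ℝ)..t, g s ≤ R * C * √(l t) := by
  obtain ⟨C, hC, hpow⟩ := exists_pow_four_le
  -- One power of `A` comes from the length of a piece and four from `l(τ k)² ≤ (A² l(s))²` within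
  -- the piece. The root collects the constants in `(N+1)⁴ ≤ C 2ᴺ` and `l(t) 2ᴺ ≤ A`.
  refine ⟨A ^ 5 * √(C * A), by positivity, fun m n τ l g T t R hmn h0 hn hpart ht hR hg hb => ?_⟩
  obtain ⟨N, hmN, hNn, hN1, hN2⟩ := exists_mem_partition hmn (h0.trans_le ht.1) (ht.2.trans_eq hn.symm)
  have hlt := (hpart N hmN hNn).2.1 t ⟨hN1, hN2⟩
  have hlpos : 0 < l t := lt_of_lt_of_le (by positivity) hlt.1
  have hτ0 : ∀ k, m ≤ k → k ≤ n → 0 ≤ τ k := by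
    intro k hk
    induction k, hk using Nat.le_induction with
    | base => intro _; rw [h0]
    | succ k hk ih => exact fun hkn => (ih (by omega)).trans (hpart k hk (by omega)).1
  have hτN : ∀ k, k ≤ N → m ≤ k → τ k ≤ τ N := by
    intro k hkN
    induction hkN using Nat.decreasingInduction with
    | self => intro _; exact le_rfl
    | of_succ k hkN ih => exact fun hk => (hpart k hk (by omega)).1.trans (ih (by omega))
  have hstep : ∀ k, m ≤ k → k < n → ∀ s ∈ Icc (τ k) (τ (k + 1)), s ≤ t → ∀ δ, 0 ≤ δ →
      δ ≤ A * k * l (τ k) ^ 2 → g s * δ ≤ R * A ^ 5 * l t * k := by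
    intro k hk hkn s hs hst δ hδ hδ'
    have h1 := (hpart k hk hkn).2.1 s hs
    have h2 := (hpart k hk hkn).2.1 (τ k) ⟨le_rfl, (hpart k hk hkn).1⟩
    have h3 := hb s ⟨(hτ0 k hk hkn.le).trans hs.1, hst⟩
    have hlk0 : 0 ≤ l (τ k) := le_trans (by positivity) h2.1
    have hls0 : 0 < l s := lt_of_lt_of_le (by positivity) h1.1
    have h4 : l (τ k) ≤ A ^ 2 * l s := by
      calc l (τ k) ≤ A * (2 : ℝ)⁻¹ ^ k := h2.2
        _ = A ^ 2 * (A⁻¹ * (2 : ℝ)⁻¹ ^ k) := by field_simp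
        _ ≤ A ^ 2 * l s := by gcongr; exact h1.1
    have h5 : δ ≤ A ^ 5 * k * l s ^ 2 := by
      calc δ ≤ A * k * l (τ k) ^ 2 := hδ'
        _ ≤ A * k * (A ^ 2 * l s) ^ 2 := by gcongr
        _ = _ := by ring
    rcases le_total (g s) 0 with hgs | hgs
    · have h6 : g s * δ ≤ 0 := mul_nonpos_of_nonpos_of_nonneg hgs hδ
      have h7 : 0 ≤ R * A ^ 5 * l t * k := by positivity
      linarith
    · calc g s * δ ≤ g s * (A ^ 5 * k * l s ^ 2) := by gcongr
        _ = (g s * l s ^ 2) * (A ^ 5 * k) := by ring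
        _ ≤ (R * l t) * (A ^ 5 * k) := by gcongr
        _ = _ := by ring
  have hint := integral_le_of_partition (P := R * A ^ 5 * l t) h0 (by positivity) hg hmN
    (fun k hk hkN => (hpart k hk (by omega)).1) hN1
    (fun k hk hkN s hs => hstep k hk (by omega) s hs
      (hs.2.trans ((hτN (k + 1) (by omega) (by omega)).trans hN1)) _
      (by linarith [(hpart k hk (by omega)).1]) (hpart k hk (by omega)).2.2)
    (fun s hs => hstep N hmN hNn s ⟨hs.1, hs.2.trans hN2⟩ hs.2 _ (by linarith)
      (by linarith [(hpart N hmN hNn).2.2]))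
  have hfin : l t * (N + 1) ^ 2 ≤ √(C * A) * √(l t) := by
    rw [← Real.sqrt_mul (by positivity)]
    refine Real.le_sqrt_of_sq_le ?_
    have h6 : l t * 2 ^ N ≤ A := by
      have := hlt.2
      calc l t * 2 ^ N ≤ A * (2 : ℝ)⁻¹ ^ N * 2 ^ N := by gcongr
        _ = A := by rw [mul_assoc, ← mul_pow]; norm_num
    calc (l t * (N + 1) ^ 2) ^ 2 = l t ^ 2 * ((N : ℝ) + 1) ^ 4 := by ring
      _ ≤ l t ^ 2 * (C * 2 ^ N) := by gcongr; exact hpow N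
      _ = C * l t * (l t * 2 ^ N) := by ring
      _ ≤ C * l t * A := by gcongr
      _ = _ := by ring
  calc _ ≤ R * A ^ 5 * l t * (N + 1) ^ 2 := hint
    _ = R * A ^ 5 * (l t * (N + 1) ^ 2) := by ring
    _ ≤ R * A ^ 5 * (√(C * A) * √(l t)) := by gcongr
    _ = _ := by ring

/-- The total length of a dyadic partition is controlled by the largest value of `l`. -/
theorem length_le_of_partition {A L : ℝ} (hA : 0 < A) {m n : ℕ} {τ : ℕ → ℝ} {l : ℝ → ℝ}
    (hmn : m < n) (h0 : τ m = 0)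
    (hpart : ∀ k, m ≤ k → k < n → τ k ≤ τ (k + 1) ∧
        (∀ t ∈ Icc (τ k) (τ (k + 1)), A⁻¹ * (2 : ℝ)⁻¹ ^ k ≤ l t ∧ l t ≤ A * (2 : ℝ)⁻¹ ^ k) ∧
        τ (k + 1) - τ k ≤ A * k * l (τ k) ^ 2) (hL : l 0 ≤ L) :
    τ n ≤ 2 * A ^ 4 * L := by
  have hstep : ∀ k, m ≤ k → k < n → τ (k + 1) - τ k ≤ A ^ 3 * (2 : ℝ)⁻¹ ^ k := by
    intro k hk hkn
    obtain ⟨h1, h2, h3⟩ := hpart k hk hkn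
    have h4 := h2 (τ k) ⟨le_rfl, h1⟩
    have hlk0 : 0 ≤ l (τ k) := le_trans (by positivity) h4.1
    -- One of the two factors `2⁻ᵏ` in `l²` absorbs the factor `k`; the other gives a geometric
    -- series starting at `2⁻ᵐ`, which is comparable to `l 0`.
    have h5 : (k : ℝ) * (2 : ℝ)⁻¹ ^ k ≤ 1 := by
      have : (k : ℝ) ≤ 2 ^ k := by exact_mod_cast Nat.lt_two_pow_self.le
      calc (k : ℝ) * (2 : ℝ)⁻¹ ^ k ≤ 2 ^ k * (2 : ℝ)⁻¹ ^ k := by gcongr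
        _ = 1 := by rw [← mul_pow]; norm_num
    calc _ ≤ A * k * l (τ k) ^ 2 := h3
      _ ≤ A * k * (A * (2 : ℝ)⁻¹ ^ k) ^ 2 := by gcongr; exact h4.2
      _ = A ^ 3 * (k * (2 : ℝ)⁻¹ ^ k) * (2 : ℝ)⁻¹ ^ k := by ring
      _ ≤ A ^ 3 * 1 * (2 : ℝ)⁻¹ ^ k := by gcongr
      _ = _ := by ring
  have hsum : ∀ k, m ≤ k → k ≤ n →
      τ k ≤ A ^ 3 * (2 * (2 : ℝ)⁻¹ ^ m - 2 * (2 : ℝ)⁻¹ ^ k) := by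
    intro k hk
    induction k, hk using Nat.le_induction with
    | base => intro _; rw [h0]; simp
    | succ k hk ih =>
      intro hkn
      have h1 := ih (by omega)
      have h2 := hstep k hk (by omega)
      rw [pow_succ (2 : ℝ)⁻¹]
      linarith
  have h1 := hsum n hmn.le le_rfl
  have h2 := (hpart m le_rfl hmn).2.1 (τ m) ⟨le_rfl, (hpart m le_rfl hmn).1⟩
  rw [h0] at h2
  have h3 : (2 : ℝ)⁻¹ ^ m ≤ A * L := by
    calc (2 : ℝ)⁻¹ ^ m = A * (A⁻¹ * (2 : ℝ)⁻¹ ^ m) := by field_simp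
      _ ≤ A * L := by gcongr; exact h2.1.trans hL
  have h4 : 0 ≤ 2 * (2 : ℝ)⁻¹ ^ n := by positivity
  calc τ n ≤ A ^ 3 * (2 * (2 : ℝ)⁻¹ ^ m - 2 * (2 : ℝ)⁻¹ ^ n) := h1
    _ ≤ A ^ 3 * (2 * (A * L)) := by gcongr; linarith
    _ = _ := by ring

/-! ### Smallness of the parameters -/

/-- `e^{-Γ^{-2/3}/4} ≤ Γ^{10}` for small `Γ`. -/
theorem exists_exp_le_pow : ∃ γ₀ : ℝ, 0 < γ₀ ∧ ∀ x : ℝ, 0 < x → x ≤ γ₀ → ∀ l : ℝ, 0 < l →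
    l ≤ Real.exp (-((1 / x) ^ (2 / 3 : ℝ))) → √(√l) ≤ x ^ 10 := by
  -- With `y = x^{-2/3}` the power `y¹⁵` equals `x^{-10}`. The limit is used at `y/4`, because the
  -- double square root divides the exponent by four, whence the threshold `(1/4)¹⁵`.
  have h1 := Real.tendsto_pow_mul_exp_neg_atTop_nhds_zero 15
  have h2 : Tendsto (fun x : ℝ => (1 / x) ^ (2 / 3 : ℝ) / 4) (𝓝[>] 0) atTop := by
    have := (tendsto_rpow_atTop (show (0 : ℝ) < 2 / 3 by norm_num)).comp
      (tendsto_inv_nhdsGT_zero (𝕜 := ℝ))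
    have := this.atTop_div_const (show (0 : ℝ) < 4 by norm_num)
    simpa [Function.comp_def] using this
  have h3 := (h1.comp h2).eventually (gt_mem_nhds (show (0 : ℝ) < (1 / 4) ^ 15 by positivity))
  rw [eventually_nhdsWithin_iff, Metric.eventually_nhds_iff] at h3
  obtain ⟨δ, hδ, hball⟩ := h3
  refine ⟨δ / 2, by positivity, fun x hx hxδ l hl hle => ?_⟩
  have h4 := hball (y := x) (by rw [Real.dist_eq, sub_zero, abs_of_pos hx]; linarith) hx
  simp only [Function.comp_apply] at h4
  set y := (1 / x) ^ (2 / 3 : ℝ)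
  have hy : y ^ 15 = (1 / x) ^ 10 := by
    rw [← Real.rpow_natCast y, ← Real.rpow_mul (by positivity), ← Real.rpow_natCast (1 / x)]
    norm_num
  have h5 : Real.exp (-(y / 4)) ≤ x ^ 10 := by
    rw [div_pow, hy, div_mul_eq_mul_div, div_lt_iff₀ (by positivity), ← mul_pow] at h4
    norm_num at h4
    rw [inv_mul_lt_iff₀ (by positivity)] at h4
    linarith
  refine le_trans ?_ h5
  rw [Real.sqrt_le_left (Real.exp_pos _).le, Real.sqrt_le_left (by positivity), ← Real.exp_nat_mul,
    ← Real.exp_nat_mul]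
  refine hle.trans (Real.exp_le_exp.2 (le_of_eq ?_))
  push_cast
  ring

/-- The crude inequality `e^{-π/b} ≤ b` already suffices. -/
theorem IsGammaLike.exists_small {Γ : ℝ → ℝ} (h : IsGammaLike Γ) {δ : ℝ} (hδ : 0 < δ) :
    ∃ β > 0, ∀ b, 0 < b → b < β → 0 < Γ b ∧ Γ b ≤ δ := by
  obtain ⟨c, hc, C, hC, bs, hbs, hb⟩ := h
  refine ⟨min bs (δ / C), by positivity, fun b hb0 hb1 => ?_⟩
  obtain ⟨h1, h2⟩ := hb b ⟨hb0, hb1.trans_le (min_le_left _ _)⟩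
  refine ⟨lt_of_lt_of_le (by positivity) h1, h2.trans ?_⟩
  have h3 : Real.exp (-Real.pi / b) ≤ b := by
    rw [neg_div, Real.exp_neg, inv_le_comm₀ (Real.exp_pos _) hb0]
    have h4 := Real.add_one_le_exp (Real.pi / b)
    have h5 : b⁻¹ ≤ Real.pi / b := by
      rw [inv_eq_one_div]
      gcongr
      linarith [Real.pi_gt_three]
    linarith
  calc C * Real.exp (-Real.pi / b) ≤ C * (δ / C) := by
        gcongr
        exact h3.trans (hb1.le.trans (min_le_right _ _))
    _ = δ := by field_simp

theorem norm_le_sum_abs (x : Sp d) : ‖x‖ ≤ ∑ j, |x j| := by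
  refine le_of_sq_le_sq ?_ (Finset.sum_nonneg fun _ _ => abs_nonneg _)
  rw [EuclideanSpace.norm_sq_eq]
  simp_rw [Real.norm_eq_abs]
  exact Finset.sum_sq_le_sq_sum_of_nonneg fun _ _ => abs_nonneg _

/-- For small `α`, the bootstrap regime controls a modulated function by its scale. -/
theorem exists_threshold (hd : d = 1 ∨ d = 2) {Q : Sp d → ℝ} (hQ : IsGroundState Q) {η : ℝ}
    {Qt : ℝ → Sp d → ℂ} (hQt : IsProfileFamily η Q Qt) {Γ : ℝ → ℝ} (hΓ : IsGammaLike Γ) {γ₀ : ℝ}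
    (hγ₀ : 0 < γ₀) :
    ∃ α > 0, ∃ g > 0, ∃ D > 0, ∀ b, 0 < b → b < α → 0 < Γ b ∧ Γ b ≤ γ₀ ∧ Γ b ≤ 1 ∧
      ∀ (ε u : H1 d) (l γ : ℝ) (x₀ : Sp d), ‖ε.fn‖ + b < α → localNormSq ε ≤ Γ b ^ (2 / 3 : ℝ) →
        0 < l → l ≤ 1 → IsModulated (Qt b) ε l x₀ γ u →
        g ≤ l * H1.gradNorm u ∧ l * H1.gradNorm u ≤ D ∧ l * ‖u‖ ≤ D ∧ l ^ 2 * ‖nl u‖ ≤ D := by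
  obtain ⟨bs, hbs, -, v, hv, hvQ⟩ := hQt.profile
  have hv0 : ∀ᵐ x, (v 0).fn x = (Q x : ℂ) := by
    filter_upwards [hvQ 0 ⟨le_rfl, hbs⟩] with x hx
    rw [hx, hQt.zero]
  have hg0 := gradNorm_pos_of_isGroundState hd hQ hv0
  set g := H1.gradNorm (v 0) / 4
  have hg : 0 < g := by positivity
  obtain ⟨D, hD, hmod⟩ := exists_modulated_bounds hd (‖v 0‖ + 1) (by positivity)
  -- The cube is chosen because `(g³)^{2/3} = g²`, so the local norm bound makes the gradient of `ε`
  -- at most `g`. Since `g` is a quarter of the gradient norm of `Q`, continuity keeps that of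
  -- `Q̃_b` above `2g`, and at least `g` survives the perturbation.
  obtain ⟨β, hβ, hsmall⟩ := hΓ.exists_small (δ := min γ₀ (min 1 (g ^ 3))) (by positivity)
  have hcont : ContinuousWithinAt v (Ico 0 bs) 0 := hv 0 ⟨le_rfl, hbs⟩
  have h1 : ∀ᶠ b in 𝓝[Ico 0 bs] 0, ‖v b‖ < ‖v 0‖ + 1 :=
    hcont.norm.eventually (gt_mem_nhds (by linarith))
  have h2 : ∀ᶠ b in 𝓝[Ico 0 bs] 0, 2 * g < H1.gradNorm (v b) :=
    (H1.continuous_gradNorm.continuousAt.comp_continuousWithinAt hcont).eventually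
      (lt_mem_nhds (by simp only [Function.comp_apply, g]; linarith))
  have h3 := h1.and h2
  rw [eventually_nhdsWithin_iff, Metric.eventually_nhds_iff] at h3
  obtain ⟨β', hβ', hball⟩ := h3
  refine ⟨min 1 (min bs (min β β')), by positivity, g, hg, D, hD, fun b hb hbα => ?_⟩
  simp only [lt_min_iff] at hbα
  obtain ⟨-, hbbs, hbβ, hbβ'⟩ := hbα
  obtain ⟨hΓ0, hΓ1⟩ := hsmall b hb hbβ
  simp only [le_min_iff] at hΓ1
  obtain ⟨hΓγ, hΓ1, hΓg⟩ := hΓ1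
  refine ⟨hΓ0, hΓγ, hΓ1, fun ε u l γ x₀ hε hloc hl hl1 hmodu => ?_⟩
  obtain ⟨hvb, hgb⟩ := hball (y := b) (by rwa [Real.dist_eq, sub_zero, abs_of_pos hb])
    ⟨hb.le, hbbs⟩
  have hε1 : ‖ε.fn‖ ≤ 1 := by
    have : ‖ε.fn‖ + b < 1 := hε.trans_le (min_le_left _ _)
    linarith
  have hgr := (H1.gradNorm_sq_le_localNormSq ε).trans hloc
  have hε2 : H1.gradNorm ε ≤ 1 := by
    refine le_of_sq_le_sq (hgr.trans ?_) zero_le_one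
    rw [one_pow]
    exact Real.rpow_le_one hΓ0.le hΓ1 (by norm_num)
  have hε3 : H1.gradNorm ε ≤ g := by
    refine le_of_sq_le_sq (hgr.trans ?_) hg.le
    calc Γ b ^ (2 / 3 : ℝ) ≤ (g ^ 3) ^ (2 / 3 : ℝ) :=
          Real.rpow_le_rpow hΓ0.le hΓg (by norm_num)
      _ = g ^ 2 := by
          rw [← Real.rpow_natCast g 3, ← Real.rpow_mul hg.le, ← Real.rpow_natCast g 2]
          norm_num
  exact hmod (Qt b) (v b) ε u l γ g x₀ (hvQ b ⟨hb.le, hbbs⟩) hvb.le hgb.le hε1 hε2 hε3 hl hl1 hmodu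

/-! ### Drift of energy and momentum in the bootstrap regime -/

/-- Energy and momentum bounds for a perturbed flow which concentrates along a dyadic partition. -/
theorem exists_energy_momentum_bound (hd : d = 1 ∨ d = 2) {A D K : ℝ} (hA : 0 < A) (hD : 0 < D) :
    ∃ C : ℝ, 1 ≤ C ∧ ∀ (u : ℝ → H1 d) (G : ℝ → L2 d) (l : ℝ → ℝ) (T : ℝ) (m n : ℕ) (τ : ℕ → ℝ),
      IsPerturbedFlow T K u G → |energy (u 0)| ≤ 1000 → ‖momentum (u 0)‖ ≤ 1000 →
      (∀ t ∈ Icc 0 T, 0 < l t ∧ l t ≤ 1 ∧ l t * ‖u t‖ ≤ D ∧ l t ^ 2 * ‖nl (u t)‖ ≤ D) →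
      (∀ t ∈ Icc 0 T, ∀ t' ∈ Icc 0 T, t ≤ t' → l t' ≤ 3 / 2 * l t) →
      m < n → τ m = 0 → τ n = T →
      (∀ k, m ≤ k → k < n → τ k ≤ τ (k + 1) ∧
        (∀ t ∈ Icc (τ k) (τ (k + 1)), A⁻¹ * (2 : ℝ)⁻¹ ^ k ≤ l t ∧ l t ≤ A * (2 : ℝ)⁻¹ ^ k) ∧
        τ (k + 1) - τ k ≤ A * k * l (τ k) ^ 2) →
      ∀ t ∈ Icc 0 T, l t ^ 2 * |energy (u t)| ≤ C * √(l t) ∧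
        l t * ‖momentum (u t)‖ ≤ C * √(l t) := by
  obtain ⟨C₁, hC₁, hint⟩ := exists_integral_le_sqrt A hA
  -- The constant is fixed before a flow is given, and only a flow guarantees that `K` is
  -- nonnegative.
  set K' := max K 0
  have hK' : 0 ≤ K' := le_max_right _ _
  refine ⟨1000 + 3 * K' * D ^ 2 * C₁ + d * (2 * K' * D ^ 2 * C₁), ?_, ?_⟩
  · have h1 : 0 ≤ 3 * K' * D ^ 2 * C₁ := by positivity
    have h2 : 0 ≤ d * (2 * K' * D ^ 2 * C₁) := by positivity
    linarith
  intro u G l T m n τ hflow hE hP hb hmono hmn h0 hn hpart t ht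
  have hKK : K' = K := max_eq_left hflow.K_nonneg
  have hut : ContinuousOn u (Icc 0 t) := hflow.cont.mono (Icc_subset_Icc_right ht.2)
  obtain ⟨hlt, hlt1, -, -⟩ := hb t ht
  have hsq : l t ≤ √(l t) := Real.le_sqrt_of_sq_le (by nlinarith)
  have hs0 : 0 ≤ √(l t) := Real.sqrt_nonneg _
  have hsT : ∀ s ∈ Icc 0 t, s ∈ Icc 0 T := fun s hs => ⟨hs.1, hs.2.trans ht.2⟩
  have e1 : 0 ≤ 3 * K' * D ^ 2 * C₁ := by positivity
  have e2 : 0 ≤ d * (2 * K' * D ^ 2 * C₁) := by positivity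
  constructor
  · have h1 := hflow.abs_energy_sub_le hd ht
    rw [← hKK] at h1
    have hg : ContinuousOn (fun s => l t ^ 2 * (K' * (‖u s‖ ^ 2 + ‖nl (u s)‖ * ‖u s‖)))
        (Icc 0 t) :=
      (((hut.norm.pow 2).add (((continuous_nl hd).comp_continuousOn hut).norm.mul
        hut.norm)).const_smul K').const_smul (l t ^ 2)
    have h2 := hint m n τ l _ T t (3 * K' * D ^ 2) hmn h0 hn hpart ht (by positivity) hg
      fun s hs => by
        obtain ⟨b1, b2, b3, b4⟩ := hb s (hsT s hs)
        have b5 := hmono s (hsT s hs) t ht hs.2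
        have c1 : l t * (l s * ‖u s‖) ^ 2 ≤ 1 * D ^ 2 := by gcongr
        -- The nonlinear part of the rate has size `l(s)⁻³`, one power more than the integration
        -- lemma admits. Almost monotonicity trades one of the two factors `l(t)` for the excess,
        -- and the other remains as the gain.
        have c2 : l t * ‖u s‖ ≤ 3 / 2 * D := by
          calc l t * ‖u s‖ ≤ 3 / 2 * l s * ‖u s‖ := by gcongr
            _ = 3 / 2 * (l s * ‖u s‖) := by ring
            _ ≤ 3 / 2 * D := by gcongr
        have c3 : (l t * ‖u s‖) * (l s ^ 2 * ‖nl (u s)‖) ≤ (3 / 2 * D) * D := by gcongr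
        calc _ = K' * l t * (l t * (l s * ‖u s‖) ^ 2
              + (l t * ‖u s‖) * (l s ^ 2 * ‖nl (u s)‖)) := by ring
          _ ≤ K' * l t * (1 * D ^ 2 + (3 / 2 * D) * D) := by gcongr
          _ ≤ K' * l t * (3 * D ^ 2) := by gcongr; nlinarith
          _ = _ := by ring
    rw [intervalIntegral.integral_const_mul] at h2
    have h3 : |energy (u t)| ≤ 1000 + |energy (u t) - energy (u 0)| := by
      have := abs_sub_abs_le_abs_sub (energy (u t)) (energy (u 0))
      linarith
    calc l t ^ 2 * |energy (u t)|
        ≤ l t ^ 2 * (1000 + |energy (u t) - energy (u 0)|) := by gcongr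
      _ = 1000 * l t ^ 2 + l t ^ 2 * |energy (u t) - energy (u 0)| := by ring
      _ ≤ 1000 * √(l t) + 3 * K' * D ^ 2 * C₁ * √(l t) := by
          have h4 : l t ^ 2 ≤ √(l t) := by nlinarith
          refine add_le_add (by gcongr) (le_trans ?_ h2)
          gcongr
      _ ≤ _ := by nlinarith [mul_nonneg e2 hs0]
  · have hg : ContinuousOn (fun s => l t * (2 * K' * ‖u s‖ ^ 2)) (Icc 0 t) :=
      ((hut.norm.pow 2).const_smul (2 * K')).const_smul (l t)
    have h2 := hint m n τ l _ T t (2 * K' * D ^ 2) hmn h0 hn hpart ht (by positivity) hg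
      fun s hs => by
        obtain ⟨b1, b2, b3, b4⟩ := hb s (hsT s hs)
        calc _ = 2 * K' * (l s * ‖u s‖) ^ 2 * l t := by ring
          _ ≤ 2 * K' * D ^ 2 * l t := by gcongr
    rw [intervalIntegral.integral_const_mul] at h2
    have h3 : ‖momentum (u t)‖ ≤ 1000 + ∑ k, |momentum (u t) k - momentum (u 0) k| := by
      have h4 := norm_le_sum_abs (momentum (u t) - momentum (u 0))
      have h5 := norm_sub_norm_le (momentum (u t)) (momentum (u 0))
      simp only [PiLp.sub_apply] at h4
      linarith
    have h6 : ∀ k, l t * |momentum (u t) k - momentum (u 0) k| ≤ 2 * K' * D ^ 2 * C₁ * √(l t) :=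
      fun k => by
        have := hflow.abs_momentum_sub_le hd ht k
        rw [← hKK] at this
        refine le_trans ?_ h2
        gcongr
    calc l t * ‖momentum (u t)‖
        ≤ l t * (1000 + ∑ k, |momentum (u t) k - momentum (u 0) k|) := by gcongr
      _ = 1000 * l t + ∑ k, l t * |momentum (u t) k - momentum (u 0) k| := by
          rw [mul_add, Finset.mul_sum]; ring
      _ ≤ 1000 * √(l t) + ∑ _k : Fin d, 2 * K' * D ^ 2 * C₁ * √(l t) := by
          exact add_le_add (by gcongr) (Finset.sum_le_sum fun k _ => h6 k)
      _ = 1000 * √(l t) + d * (2 * K' * D ^ 2 * C₁) * √(l t) := by simp; ring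
      _ ≤ _ := by nlinarith [mul_nonneg e1 hs0]

end LogLogNLS

end

/-! ### Choice of constants and conclusion -/

open LogLogNLS in
theorem lemma2p4 (d : ℕ) (hd : d = 1 ∨ d = 2)
    (Q : Sp d → ℝ) (hQ : IsGroundState Q)
    (η : ℝ) (hη : η ∈ Set.Ioo (0 : ℝ) 1)
    (Qt : ℝ → Sp d → ℂ) (hQt : IsProfileFamily η Q Qt)
    (Γ : ℝ → ℝ) (hΓ : IsGammaLike Γ) :
    ∃ α : ℝ, 0 < α ∧ ∀ K A : ℝ, 0 < K → 0 < A → ∃ ls : ℝ, 0 < ls ∧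
      ∀ (N : ℕ) (φ : Fin N → 𝓢(Sp d, ℝ)) (B : Fin N → ℝ → ℝ),
        (∀ k, ContinuousOn (B k) (Set.Ici 0)) → CoeffBound φ B K →
      ∀ (T₁ : ℝ) (u : ℝ → H1 d), 0 < T₁ → IsMildSolution φ B T₁ u →
      ∀ (b₀ l₀ : ℝ) (ε₀ : H1 d), IsInitialDatum α Γ Qt b₀ l₀ ε₀ (u 0) → l₀ ≤ ls →
      ∀ (b l γ : ℝ → ℝ) (x₀ : ℝ → Sp d) (ε : ℝ → H1 d),
        (∀ t ∈ Set.Icc 0 T₁, IsModulated (Qt (b t)) (ε t) (l t) (x₀ t) (γ t) (u t)) →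
        (∀ t ∈ Set.Icc 0 T₁, IsOrthogonal (Qt (b t)) (ε t)) →
        IsBootstrap α A Γ T₁ b l ε →
      ∀ t ∈ Set.Icc 0 T₁,
        l t ^ 2 * |energy (u t)| ≤ Γ (b t) ^ 10 ∧ l t * ‖momentum (u t)‖ ≤ Γ (b t) ^ 10 := by
  obtain ⟨γ₀, hγ₀, hexp⟩ := exists_exp_le_pow
  obtain ⟨α, hα, g, hg, D, hD, hthr⟩ := exists_threshold hd hQ hQt hΓ hγ₀
  refine ⟨α, hα, fun K A hK hA => ?_⟩
  obtain ⟨C, hC, hbound⟩ := exists_energy_momentum_bound (d := d) hd (K := linConst d * K) hA hD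
  have hC0 : 0 < C := by linarith
  -- The first bound lets `l^{1/4}` absorb the constant `C`; the second forces the lifetime to be at
  -- most one, so that the coefficient bounds on `[0, 1]` apply.
  set L : ℝ := min ((C⁻¹) ^ 4) (2 * A ^ 4)⁻¹
  have hL : 0 < L := by positivity
  -- The factor `2/3` anticipates the almost monotonicity constant `3/2`, and `g / D` the comparison
  -- between `l₀` and `l 0`.
  refine ⟨L * (2 / 3 * (g / D)), by positivity, ?_⟩
  intro N φ B hB hφ T₁ u hT hu b₀ l₀ ε₀ hinit hl₀ b l γ x₀ ε hmod _ hboot t ht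
  have hexp1 : ∀ x : ℝ, ∀ r : ℝ, 0 ≤ x → Real.exp (-(x ^ r)) ≤ 1 := fun x r hx =>
    Real.exp_le_one_iff.2 (neg_nonpos.2 (Real.rpow_nonneg hx _))
  have hbt : ∀ s ∈ Set.Icc 0 T₁, b s < α := fun s hs => by
    have := hboot.small s hs
    linarith [norm_nonneg (ε s).fn]
  have hl1 : ∀ s ∈ Set.Icc 0 T₁, l s ≤ 1 := fun s hs =>
    (hboot.l_le s hs).trans (hexp1 _ _ (by
      have := (hthr (b s) (hboot.b_pos s hs) (hbt s hs)).1
      positivity))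
  have hsize : ∀ s ∈ Set.Icc 0 T₁, g ≤ l s * H1.gradNorm (u s) ∧ l s * H1.gradNorm (u s) ≤ D ∧
      l s * ‖u s‖ ≤ D ∧ l s ^ 2 * ‖nl (u s)‖ ≤ D := fun s hs =>
    (hthr (b s) (hboot.b_pos s hs) (hbt s hs)).2.2.2 (ε s) (u s) (l s) (γ s) (x₀ s)
      (hboot.small s hs) (hboot.local_le s hs) (hboot.l_pos s hs) (hl1 s hs) (hmod s hs)
  have h0T : (0 : ℝ) ∈ Set.Icc 0 T₁ := ⟨le_rfl, hT.le⟩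
  have hb₀ : b₀ < α := by
    have := hinit.small
    linarith [norm_nonneg ε₀.fn]
  obtain ⟨hΓ₀, -, hΓ₀1, hthr₀⟩ := hthr b₀ hinit.b_pos hb₀
  -- Since `Γ ≤ 1`, the initial exponent `4/5` implies the bound with `2/3` required by the
  -- threshold lemma.
  have hsize₀ := hthr₀ ε₀ (u 0) l₀ 0 0 hinit.small
    (hinit.local_le.trans (Real.rpow_le_rpow_of_exponent_ge hΓ₀ hΓ₀1 (by norm_num)))
    hinit.l_pos (hinit.l_le.trans (hexp1 _ _ (by positivity))) hinit.form
  -- The parameters of the initial decomposition are not assumed equal to those of the modulated one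
  -- at time zero. Both describe the same function, whose gradient norm determines either scale up
  -- to the ratio `D / g`.
  have hl0 : 3 / 2 * l 0 ≤ L := by
    have h1 := (hsize 0 h0T).2.1
    have h2 := hsize₀.1
    have h3 := hboot.l_pos 0 h0T
    have h4 := hinit.l_pos
    have h5 : l 0 * g ≤ l₀ * D := by
      calc l 0 * g ≤ l 0 * (l₀ * H1.gradNorm (u 0)) := by gcongr
        _ = l₀ * (l 0 * H1.gradNorm (u 0)) := by ring
        _ ≤ l₀ * D := by gcongr
    have h6 : l₀ * D ≤ L * (2 / 3 * g) := by
      calc l₀ * D ≤ L * (2 / 3 * (g / D)) * D := by gcongr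
        _ = L * (2 / 3 * g) := by field_simp
    have h7 : (3 / 2 * l 0) * g ≤ L * g := by linarith
    exact le_of_mul_le_mul_right h7 hg
  have hl0' : l 0 ≤ L := by
    have := hboot.l_pos 0 h0T
    linarith
  obtain ⟨m, n, τ, hmn, hτm, hτn, hpart⟩ := hboot.partition
  -- An empty partition would force `T₁ = 0`.
  have hmn' : m < n := by
    refine lt_of_le_of_ne hmn fun h => ?_
    rw [← h, hτm] at hτn
    linarith
  have hT1 : T₁ ≤ 1 := by
    rw [← hτn]
    refine (length_le_of_partition hA hmn' hτm hpart hl0').trans ?_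
    calc 2 * A ^ 4 * L ≤ 2 * A ^ 4 * (2 * A ^ 4)⁻¹ := by gcongr; exact min_le_right _ _
      _ = 1 := mul_inv_cancel₀ (by positivity)
  obtain ⟨G, hflow⟩ := hu.exists_isPerturbedFlow hd hK.le hB hφ hT1
  obtain ⟨hE, hP⟩ := hbound u G l T₁ m n τ hflow hinit.energy_le hinit.momentum_le
    (fun s hs => ⟨hboot.l_pos s hs, hl1 s hs, (hsize s hs).2.2.1, (hsize s hs).2.2.2⟩)
    hboot.almost_mono hmn' hτm hτn hpart t ht
  have hlt := hboot.l_pos t ht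
  have hltL : l t ≤ (C⁻¹) ^ 4 :=
    ((hboot.almost_mono 0 h0T t ht ht.1).trans hl0).trans (min_le_left _ _)
  obtain ⟨hΓt, hΓγ, -, -⟩ := hthr (b t) (hboot.b_pos t ht) (hbt t ht)
  have hroot : √(√(l t)) ≤ Γ (b t) ^ 10 := hexp _ hΓt hΓγ _ hlt (hboot.l_le t ht)
  -- Writing `√l` as the square of `l^{1/4}`, one factor cancels `C` and the other is bounded by
  -- `Γ¹⁰`.
  have hfin : C * √(l t) ≤ Γ (b t) ^ 10 := by
    refine le_trans ?_ hroot
    have h1 : √(√(l t)) ≤ C⁻¹ := by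
      rw [Real.sqrt_le_left (by positivity), Real.sqrt_le_left (by positivity), ← pow_mul]
      exact hltL
    calc C * √(l t) = C * (√(√(l t)) * √(√(l t))) := by
          rw [Real.mul_self_sqrt (Real.sqrt_nonneg _)]
      _ ≤ C * (C⁻¹ * √(√(l t))) := by gcongr
      _ = √(√(l t)) := by field_simp
  exact ⟨hE.trans hfin, hP.trans hfin⟩
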